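/- Let $G$ be a finite simple graph. An \emph{embedding} $\Gamma$ of $G$ in the plane (crossings allowed) maps the vertices to distinct points and every edge to a curve between its end vertices, such that no edge meets a vertex other than its endpoints and no three distinct edges meet in a common point that is not a vertex. Here edges are piecewise regular curves: continuous curves that can be subdivided into finitely many $C^1$ pieces, each with nowhere vanishing velocity (one-sided at its ends). For instance, polygonal curves are allowed. $\Gamma$ is \emph{oddly embedded around} a point $p$ if $p$ lies on no vertex or edge of $\Gamma$ and every cycle of $G$ has odd length if and only if the corresponding closed curve has odd winding number around $p$. An \emph{odd Euler path} for $\Gamma$ is a curve $T$ in the plane that goes through no vertex of $\Gamma$ and crosses every edge of $\Gamma$ an odd number of times: $T$ meets each edge only finitely often (counted by pairs of parameters), each meeting is a transversal crossing (both velocities exist and are linearly independent), and their number is odd. The \emph{outer face} is the unbounded connected component of the complement of $\Gamma$. \textbf{Lemma.} Let $p$ be a point in the plane and let $\Gamma$ be a graph oddly embedded around $p$. Then there is an odd Euler path for $\Gamma$ that starts at $p$ and ends in the outer face. Moreover, such a path can be computed in polynomial time: there is an algorithm that, given a point $p$ and an embedded graph $\Gamma$ with polygonal edges, described by the coordinates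 of $p$, of the vertices, and of the successive corners of every edge (all rational), runs in time polynomial in the bit length of its input, and that outputs, whenever $\Gamma$ is oddly embedded around $p$, the successive (rational) corners of a polygonal odd Euler path for $\Gamma$ that starts at $p$ and ends in the outer face. (Algorithms are programs in a first-order language with rational arithmetic, pairs, lists, case distinction and iteration over lists, where every executed instruction costs one plus the bit lengths of its input and output.) -/

import Mathlib

open Set unitInterval

namespace OddEuler

/-! ### Curves in the plane

The plane is `ℂ`; a curve from `a` to `b` is a `Path a b`, parametrised by `[0, 1]`. -/

/-- A piecewise regular `C¹` curve: for some subdivision `0 = τ 0 < τ 1 < ⋯ < τ n = 1`, the curve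
is `C¹` on every closed piece, with nowhere vanishing (at the ends: one-sided) velocity. -/
def PiecewiseRegular {a b : ℂ} (γ : Path a b) : Prop :=
  ∃ (n : ℕ) (τ : ℕ → ℝ), τ 0 = 0 ∧ τ n = 1 ∧ ∀ i < n, τ i < τ (i + 1) ∧
    ContDiffOn ℝ 1 γ.extend (Icc (τ i) (τ (i + 1))) ∧
    ∀ t ∈ Icc (τ i) (τ (i + 1)), derivWithin γ.extend (Icc (τ i) (τ (i + 1))) t ≠ 0

/-- `n` is the winding number of the closed curve `γ` around `p`: along a continuous choice `θ` of
the argument of `γ - p`, the total change of argument is `2πn`. (If `p` is not on `γ`, there is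
exactly one such `n`.) -/
def IsWindingNumber {x : ℂ} (γ : Path x x) (p : ℂ) (n : ℤ) : Prop :=
  ∃ θ : C(I, ℝ),
    (∀ t, γ t - p = (‖γ t - p‖ : ℂ) * Complex.exp ((θ t : ℂ) * Complex.I)) ∧
    θ 1 - θ 0 = 2 * Real.pi * n

/-- The pairs of parameters at which the curves `T` and `γ` meet. -/
def meets {a b c d : ℂ} (T : Path a b) (γ : Path c d) : Set (I × I) :=
  {x | T x.1 = γ x.2}

/-- At parameter `t` of `T` and parameter `s` of `γ` both curves have velocities, and these are
linearly independent: the two curves cross transversally. -/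
def CrossesAt {a b c d : ℂ} (T : Path a b) (γ : Path c d) (t s : I) : Prop :=
  ∃ v w : ℂ, HasDerivAt T.extend v (t : ℝ) ∧ HasDerivAt γ.extend w (s : ℝ) ∧
    LinearIndependent ℝ ![v, w]

/-- `T` crosses `γ` an odd number of times: they meet finitely often, every meeting is a
transversal crossing, and the number of crossings is odd. -/
def CrossesOddly {a b c d : ℂ} (T : Path a b) (γ : Path c d) : Prop :=
  (meets T γ).Finite ∧ (∀ x ∈ meets T γ, CrossesAt T γ x.1 x.2) ∧ Odd (meets T γ).ncard

/-- The last vertex of the polygonal curve through `a` and then the points of the list. -/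
def lastPoint : ℂ → List ℂ → ℂ
  | a, [] => a
  | _, b :: L => lastPoint b L

/-- The polygonal curve that starts at `a` and runs through the points of the list, in order. -/
noncomputable def polyPath : (a : ℂ) → (L : List ℂ) → Path a (lastPoint a L)
  | a, [] => Path.refl a
  | a, [b] => Path.segment a b
  | a, b :: c :: L => (Path.segment a b).trans (polyPath b (c :: L))

/-! ### Embedded graphs -/

/-- A (not necessarily crossing-free) embedding of the graph `G` into the plane: vertices go to
distinct points, edges are piecewise regular curves between their end vertices that do not meet
other vertices, and no three distinct edges cross in a common point. An edge has one curve,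
which the two orientations of the edge traverse in opposite directions. -/
structure Embedding {V : Type*} (G : SimpleGraph V) where
  pos : V → ℂ
  pos_injective : Function.Injective pos
  curve : ∀ {u v : V}, G.Adj u v → Path (pos u) (pos v)
  curve_symm : ∀ {u v : V} (h : G.Adj u v), curve h.symm = (curve h).symm
  regular : ∀ {u v : V} (h : G.Adj u v), PiecewiseRegular (curve h)
  avoids : ∀ {u v : V} (h : G.Adj u v) (w : V), w ≠ u → w ≠ v → ∀ t, curve h t ≠ pos w
  no_triple : ∀ {u₁ v₁ u₂ v₂ u₃ v₃ : V} (h₁ : G.Adj u₁ v₁) (h₂ : G.Adj u₂ v₂) (h₃ : G.Adj u₃ v₃),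
    s(u₁, v₁) ≠ s(u₂, v₂) → s(u₁, v₁) ≠ s(u₃, v₃) → s(u₂, v₂) ≠ s(u₃, v₃) →
    ∀ t₁ t₂ t₃ : I, curve h₁ t₁ = curve h₂ t₂ → curve h₁ t₁ = curve h₃ t₃ →
      curve h₁ t₁ ∈ range pos

namespace Embedding

variable {V : Type*} {G : SimpleGraph V} (Γ : Embedding G)

/-- The set of all points on vertices and edges. -/
def image : Set ℂ :=
  range Γ.pos ∪ {z | ∃ (u v : V) (h : G.Adj u v) (t : I), Γ.curve h t = z}

/-- The outer face: the points off the embedded graph whose component in the complement of the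
embedded graph is unbounded. -/
def outerFace : Set ℂ :=
  {z | z ∈ Γ.imageᶜ ∧ ¬ Bornology.IsBounded (connectedComponentIn Γ.imageᶜ z)}

/-- The curve in the plane that corresponds to a walk in the graph. -/
noncomputable def walkCurve : {u v : V} → G.Walk u v → Path (Γ.pos u) (Γ.pos v)
  | _, _, .nil => Path.refl _
  | _, _, .cons h W => (Γ.curve h).trans (walkCurve W)

/-- `Γ` is an odd embedding around `p`: the point `p` is not on a vertex or edge, and every cycle
has odd length if and only if the corresponding closed curve has odd winding number around `p`. -/
def IsOddAround (p : ℂ) : Prop :=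
  p ∉ Γ.image ∧ ∀ (v : V) (c : G.Walk v v), c.IsCycle →
    ∀ n : ℤ, IsWindingNumber (Γ.walkCurve c) p n → (Odd c.length ↔ Odd n)

/-- `T` is an odd Euler path: it does not go through any vertex, and it crosses every edge an odd
number of times. -/
def IsOddEulerPath {a b : ℂ} (T : Path a b) : Prop :=
  (∀ (t : I) (v : V), T t ≠ Γ.pos v) ∧
  ∀ {u v : V} (h : G.Adj u v), CrossesOddly T (Γ.curve h)

end Embedding

/-! ### A model of computation with bit costs

Data are built from rational numbers by pairs and finite lists. Programs form a first-order language
with rational arithmetic, case distinction and bounded iteration over a list. Each executed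
instruction is charged one plus the total bit length of its input and of its output. -/

/-- The data types of the language. -/
inductive Ty : Type
  | rat : Ty
  | prod : Ty → Ty → Ty
  | list : Ty → Ty

/-- The values of a data type. -/
@[reducible] def Ty.Val : Ty → Type
  | .rat => ℚ
  | .prod a b => a.Val × b.Val
  | .list a => List a.Val

/-- The bit length of a value; rationals are written in binary, in lowest terms. -/
def Ty.size : (a : Ty) → a.Val → ℕ
  | .rat, q => 2 + Nat.size (Int.natAbs q.num) + Nat.size q.den
  | .prod a b, x => 1 + a.size x.1 + b.size x.2
  | .list a, l => 1 + (l.map fun x => 1 + a.size x).sum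

/-- Programs that take an input of the first type to an output of the second. -/
inductive Prog : Ty → Ty → Type
  | id {a : Ty} : Prog a a
  | comp {a b c : Ty} (g : Prog b c) (f : Prog a b) : Prog a c
  | pair {a b c : Ty} (f : Prog a b) (g : Prog a c) : Prog a (.prod b c)
  | fst {a b : Ty} : Prog (.prod a b) a
  | snd {a b : Ty} : Prog (.prod a b) b
  | const {a : Ty} (q : ℚ) : Prog a .rat
  | add : Prog (.prod .rat .rat) .rat
  | sub : Prog (.prod .rat .rat) .rat
  | mul : Prog (.prod .rat .rat) .rat
  | div : Prog (.prod .rat .rat) .rat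
  | nil {a b : Ty} : Prog a (.list b)
  | cons {a : Ty} : Prog (.prod a (.list a)) (.list a)
  | ifPos {a b : Ty} (c : Prog a .rat) (f g : Prog a b) : Prog a b
  | fold {a b : Ty} (f : Prog (.prod b a) b) : Prog (.prod b (.list a)) b

/-- The result of running a program on an input. `ifPos c f g` runs `f` if the value of `c` is
positive and `g` otherwise; `fold f` updates a state by `f`, once for each element of a list. -/
def Prog.eval : {a b : Ty} → Prog a b → a.Val → b.Val
  | _, _, .id, x => x
  | _, _, .comp g f, x => g.eval (f.eval x)
  | _, _, .pair f g, x => (f.eval x, g.eval x)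
  | _, _, .fst, x => x.1
  | _, _, .snd, x => x.2
  | _, _, .const q, _ => q
  | _, _, .add, x => x.1 + x.2
  | _, _, .sub, x => x.1 - x.2
  | _, _, .mul, x => x.1 * x.2
  | _, _, .div, x => x.1 / x.2
  | _, _, .nil, _ => []
  | _, _, .cons, x => x.1 :: x.2
  | _, _, .ifPos c f g, x => if 0 < c.eval x then f.eval x else g.eval x
  | _, _, .fold f, x => x.2.foldl (fun s y => f.eval (s, y)) x.1

/-- The running time of a program on an input: every instruction, each time it is executed, costs
one plus the bit lengths of its input and its output, and a compound instruction costs in addition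
what the parts that it executes cost. -/
def Prog.time : {a b : Ty} → Prog a b → a.Val → ℕ
  | a, b, F, x => 1 + a.size x + b.size (F.eval x) + match a, b, F, x with
    | _, _, .comp g f, x => f.time x + g.time (f.eval x)
    | _, _, .pair f g, x => f.time x + g.time x
    | _, _, .ifPos c f g, x => c.time x + if 0 < c.eval x then f.time x else g.time x
    | _, _, .fold f, x =>
        (x.2.foldl (fun s y => (f.eval (s.1, y), s.2 + f.time (s.1, y))) (x.1, 0)).2
    | _, _, _, _ => 0

/-- A point of the plane with rational coordinates. -/
abbrev Ty.point : Ty := .prod .rat .rat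

/-- An input: the point `p`, the list of vertices, and the list of edges, where an edge is a
polygonal curve, given by its first point and the list of its further points. -/
abbrev Ty.drawing : Ty := .prod .point (.prod (.list .point) (.list (.prod .point (.list .point))))

/-- The point of the plane with the given rational coordinates. -/
noncomputable def toPlane (q : Ty.point.Val) : ℂ := ⟨(q.1 : ℝ), (q.2 : ℝ)⟩

/-- The data `vs` (vertices) and `es` (edges) describe the embedded graph `Γ`: `vs` lists the
positions of the vertices, every entry of `es` is a polygonal curve that represents an edge, and
every edge is represented, in one of its two directions. -/
structure Describes (vs : List Ty.point.Val) (es : List (Ty.point.Val × List Ty.point.Val))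
    {n : ℕ} {G : SimpleGraph (Fin n)} (Γ : Embedding G) : Prop where
  vertices : vs.map toPlane = List.ofFn Γ.pos
  edges : ∀ e ∈ es, ∃ (u v : Fin n) (h : G.Adj u v),
    (Γ.curve h : I → ℂ) = polyPath (toPlane e.1) (e.2.map toPlane)
  complete : ∀ (u v : Fin n) (h : G.Adj u v), ∃ e ∈ es,
    (Γ.curve h : I → ℂ) = polyPath (toPlane e.1) (e.2.map toPlane) ∨
    (Γ.curve h.symm : I → ℂ) = polyPath (toPlane e.1) (e.2.map toPlane)

end OddEuler

/-! Everything is counted modulo two, with lines of one fixed direction `m + i`. Choose the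
direction so that the ray from `p` crosses all edges transversally. Along a closed curve the number
of crossings with this ray has the parity of the winding number around `p`
(`natCast_ncard_hits_slantRay`). Hence odd embeddedness makes the edge weight "1 + crossings with
the ray" sum to zero over every cycle (`IsOddAround.sum_cycle`). A weight in `ZMod 2` that vanishes
on cycles is a coboundary (`exists_potential`): it equals `g u + g v` on each edge `uv`, for some
function `g` on the vertices.

The path follows the ray up to a height `Y` above the drawing. The edges crossed evenly so far are
those with `g u ≠ g v`. For every vertex with `g = 1` the path then goes down a line just to one
side of the vertex and up a line just to the other side, with turns at the heights `-Y` and `Y`,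
outside the drawing. An edge crosses these two lines an odd number of times in all if and only if
exactly one of its ends lies between them (`TransverseLine.natCast_ncard_hits`). So these boxes
contribute `g u + g v` and correct all parities at once (`Transverse.isOddEulerPath_of_isolates`).
The end of the path has height `Y`, hence is in the outer face.

For general curves, suitable directions and offsets exist by measure: finitely many values are bad
because of break points, and the critical values of a real function form a null set.

For polygonal edges, a line is transversal as soon as it avoids all corners, so an explicit rational
slope, margin and height suffice. The potential is found, as signs, by merging classes of vertices
along the edges while recording the sign of each vertex relative to its class (`Drawing.merge`). The
invariant `Compatible` compares these signs with a potential that is known to exist. The time bound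
follows from closure properties of `PolyTime`. The delicate construct is iteration, which could
double bit lengths at every step; in the folds used here the states are copied data, signs, or
concatenations of controlled length. -/

namespace OddEuler

open Filter Topology

/-! ### Slanted lines and transversality -/

/-- The linear functional whose level sets are the lines of direction `m + i`. -/
noncomputable def slant (m : ℝ) : ℂ →L[ℝ] ℝ := Complex.reCLM - m • Complex.imCLM

lemma slant_apply (m : ℝ) (z : ℂ) : slant m z = z.re - m * z.im := by simp [slant]

/-- The line `slant m = c` does not contain the ends of `γ` and is crossed transversally by `γ`. -/
structure TransverseLine (m c : ℝ) {a b : ℂ} (γ : Path a b) : Prop where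
  left : slant m a ≠ c
  right : slant m b ≠ c
  transverse : ∀ s : I, slant m (γ s) = c → ∃ w, HasDerivAt γ.extend w (s : ℝ) ∧ slant m w ≠ 0

lemma hasDerivAt_slant_extend {m : ℝ} {a b : ℂ} {γ : Path a b} {w : ℂ} {s : ℝ}
    (h : HasDerivAt γ.extend w s) : HasDerivAt (fun t => slant m (γ.extend t)) (slant m w) s :=
  (slant m).hasFDerivAt.comp_hasDerivAt s h

lemma hasDerivAt_extend_symm {a b : ℂ} {γ : Path a b} {w : ℂ} {s : ℝ}
    (h : HasDerivAt γ.extend w (1 - s)) : HasDerivAt γ.symm.extend (-w) s := by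
  rw [Path.extend_symm]
  have := HasDerivAt.scomp s h ((hasDerivAt_id s).const_sub 1)
  rw [neg_one_smul] at this
  exact this

lemma TransverseLine.symm {m c : ℝ} {a b : ℂ} {γ : Path a b} (h : TransverseLine m c γ) :
    TransverseLine m c γ.symm where
  left := h.right
  right := h.left
  transverse s hs := by
    obtain ⟨w, hw, hw0⟩ := h.transverse (unitInterval.symm s) hs
    exact ⟨-w, hasDerivAt_extend_symm (by simpa using hw), by simpa using hw0⟩

lemma extend_eq_of_coe_eq {a b c d : ℂ} {γ : Path a b} {δ : Path c d}
    (h : (γ : I → ℂ) = δ) (t : ℝ) : γ.extend t = δ.extend t := by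
  change γ _ = δ _
  rw [h]

lemma TransverseLine.congr {m c : ℝ} {a b a' b' : ℂ} {γ : Path a b} {δ : Path a' b'}
    (h : TransverseLine m c γ) (hγ : (δ : I → ℂ) = γ) : TransverseLine m c δ where
  left := by rw [← δ.source, hγ, γ.source]; exact h.left
  right := by rw [← δ.target, hγ, γ.target]; exact h.right
  transverse s hs := by
    rw [hγ] at hs
    obtain ⟨w, hw, hw0⟩ := h.transverse s hs
    refine ⟨w, ?_, hw0⟩
    rwa [show (δ.extend : ℝ → ℂ) = γ.extend from funext (extend_eq_of_coe_eq hγ)]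

/-- An infinite set of meeting parameters would accumulate at one of its points, but a nonzero
derivative of `slant m` along the curve isolates each of them. -/
lemma TransverseLine.finite {m c : ℝ} {a b : ℂ} {γ : Path a b} (h : TransverseLine m c γ) :
    {s : I | slant m (γ s) = c}.Finite := by
  have hcl : IsClosed {s : I | slant m (γ s) = c} :=
    isClosed_eq ((slant m).continuous.comp γ.continuous) continuous_const
  by_contra hinf
  obtain ⟨s, hs, hacc⟩ := Set.Infinite.exists_accPt_of_subset_isCompact hinf hcl.isCompact
    subset_rfl
  obtain ⟨w, hw, hw0⟩ := h.transverse s hs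
  have h1 := (hasDerivAt_slant_extend (m := m) hw).eventually_ne (c := c) hw0
  rw [eventually_nhdsWithin_iff] at h1
  rw [accPt_iff_frequently] at hacc
  obtain ⟨t, ⟨hts, htc⟩, ht⟩ := (hacc.and_eventually
    (continuous_subtype_val.continuousAt.eventually h1)).exists
  have hne : (t : ℝ) ∈ ({(s : ℝ)}ᶜ : Set ℝ) := fun h => hts (Subtype.ext h)
  have := ht hne
  rw [Path.extend_extends'] at this
  exact this htc

/-! ### Parity of the number of jumps -/

lemma eq_add_card_of_jumps (F : Finset ℝ) (f : ℝ → ZMod 2)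
    (hloc : ∀ s ∉ F, ∀ᶠ t in 𝓝 s, f t = f s)
    (hjump : ∀ s ∈ F, ∃ c, (∀ᶠ t in 𝓝[<] s, f t = c) ∧ ∀ᶠ t in 𝓝[>] s, f t = c + 1)
    {a b : ℝ} (hF : ∀ s ∈ F, a < s ∧ s < b) : f b = f a + F.card := by
  choose! c hl hr using hjump
  let N : ℝ → ZMod 2 := fun t => ((F.filter (· < t)).card : ZMod 2)
  -- The value of `f` at a jump is arbitrary, so it is replaced by the limit from the left. This
  -- fits `N`, which does not yet count a jump located at `t` itself.
  let g : ℝ → ZMod 2 := fun t => (if t ∈ F then c t else f t) + N t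
  have hnear : ∀ s, ∃ ε > 0, ∀ x ∈ F, x ≠ s → ε ≤ |x - s| := fun s => by
    have := (F.finite_toSet.subset (Set.sdiff_subset (t := {s}))).isClosed.isOpen_compl.mem_nhds
      (x := s) (by simp)
    obtain ⟨ε, hε, hball⟩ := Metric.mem_nhds_iff.1 this
    refine ⟨ε, hε, fun x hx hxs => ?_⟩
    by_contra! hlt
    exact hball (a := x) (by simpa [Real.dist_eq] using hlt) ⟨hx, hxs⟩
  have hg : IsLocallyConstant g := by
    rw [IsLocallyConstant.iff_eventually_eq]
    intro s
    obtain ⟨ε, hε, hFε⟩ := hnear s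
    have hle : ∀ t, |t - s| < ε → t ≤ s → N t = N s := fun t ht hts => by
      simp only [N]
      congr 2
      refine Finset.filter_congr fun x hx => ⟨fun h => h.trans_le hts, fun h => ?_⟩
      have := hFε x hx h.ne
      rw [abs_of_nonpos (by linarith)] at this
      rw [abs_of_nonpos (by linarith)] at ht
      linarith
    have hgt : ∀ t, |t - s| < ε → s < t → N t = N s + if s ∈ F then 1 else 0 := fun t ht hts => by
      have hsplit : F.filter (· < t) = F.filter (· < s) ∪ F.filter (· = s) := by
        rw [← Finset.filter_or]
        refine Finset.filter_congr fun x hx => ⟨fun h => ?_, fun h => ?_⟩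
        · by_contra! hx2
          have := hFε x hx hx2.2
          rw [abs_of_nonneg (by linarith)] at this
          rw [abs_of_pos (by linarith)] at ht
          linarith
        · rcases h with h | h <;> linarith
      have hdis : Disjoint (F.filter (· < s)) (F.filter (· = s)) := by
        rw [Finset.disjoint_filter]
        exact fun x _ h h' => h.ne h'
      simp only [N]
      rw [hsplit, Finset.card_union_of_disjoint hdis, Finset.filter_eq']
      split_ifs <;> simp
    have hball : ∀ᶠ t in 𝓝 s, |t - s| < ε := by
      have := Metric.ball_mem_nhds s hε
      filter_upwards [this] with t ht
      simpa [Real.dist_eq] using ht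
    have hoff : ∀ t, |t - s| < ε → t ≠ s → t ∉ F := fun t ht hts htF =>
      absurd (hFε t htF hts) (not_le.2 ht)
    by_cases hs : s ∈ F
    · have e1 : ∀ᶠ t in 𝓝 s, t < s → f t = c s := eventually_nhdsWithin_iff.1 (hl s hs)
      have e2 : ∀ᶠ t in 𝓝 s, s < t → f t = c s + 1 := eventually_nhdsWithin_iff.1 (hr s hs)
      filter_upwards [e1, e2, hball] with t h1 h2 hb
      rcases lt_trichotomy t s with hts | rfl | hts
      · simp only [g, hs, hoff t hb hts.ne, if_true, if_false, h1 hts, hle t hb hts.le]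
      · rfl
      · simp only [g, hs, hoff t hb hts.ne', if_true, if_false, h2 hts, hgt t hb hts]
        linear_combination (CharTwo.add_self_eq_zero (1 : ZMod 2))
    · filter_upwards [hloc s hs, hball] with t h1 hb
      have ht : t ∉ F := fun h => by
        rcases eq_or_ne t s with rfl | hts
        · exact hs h
        · exact hoff t hb hts h
      simp only [g, hs, ht, if_false, h1]
      rcases le_or_gt t s with hts | hts
      · rw [hle t hb hts]
      · rw [hgt t hb hts, if_neg hs, add_zero]
  have := hg.apply_eq_of_isPreconnected isPreconnected_univ (mem_univ b) (mem_univ a)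
  have ha : a ∉ F := fun h => (hF a h).1.false
  have hb : b ∉ F := fun h => (hF b h).2.false
  have hNa : N a = 0 := by
    simp only [N]
    rw [Finset.filter_false_of_mem fun s hs => (hF s hs).1.not_gt]; simp
  have hNb : N b = F.card := by
    simp only [N]
    rw [Finset.filter_true_of_mem fun s hs => (hF s hs).2]
  simp only [g, ha, hb, if_false, hNa, hNb] at this
  have h2 : (F.card : ZMod 2) + F.card = 0 := CharTwo.add_self_eq_zero _
  linear_combination this - h2

lemma eventually_sign_of_hasDerivAt {φ : ℝ → ℝ} {w s : ℝ} (h : HasDerivAt φ w s) (hw : w ≠ 0)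
    (h0 : φ s = 0) :
    ((∀ᶠ t in 𝓝[<] s, φ t < 0) ∧ ∀ᶠ t in 𝓝[>] s, 0 < φ t) ∨
      ((∀ᶠ t in 𝓝[<] s, 0 < φ t) ∧ ∀ᶠ t in 𝓝[>] s, φ t < 0) := by
  rcases hw.lt_or_gt with hw | hw
  · right
    have := eventually_nhdsWithin_sign_eq_of_deriv_neg (f := φ) (x₀ := s) (by rwa [h.deriv]) h0
    constructor
    · filter_upwards [nhdsWithin_le_nhds this, self_mem_nhdsWithin] with t ht hts
      rw [sign_pos (sub_pos.2 hts)] at ht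
      exact sign_eq_one_iff.1 ht
    · filter_upwards [nhdsWithin_le_nhds this, self_mem_nhdsWithin] with t ht hts
      rw [sign_neg (sub_neg.2 hts)] at ht
      exact sign_eq_neg_one_iff.1 ht
  · left
    have := eventually_nhdsWithin_sign_eq_of_deriv_pos (f := φ) (x₀ := s) (by rwa [h.deriv]) h0
    constructor
    · filter_upwards [nhdsWithin_le_nhds this, self_mem_nhdsWithin] with t ht hts
      rw [sign_neg (sub_neg.2 hts)] at ht
      exact sign_eq_neg_one_iff.1 ht
    · filter_upwards [nhdsWithin_le_nhds this, self_mem_nhdsWithin] with t ht hts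
      rw [sign_pos (sub_pos.2 hts)] at ht
      exact sign_eq_one_iff.1 ht

end OddEuler

namespace OddEuler

open Filter Topology

/-! ### Crossing parities of lines and rays -/

/-- The parameters at which `γ` is in the set `A`. -/
def hits {a b : ℂ} (γ : Path a b) (A : Set ℂ) : Set I := {s | γ s ∈ A}

/-- Transfer of the jump count to a path. It is used twice: for a whole line, with the side of the
line as `f`, and for a ray, with the number of completed turns as `f`. -/
lemma natCast_ncard_eq_of_jumps {a b : ℂ} {γ : Path a b} {A : Set ℂ} (hfin : (hits γ A).Finite)
    (ha : a ∉ A) (hb : b ∉ A) (f : ℝ → ZMod 2)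
    (hlow : ∀ t ≤ 0, f t = f 0) (hhigh : ∀ t, 1 ≤ t → f t = f 1)
    (hloc : ∀ s : I, γ s ∉ A → ∀ᶠ t in 𝓝 (s : ℝ), f t = f s)
    (hjump : ∀ s : I, γ s ∈ A →
      ∃ c, (∀ᶠ t in 𝓝[<] (s : ℝ), f t = c) ∧ ∀ᶠ t in 𝓝[>] (s : ℝ), f t = c + 1) :
    ((hits γ A).ncard : ZMod 2) = f 1 - f 0 := by
  have hcard : (hits γ A).ncard = (hfin.toFinset.image ((↑) : I → ℝ)).card := by
    rw [Finset.card_image_of_injective _ Subtype.val_injective, ncard_eq_toFinset_card _ hfin]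
  have := eq_add_card_of_jumps (hfin.toFinset.image ((↑) : I → ℝ)) f (a := 0) (b := 1)
    (fun s hs => ?_) (fun s hs => ?_) (fun s hs => ?_)
  · rw [this, hcard]; ring
  · rcases lt_or_ge s 0 with h0 | h0
    · filter_upwards [Iio_mem_nhds h0] with t ht
      rw [hlow t ht.le, hlow s h0.le]
    rcases lt_or_ge 1 s with h1 | h1
    · filter_upwards [Ioi_mem_nhds h1] with t ht
      rw [hhigh t (le_of_lt ht), hhigh s h1.le]
    refine hloc ⟨s, h0, h1⟩ fun h => hs ?_
    exact Finset.mem_image.2 ⟨⟨s, h0, h1⟩, hfin.mem_toFinset.2 h, rfl⟩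
  · obtain ⟨s, h, rfl⟩ := Finset.mem_image.1 hs
    exact hjump s (hfin.mem_toFinset.1 h)
  · obtain ⟨s, h, rfl⟩ := Finset.mem_image.1 hs
    have h : γ s ∈ A := hfin.mem_toFinset.1 h
    refine ⟨lt_of_le_of_ne s.2.1 fun h0 => ha ?_, lt_of_le_of_ne s.2.2 fun h1 => hb ?_⟩
    · rwa [show s = 0 from Subtype.ext h0.symm, γ.source] at h
    · rwa [show s = 1 from Subtype.ext h1, γ.target] at h

/-- `1` if `z` is to the left of the slanted line, `0` otherwise. -/
noncomputable def leftOf (m c : ℝ) (z : ℂ) : ZMod 2 := if slant m z < c then 1 else 0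

/-- The slanted line at offset `c`. -/
def slantLine (m c : ℝ) : Set ℂ := {z | slant m z = c}

lemma eventually_slant_sign {m c : ℝ} {a b : ℂ} {γ : Path a b} (h : TransverseLine m c γ) {s : I}
    (hs : slant m (γ s) = c) :
    ((∀ᶠ t in 𝓝[<] (s : ℝ), slant m (γ.extend t) < c) ∧
        ∀ᶠ t in 𝓝[>] (s : ℝ), c < slant m (γ.extend t)) ∨
      ((∀ᶠ t in 𝓝[<] (s : ℝ), c < slant m (γ.extend t)) ∧
        ∀ᶠ t in 𝓝[>] (s : ℝ), slant m (γ.extend t) < c) := by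
  obtain ⟨w, hw, hw0⟩ := h.transverse s hs
  have := eventually_sign_of_hasDerivAt ((hasDerivAt_slant_extend (m := m) hw).sub_const c) hw0
    (by simp [hs])
  simpa only [sub_neg, sub_pos] using this

/-- The side indicator `leftOf` flips at every transversal crossing, so only the sides of the two
ends matter. -/
lemma TransverseLine.natCast_ncard_hits {m c : ℝ} {a b : ℂ} {γ : Path a b}
    (h : TransverseLine m c γ) :
    ((hits γ (slantLine m c)).ncard : ZMod 2) = leftOf m c a + leftOf m c b := by
  have hcont : Continuous fun t => slant m (γ.extend t) :=
    (slant m).continuous.comp γ.continuous_extend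
  rw [natCast_ncard_eq_of_jumps (A := slantLine m c) h.finite h.left h.right
    (fun t => leftOf m c (γ.extend t))
    (fun t ht => by rw [γ.extend_of_le_zero ht, γ.extend_zero])
    (fun t ht => by rw [γ.extend_of_one_le ht, γ.extend_one])]
  · simp only [Path.extend_one, Path.extend_zero]
    rw [sub_eq_add_neg, CharTwo.neg_eq, add_comm]
  · intro s hs
    have hs : slant m (γ.extend s) ≠ c := by simpa [slantLine] using hs
    rcases hs.lt_or_gt with hlt | hgt
    · filter_upwards [hcont.continuousAt.eventually_lt_const hlt] with t ht
      simp only [leftOf, if_pos ht, if_pos hlt]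
    · filter_upwards [hcont.continuousAt.eventually_const_lt hgt] with t ht
      simp only [leftOf, if_neg ht.not_gt, if_neg hgt.not_gt]
  · intro s hs
    rcases eventually_slant_sign h hs with ⟨h1, h2⟩ | ⟨h1, h2⟩
    · refine ⟨1, ?_, ?_⟩
      · filter_upwards [h1] with t ht
        simp [leftOf, ht]
      · filter_upwards [h2] with t ht
        simp only [leftOf, if_neg ht.not_gt]
        rfl
    · refine ⟨0, ?_, ?_⟩
      · filter_upwards [h1] with t ht
        simp [leftOf, ht.not_gt]
      · filter_upwards [h2] with t ht
        simp [leftOf, ht]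

/-- The open ray that starts at `p` and goes up in direction `m + i`. -/
def slantRay (m : ℝ) (p : ℂ) : Set ℂ := {z | slant m z = slant m p ∧ p.im < z.im}

/-- The number of turns that the angle `θ` has made beyond the direction `m + i`. -/
noncomputable def turns (m θ : ℝ) : ℝ := (θ - Complex.arg (m + Complex.I)) / (2 * Real.pi)

lemma two_pi_mul_turns (m θ : ℝ) :
    2 * Real.pi * turns m θ = θ - Complex.arg (m + Complex.I) := by
  rw [turns, mul_div_cancel₀ _ (by positivity)]

lemma exists_polar_direction (m : ℝ) :
    ∃ k > 0, m = k * Real.cos (Complex.arg (m + Complex.I)) ∧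
      1 = k * Real.sin (Complex.arg (m + Complex.I)) := by
  have hne : (m + Complex.I : ℂ) ≠ 0 := fun h => by simpa using congrArg Complex.im h
  refine ⟨‖(m + Complex.I : ℂ)‖, norm_pos_iff.2 hne, ?_, ?_⟩
  · rw [Complex.norm_mul_cos_arg]; simp
  · rw [Complex.norm_mul_sin_arg]; simp

/-- Write `m + i` in polar form with modulus `k` and argument `α`. Then `slant m` is `-k` times the
component perpendicular to this direction, and `2π * turns m θ = θ - α`. -/
lemma exists_slant_polar (m : ℝ) :
    ∃ k > 0, ∀ (r θ : ℝ), slant m (r * Complex.exp (θ * Complex.I)) =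
      - (k * r * Real.sin (2 * Real.pi * turns m θ)) := by
  obtain ⟨k, hk, hm, h1⟩ := exists_polar_direction m
  refine ⟨k, hk, fun r θ => ?_⟩
  rw [two_pi_mul_turns, Real.sin_sub, slant_apply, Complex.re_ofReal_mul, Complex.im_ofReal_mul,
    Complex.exp_ofReal_mul_I_re, Complex.exp_ofReal_mul_I_im]
  linear_combination r * Real.cos θ * h1 - r * Real.sin θ * hm

/-- The vanishing sine makes `θ - α` a multiple `nπ`. Even `n` gives the ray that goes up (`sin α >
0`), odd `n` the opposite ray. -/
lemma sin_pos_iff_turns {m θ : ℝ} (hs : Real.sin (2 * Real.pi * turns m θ) = 0) :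
    0 < Real.sin θ ↔ ∃ k : ℤ, turns m θ = k := by
  obtain ⟨k, hk, -, h1⟩ := exists_polar_direction m
  have hα : 0 < Real.sin (Complex.arg (m + Complex.I)) :=
    pos_of_mul_pos_right (by rw [← h1]; exact one_pos) hk.le
  obtain ⟨n, hn⟩ := Real.sin_eq_zero_iff.1 hs
  have hθ : θ = Complex.arg (m + Complex.I) + n * Real.pi := by
    rw [hn, two_pi_mul_turns]; ring
  have hu : turns m θ = n / 2 := by
    field_simp at hn ⊢
    linarith
  have hsin : Real.sin θ = (-1) ^ n * Real.sin (Complex.arg (m + Complex.I)) := by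
    rw [← Real.sin_add_int_mul_pi, ← hθ]
  rw [hsin, hu]
  rcases n.even_or_odd with he | ho
  · rw [he.neg_one_zpow, one_mul]
    obtain ⟨j, rfl⟩ := he
    exact ⟨fun _ => ⟨j, by push_cast; ring⟩, fun _ => hα⟩
  · rw [ho.neg_one_zpow]
    refine ⟨fun h => by linarith, ?_⟩
    rintro ⟨j, hj⟩
    obtain ⟨i, rfl⟩ := ho
    have : (2 * i + 1 : ℤ) = 2 * j := by
      have : ((2 * i + 1 : ℤ) : ℝ) = 2 * j := by linarith
      exact_mod_cast this
    omega

/-- `θ` is a continuous choice of the argument of `γ - p`. -/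
def IsAngle {a b : ℂ} (γ : Path a b) (p : ℂ) (θ : C(I, ℝ)) : Prop :=
  ∀ t, γ t - p = (‖γ t - p‖ : ℂ) * Complex.exp ((θ t : ℂ) * Complex.I)

lemma eventually_floor_eq {u : ℝ → ℝ} {s : ℝ} (hu : ContinuousAt u s) (h : ∀ k : ℤ, u s ≠ k) :
    ∀ᶠ t in 𝓝 s, ⌊u t⌋ = ⌊u s⌋ := by
  have h1 : (⌊u s⌋ : ℝ) < u s := lt_of_le_of_ne (Int.floor_le _) (h _).symm
  filter_upwards [hu.eventually_const_lt h1, hu.eventually_lt_const (Int.lt_floor_add_one (u s))]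
    with t h1 h2
  exact Int.floor_eq_iff.2 ⟨h1.le, h2⟩

/-- Within distance `1/2` of an integer `k`, the sign of `sin (2πu)` is the sign of `u - k`. It thus
tells on which side of the jump of the floor function `u` lies. -/
lemma floor_eq_of_sin_pos {u : ℝ} {k : ℤ} (hk : |u - k| < 1 / 2)
    (h : 0 < Real.sin (2 * Real.pi * u)) : ⌊u⌋ = k := by
  obtain ⟨h1, h2⟩ := abs_lt.1 hk
  have : Real.sin (2 * Real.pi * u) = Real.sin (2 * Real.pi * (u - k)) := by
    rw [← Real.sin_sub_int_mul_two_pi _ k]; congr 1; ring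
  rw [this] at h
  rw [Int.floor_eq_iff]
  refine ⟨?_, by linarith⟩
  by_contra! hlt
  refine h.not_ge (Real.sin_nonpos_of_nonpos_of_neg_pi_le ?_ ?_)
  · nlinarith [Real.pi_pos]
  · nlinarith [Real.pi_pos]

lemma floor_eq_of_sin_neg {u : ℝ} {k : ℤ} (hk : |u - k| < 1 / 2)
    (h : Real.sin (2 * Real.pi * u) < 0) : ⌊u⌋ = k - 1 := by
  obtain ⟨h1, h2⟩ := abs_lt.1 hk
  have : Real.sin (2 * Real.pi * u) = Real.sin (2 * Real.pi * (u - k)) := by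
    rw [← Real.sin_sub_int_mul_two_pi _ k]; congr 1; ring
  rw [this] at h
  rw [Int.floor_eq_iff]
  push_cast
  refine ⟨by linarith, ?_⟩
  by_contra! hlt
  refine h.not_ge (Real.sin_nonneg_of_nonneg_of_le_pi ?_ ?_)
  · nlinarith [Real.pi_pos]
  · nlinarith [Real.pi_pos]

/-- The curve meets the ray exactly when the number of turns is an integer. A transversal meeting
moves that number through the integer, so its floor changes by one. -/
lemma natCast_ncard_hits_slantRay {m : ℝ} {p a b : ℂ} {γ : Path a b}
    (h : TransverseLine m (slant m p) γ) (hp : ∀ t, γ t ≠ p) {θ : C(I, ℝ)} (hθ : IsAngle γ p θ) :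
    ((hits γ (slantRay m p)).ncard : ZMod 2) = (⌊turns m (θ 1)⌋ : ZMod 2) - ⌊turns m (θ 0)⌋ := by
  obtain ⟨k, hk, hpol⟩ := exists_slant_polar m
  let u : ℝ → ℝ := fun t => turns m (IccExtend zero_le_one θ t)
  have hucont : Continuous u := by
    have : Continuous (IccExtend (zero_le_one' ℝ) θ) := θ.continuous.Icc_extend'
    unfold u turns
    fun_prop
  have hu : ∀ t : ℝ, slant m (γ.extend t) - slant m p =
      - (k * ‖γ.extend t - p‖ * Real.sin (2 * Real.pi * u t)) := fun t => by
    rw [← hpol, ← map_sub]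
    congr 1
    exact hθ _
  have hpos : ∀ t : ℝ, 0 < k * ‖γ.extend t - p‖ := fun t =>
    mul_pos hk (norm_pos_iff.2 (sub_ne_zero.2 (hp _)))
  have hmem : ∀ s : I, γ s ∈ slantRay m p ↔ ∃ j : ℤ, u s = j := fun s => by
    have hus : u s = turns m (θ s) := by simp [u]
    have hs := hu s
    rw [γ.extend_extends'] at hs
    have hps := hpos s
    rw [γ.extend_extends'] at hps
    have him : (γ s).im - p.im = ‖γ s - p‖ * Real.sin (θ s) := by
      rw [← Complex.sub_im, hθ s, Complex.im_ofReal_mul, Complex.exp_ofReal_mul_I_im]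
      simp
    have himp : p.im < (γ s).im ↔ 0 < Real.sin (θ s) := by
      rw [← sub_pos, him]
      exact mul_pos_iff_of_pos_left (norm_pos_iff.2 (sub_ne_zero.2 (hp _)))
    constructor
    · rintro ⟨h1, h2⟩
      rw [h1, sub_self, zero_eq_neg] at hs
      rw [hus] at hs ⊢
      exact (sin_pos_iff_turns ((mul_eq_zero.1 hs).resolve_left hps.ne')).1 (himp.1 h2)
    · rintro ⟨j, hj⟩
      have hsin : Real.sin (2 * Real.pi * u s) = 0 := by
        rw [hj, show 2 * Real.pi * (j : ℝ) = ((2 * j : ℤ) : ℝ) * Real.pi by push_cast; ring]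
        exact Real.sin_int_mul_pi _
      rw [hsin, mul_zero, neg_zero] at hs
      refine ⟨sub_eq_zero.1 hs, himp.2 ?_⟩
      rw [hus] at hsin hj
      exact (sin_pos_iff_turns hsin).2 ⟨j, hj⟩
  have hfin : (hits γ (slantRay m p)).Finite := h.finite.subset fun s hs => hs.1
  rw [natCast_ncard_eq_of_jumps hfin (fun hh => h.left hh.1) (fun hh => h.right hh.1)
    (fun t => (⌊u t⌋ : ZMod 2))]
  · simp [u]
  · intro t ht
    simp [u, IccExtend_of_le_left _ _ ht]
  · intro t ht
    simp [u, IccExtend_of_right_le _ _ ht]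
  · intro s hs
    rw [hmem] at hs
    filter_upwards [eventually_floor_eq hucont.continuousAt (not_exists.1 hs)] with t ht
    rw [ht]
  · intro s hs
    obtain ⟨j, hj⟩ := (hmem s).1 hs
    have hnear : ∀ᶠ t in 𝓝 (s : ℝ), |u t - j| < 1 / 2 := by
      have : Continuous fun t => |u t - j| := by fun_prop
      exact this.continuousAt.eventually_lt_const (by simp [hj])
    have hneg : ∀ t, |u t - j| < 1 / 2 → slant m p < slant m (γ.extend t) → ⌊u t⌋ = j - 1 :=
      fun t ht hlt => floor_eq_of_sin_neg ht (by
        have := hu t; have := hpos t; by_contra! hh; nlinarith)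
    have hposi : ∀ t, |u t - j| < 1 / 2 → slant m (γ.extend t) < slant m p → ⌊u t⌋ = j :=
      fun t ht hlt => floor_eq_of_sin_pos ht (by
        have := hu t; have := hpos t; by_contra! hh; nlinarith)
    have h2 : (1 : ZMod 2) + 1 = 0 := CharTwo.add_self_eq_zero _
    -- Since `slant` is a negative multiple of the sine, increasing `slant` means turning clockwise,
    -- and the floor drops from `j` to `j - 1`. Modulo two this is the same as a rise by one.
    rcases eventually_slant_sign h hs.1 with ⟨h1, h2⟩ | ⟨h1, h2⟩
    · refine ⟨j, ?_, ?_⟩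
      · filter_upwards [h1, nhdsWithin_le_nhds hnear] with t ht ht'
        rw [hposi t ht' ht]
      · filter_upwards [h2, nhdsWithin_le_nhds hnear] with t ht ht'
        rw [hneg t ht' ht]
        push_cast
        rw [sub_eq_add_neg, CharTwo.neg_eq]
    · refine ⟨j - 1, ?_, ?_⟩
      · filter_upwards [h1, nhdsWithin_le_nhds hnear] with t ht ht'
        rw [hneg t ht' ht]
        push_cast
        rfl
      · filter_upwards [h2, nhdsWithin_le_nhds hnear] with t ht ht'
        rw [hposi t ht' ht]
        ring

end OddEuler

namespace OddEuler

open Filter Topology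

/-! ### Counting crossings of concatenated paths -/

/-- The first half of the unit interval. -/
noncomputable def halfLeft (t : I) : I :=
  ⟨t / 2, by constructor <;> linarith [t.2.1, t.2.2]⟩

/-- The second half of the unit interval. -/
noncomputable def halfRight (t : I) : I :=
  ⟨(t + 1) / 2, by constructor <;> linarith [t.2.1, t.2.2]⟩

lemma continuous_halfLeft : Continuous halfLeft := by
  unfold halfLeft; fun_prop

lemma continuous_halfRight : Continuous halfRight := by
  unfold halfRight; fun_prop

lemma halfLeft_injective : Function.Injective halfLeft := fun s t h => by
  have := congrArg Subtype.val h
  simp only [halfLeft] at this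
  exact Subtype.ext (by linarith)

lemma halfRight_injective : Function.Injective halfRight := fun s t h => by
  have := congrArg Subtype.val h
  simp only [halfRight] at this
  exact Subtype.ext (by linarith)

lemma exists_half (t : I) : (∃ s, t = halfLeft s) ∨ ∃ s, t = halfRight s := by
  rcases le_total (t : ℝ) (1 / 2) with h | h
  · exact .inl ⟨⟨2 * t, by constructor <;> linarith [t.2.1]⟩, Subtype.ext (by simp [halfLeft])⟩
  · exact .inr ⟨⟨2 * t - 1, by constructor <;> linarith [t.2.2]⟩,
      Subtype.ext (by simp [halfRight])⟩

lemma trans_halfLeft {a b c : ℂ} (γ : Path a b) (δ : Path b c) (t : I) :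
    γ.trans δ (halfLeft t) = γ t := by
  rw [← Path.extend_extends', Path.extend_trans_of_le_half _ _
    (by simp only [halfLeft]; linarith [t.2.2]),
    ← Path.extend_extends' γ t]
  congr 1
  simp only [halfLeft]; ring

lemma trans_halfRight {a b c : ℂ} (γ : Path a b) (δ : Path b c) (t : I) :
    γ.trans δ (halfRight t) = δ t := by
  rw [← Path.extend_extends', Path.extend_trans_of_half_le _ _
    (by simp only [halfRight]; linarith [t.2.1]),
    ← Path.extend_extends' δ t]
  congr 1
  simp only [halfRight]; ring

lemma hasDerivAt_trans_left {a b c : ℂ} {γ : Path a b} (δ : Path b c) {w : ℂ} {t : I}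
    (h : HasDerivAt γ.extend w t) (ht : γ t ≠ b) :
    HasDerivAt (γ.trans δ).extend ((2 : ℝ) • w) (halfLeft t) := by
  have ht1 : (t : ℝ) < 1 := lt_of_le_of_ne t.2.2 fun h1 => ht (by
    rw [show t = 1 from Subtype.ext h1, γ.target])
  have h2 : HasDerivAt γ.extend w (2 * ((halfLeft t : I) : ℝ)) := by
    convert h using 1; simp only [halfLeft]; ring
  have h3 : HasDerivAt (fun s : ℝ => γ.extend (2 * s)) ((2 : ℝ) • w) (halfLeft t : I) :=
    HasDerivAt.scomp _ h2 (by simpa using (hasDerivAt_id ((halfLeft t : I) : ℝ)).const_mul 2)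
  refine h3.congr_of_eventuallyEq ?_
  have : ((halfLeft t : I) : ℝ) < 1 / 2 := by simp only [halfLeft]; linarith
  filter_upwards [Iio_mem_nhds this] with s hs
  exact Path.extend_trans_of_le_half _ _ (le_of_lt hs)

lemma hasDerivAt_trans_right {a b c : ℂ} (γ : Path a b) {δ : Path b c} {w : ℂ} {t : I}
    (h : HasDerivAt δ.extend w t) (ht : δ t ≠ b) :
    HasDerivAt (γ.trans δ).extend ((2 : ℝ) • w) (halfRight t) := by
  have ht1 : 0 < (t : ℝ) := lt_of_le_of_ne t.2.1 fun h1 => ht (by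
    rw [show t = 0 from Subtype.ext h1.symm, δ.source])
  have h2 : HasDerivAt δ.extend w (2 * ((halfRight t : I) : ℝ) - 1) := by
    convert h using 1; simp only [halfRight]; ring
  have h3 : HasDerivAt (fun s : ℝ => δ.extend (2 * s - 1)) ((2 : ℝ) • w) (halfRight t : I) :=
    HasDerivAt.scomp _ h2
      (by simpa using ((hasDerivAt_id ((halfRight t : I) : ℝ)).const_mul 2).sub_const 1)
  refine h3.congr_of_eventuallyEq ?_
  have : 1 / 2 < ((halfRight t : I) : ℝ) := by simp only [halfRight]; linarith
  filter_upwards [Ioi_mem_nhds this] with s hs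
  exact Path.extend_trans_of_half_le _ _ (le_of_lt hs)

/-- The parameter `1/2` belongs to both halves; `h1` ensures that nothing is counted there. The
factor `X` is the parameter of the other curve when meetings are counted, and `Unit` when hits of a
set are counted. -/
lemma ncard_union_halves {X : Type*} {M M₁ M₂ : Set (I × X)}
    (hl : ∀ t x, (halfLeft t, x) ∈ M ↔ (t, x) ∈ M₁)
    (hr : ∀ t x, (halfRight t, x) ∈ M ↔ (t, x) ∈ M₂)
    (h1 : ∀ x, (1, x) ∉ M₁) (hf₁ : M₁.Finite) (hf₂ : M₂.Finite) :
    M.Finite ∧ M.ncard = M₁.ncard + M₂.ncard := by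
  have hM : M = Prod.map halfLeft id '' M₁ ∪ Prod.map halfRight id '' M₂ := by
    ext ⟨t, x⟩
    constructor
    · intro h
      rcases exists_half t with ⟨s, rfl⟩ | ⟨s, rfl⟩
      · exact .inl ⟨(s, x), (hl s x).1 h, rfl⟩
      · exact .inr ⟨(s, x), (hr s x).1 h, rfl⟩
    · rintro (⟨⟨s, y⟩, h, he⟩ | ⟨⟨s, y⟩, h, he⟩)
      · rw [← he]; exact (hl s y).2 h
      · rw [← he]; exact (hr s y).2 h
  have hdis : Disjoint (Prod.map halfLeft id '' M₁) (Prod.map halfRight id '' M₂) := by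
    rw [Set.disjoint_left]
    rintro _ ⟨⟨s, y⟩, h, rfl⟩ ⟨⟨t, z⟩, h', he⟩
    simp only [Prod.map, id, Prod.mk.injEq] at he
    have := congrArg Subtype.val he.1
    simp only [halfLeft, halfRight] at this
    have hs : s = 1 := Subtype.ext (le_antisymm s.2.2 (by
      change (1 : ℝ) ≤ s; linarith [t.2.1]))
    exact h1 y (hs ▸ h)
  rw [hM]
  refine ⟨(hf₁.image _).union (hf₂.image _), ?_⟩
  rw [ncard_union_eq hdis (hf₁.image _) (hf₂.image _),
    ncard_image_of_injective _ (halfLeft_injective.prodMap Function.injective_id),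
    ncard_image_of_injective _ (halfRight_injective.prodMap Function.injective_id)]

lemma hits_trans {a b c : ℂ} {γ : Path a b} {δ : Path b c} {A : Set ℂ} (hb : b ∉ A)
    (hγ : (hits γ A).Finite) (hδ : (hits δ A).Finite) :
    (hits (γ.trans δ) A).Finite ∧
      (hits (γ.trans δ) A).ncard = (hits γ A).ncard + (hits δ A).ncard := by
  have key : ∀ S : Set I, (S.Finite → (S ×ˢ (univ : Set Unit)).Finite) ∧
      (S ×ˢ (univ : Set Unit)).ncard = S.ncard := fun S =>
    ⟨fun h => h.prod finite_univ, by rw [ncard_prod, ncard_univ]; simp⟩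
  have := ncard_union_halves (X := Unit) (M := hits (γ.trans δ) A ×ˢ univ)
    (M₁ := hits γ A ×ˢ univ) (M₂ := hits δ A ×ˢ univ)
    (fun t x => by simp [hits, trans_halfLeft]) (fun t x => by simp [hits, trans_halfRight])
    (fun x => by simp [hits, hb]) ((key _).1 hγ) ((key _).1 hδ)
  rw [(key _).2, (key _).2, (key _).2] at this
  refine ⟨?_, this.2⟩
  have h := this.1.image Prod.fst
  rwa [fst_image_prod _ univ_nonempty] at h

lemma hits_refl {a : ℂ} {A : Set ℂ} (ha : a ∉ A) : hits (Path.refl a) A = ∅ := by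
  ext; simp [hits, ha]

lemma ncard_hits_symm {a b : ℂ} (γ : Path a b) (A : Set ℂ) :
    (hits γ.symm A).ncard = (hits γ A).ncard := by
  have : hits γ.symm A = unitInterval.symm ⁻¹' hits γ A := rfl
  rw [this, ← Set.image_eq_preimage_of_inverse (f := unitInterval.symm)
    unitInterval.symm_involutive unitInterval.symm_involutive]
  exact ncard_image_of_injective _ unitInterval.symm_bijective.injective

lemma hits_congr {a b c d : ℂ} {γ : Path a b} {δ : Path c d} (h : (γ : I → ℂ) = δ) (A : Set ℂ) :
    hits γ A = hits δ A := by
  simp only [hits, h]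

/-! ### Transversal crossings -/

/-- `T` and `γ` meet `n` times, and they cross transversally at each meeting. -/
structure CrossesTimes {a b c d : ℂ} (T : Path a b) (γ : Path c d) (n : ℕ) : Prop where
  finite : (meets T γ).Finite
  crosses : ∀ x ∈ meets T γ, CrossesAt T γ x.1 x.2
  ncard : (meets T γ).ncard = n

lemma crossesTimes_zero {a b c d : ℂ} {T : Path a b} {γ : Path c d} (h : ∀ t s, T t ≠ γ s) :
    CrossesTimes T γ 0 := by
  have : meets T γ = ∅ := by ext ⟨t, s⟩; simpa [meets] using h t s
  constructor <;> simp [this]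

/-- The factor two is the change of speed in a concatenation of paths. -/
lemma crossesAt_of_smul {a b c d a' b' : ℂ} {T : Path a b} {T' : Path a' b'} {γ : Path c d}
    {t t' s : I} (h : CrossesAt T γ t s)
    (hd : ∀ v, HasDerivAt T.extend v t → HasDerivAt T'.extend ((2 : ℝ) • v) t') :
    CrossesAt T' γ t' s := by
  obtain ⟨v, w, hv, hw, hli⟩ := h
  refine ⟨_, w, hd v hv, hw, ?_⟩
  rw [LinearIndependent.pair_iff] at hli ⊢
  intro x y hxy
  have := hli (x * 2) y (by rw [mul_smul]; exact hxy)
  exact ⟨by linarith [this.1], this.2⟩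

/-- The joint `b` may be a corner without velocity; as `γ` avoids it, no meeting happens there. -/
lemma CrossesTimes.trans {a b c d e : ℂ} {T : Path a b} {T' : Path b c} {γ : Path d e} {n n' : ℕ}
    (h : CrossesTimes T γ n) (h' : CrossesTimes T' γ n') (hb : ∀ s, γ s ≠ b) :
    CrossesTimes (T.trans T') γ (n + n') := by
  obtain ⟨hfin, hcard⟩ := ncard_union_halves (M := meets (T.trans T') γ) (M₁ := meets T γ)
    (M₂ := meets T' γ) (fun t x => by simp [meets, trans_halfLeft])
    (fun t x => by simp [meets, trans_halfRight]) (fun x => by simpa [meets] using (hb x).symm)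
    h.finite h'.finite
  refine ⟨hfin, ?_, by rw [hcard, h.ncard, h'.ncard]⟩
  rintro ⟨t, s⟩ hx
  have hx : T.trans T' t = γ s := hx
  rcases exists_half t with ⟨t, rfl⟩ | ⟨t, rfl⟩
  · rw [trans_halfLeft] at hx
    exact crossesAt_of_smul (h.crosses (t, s) hx)
      fun v hv => hasDerivAt_trans_left _ hv (hx ▸ hb s)
  · rw [trans_halfRight] at hx
    exact crossesAt_of_smul (h'.crosses (t, s) hx)
      fun v hv => hasDerivAt_trans_right _ hv (hx ▸ hb s)

lemma hasDerivAt_segment {a b : ℂ} {t : I} (ha : Path.segment a b t ≠ a)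
    (hb : Path.segment a b t ≠ b) : HasDerivAt (Path.segment a b).extend (b - a) t := by
  have h0 : 0 < (t : ℝ) := lt_of_le_of_ne t.2.1 fun h1 => ha (by
    rw [show t = 0 from Subtype.ext h1.symm, Path.source])
  have h1 : (t : ℝ) < 1 := lt_of_le_of_ne t.2.2 fun h1 => hb (by
    rw [show t = 1 from Subtype.ext h1, Path.target])
  have : HasDerivAt (AffineMap.lineMap a b : ℝ → ℂ) (b - a) t := AffineMap.hasDerivAt_lineMap
  refine this.congr_of_eventuallyEq ?_
  filter_upwards [Icc_mem_nhds h0 h1] with s hs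
  exact Path.eqOn_extend_segment a b hs

/-- A nondegenerate segment is injective, so meetings correspond to parameters of `γ` alone. They
are transversal because `slant m` kills the direction of the segment but not the velocity of `γ`. -/
lemma crossesTimes_segment {m c : ℝ} {a b d e : ℂ} {γ : Path d e} (h : TransverseLine m c γ)
    (ha : slant m a = c) (hb : slant m b = c) (hab : a ≠ b) (haγ : ∀ s, γ s ≠ a)
    (hbγ : ∀ s, γ s ≠ b) :
    CrossesTimes (Path.segment a b) γ (hits γ (segment ℝ a b)).ncard := by
  have hline : ∀ t, slant m (Path.segment a b t) = c := fun t => by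
    have : Path.segment a b t = AffineMap.lineMap a b (t : ℝ) := rfl
    rw [this, AffineMap.lineMap_apply_module, map_add, map_smul, map_smul, ha, hb]
    simp only [smul_eq_mul]; ring
  have himg : hits γ (segment ℝ a b) = Prod.snd '' meets (Path.segment a b) γ := by
    ext s
    simp only [hits, meets, ← Path.range_segment, mem_ofPred_eq, mem_image, Prod.exists,
      exists_eq_right, mem_range]
  have hinj : InjOn Prod.snd (meets (Path.segment a b) γ) := by
    rintro ⟨t, s⟩ h ⟨t', s'⟩ h' (rfl : s = s')
    have : Path.segment a b t = Path.segment a b t' := Eq.trans h (Eq.symm h')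
    rw [Path.segment_injective_of_ne hab this]
  refine ⟨?_, ?_, by rw [himg, hinj.ncard_image]⟩
  · refine Finite.of_finite_image (f := Prod.snd) (h.finite.subset ?_) hinj
    rintro _ ⟨⟨t, s⟩, hx, rfl⟩
    have hx : Path.segment a b t = γ s := hx
    change slant m (γ s) = c
    rw [← hx, hline]
  · rintro ⟨t, s⟩ hx
    have hx : Path.segment a b t = γ s := hx
    obtain ⟨w, hw, hw0⟩ := h.transverse s (by rw [← hx, hline])
    refine ⟨b - a, w, hasDerivAt_segment (hx ▸ haγ s) (hx ▸ hbγ s), hw, ?_⟩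
    rw [LinearIndependent.pair_iff]
    intro x y hxy
    have := congrArg (slant m) hxy
    rw [map_add, map_smul, map_smul, map_sub, ha, hb, map_zero] at this
    simp only [sub_self, smul_eq_mul, mul_zero, zero_add, mul_eq_zero, hw0, or_false] at this
    subst this
    rw [zero_smul, add_zero, smul_eq_zero] at hxy
    exact ⟨hxy.resolve_right (sub_ne_zero.2 hab.symm), rfl⟩

end OddEuler

namespace OddEuler

open Filter Topology

/-! ### Winding numbers and crossings with a ray -/

/-- Lift the normalised curve `(γ - p) / ‖γ - p‖` through the covering of the circle by the line. -/
lemma exists_isAngle {a b : ℂ} (γ : Path a b) {p : ℂ} (hp : ∀ t, γ t ≠ p) :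
    ∃ θ : C(I, ℝ), IsAngle γ p θ := by
  have hne : ∀ t, γ t - p ≠ 0 := fun t => sub_ne_zero.2 (hp t)
  have hnorm : ∀ t, (‖γ t - p‖ : ℂ) ≠ 0 := fun t => by simpa using hne t
  let c : C(I, Circle) :=
    ⟨fun t => ⟨(γ t - p) / ‖γ t - p‖, by
      simp [Submonoid.unitSphere, div_self (norm_ne_zero_iff.2 (hne t))]⟩, by
      refine Continuous.subtype_mk (Continuous.div ?_ ?_ hnorm) _ <;> fun_prop⟩
  obtain ⟨θ, hθ, -⟩ := Circle.isCoveringMap_exp.exists_path_lifts c (Complex.arg (c 0))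
    (Circle.exp_arg _).symm
  refine ⟨θ, fun t => ?_⟩
  have := congrArg (fun z : Circle => (z : ℂ)) (congrFun hθ t)
  simp only [Function.comp_apply, Circle.coe_exp] at this
  rw [this]
  change _ = _ * ((γ t - p) / ‖γ t - p‖)
  rw [mul_div_cancel₀ _ (hnorm t)]

lemma IsAngle.exists_int {a : ℂ} {γ : Path a a} {p : ℂ} (hp : ∀ t, γ t ≠ p) {θ : C(I, ℝ)}
    (hθ : IsAngle γ p θ) : ∃ n : ℤ, θ 1 - θ 0 = 2 * Real.pi * n := by
  have h0 := hθ 0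
  have h1 := hθ 1
  have hne : a - p ≠ 0 := sub_ne_zero.2 (by simpa using hp 0)
  rw [γ.source] at h0
  rw [γ.target] at h1
  have := mul_left_cancel₀ (by simpa using hne) (h1.symm.trans h0)
  obtain ⟨n, hn⟩ := Complex.exp_eq_exp_iff_exists_int.1 this
  refine ⟨n, ?_⟩
  have := congrArg Complex.im hn
  simp at this
  linarith

/-! ### Ray crossings along walks and cycles of the graph -/

namespace Embedding

variable {V : Type*} {G : SimpleGraph V} (Γ : Embedding G)

lemma pos_mem_image (v : V) : Γ.pos v ∈ Γ.image := .inl ⟨v, rfl⟩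

lemma curve_mem_image {u v : V} (h : G.Adj u v) (t : I) : Γ.curve h t ∈ Γ.image :=
  .inr ⟨u, v, h, t, rfl⟩

/-- The number of times that an edge meets a set of points. -/
noncomputable def edgeHits (A : Set ℂ) {u v : V} (h : G.Adj u v) : ℕ := (hits (Γ.curve h) A).ncard

lemma edgeHits_symm (A : Set ℂ) {u v : V} (h : G.Adj u v) :
    Γ.edgeHits A h.symm = Γ.edgeHits A h := by
  rw [edgeHits, Γ.curve_symm, ncard_hits_symm, edgeHits]

/-- The slanted line at offset `c` avoids the vertices and crosses the edges transversally. -/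
structure Transverse (m c : ℝ) : Prop where
  pos : ∀ v, slant m (Γ.pos v) ≠ c
  curve : ∀ {u v : V} (h : G.Adj u v), TransverseLine m c (Γ.curve h)

variable {Γ}

lemma walkCurve_ne {p : ℂ} (hp : p ∉ Γ.image) {u v : V} (W : G.Walk u v) (t : I) :
    Γ.walkCurve W t ≠ p := by
  induction W generalizing t with
  | nil => exact fun h => hp (h ▸ Γ.pos_mem_image _)
  | cons h W ih =>
    rcases exists_half t with ⟨s, rfl⟩ | ⟨s, rfl⟩
    · rw [walkCurve, trans_halfLeft]
      exact fun hh => hp (hh ▸ Γ.curve_mem_image h s)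
    · rw [walkCurve, trans_halfRight]
      exact ih s

/-- A choice of the argument along the walk restricts to one along the first edge and one along the
rest, so the floors telescope. Open walks are needed for the induction. -/
lemma Transverse.sum_edgeHits {m : ℝ} {p : ℂ} (h : Γ.Transverse m (slant m p)) (hp : p ∉ Γ.image)
    {u v : V} (W : G.Walk u v) {θ : C(I, ℝ)} (hθ : IsAngle (Γ.walkCurve W) p θ) :
    (W.darts.map fun d => (Γ.edgeHits (slantRay m p) d.adj : ZMod 2)).sum =
      (⌊turns m (θ 1)⌋ : ZMod 2) - ⌊turns m (θ 0)⌋ := by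
  induction W generalizing θ with
  | @nil u =>
    rw [← natCast_ncard_hits_slantRay (γ := Path.refl (Γ.pos u)) ?_ ?_ hθ, hits_refl]
    · simp
    · exact fun hh => h.pos u hh.1
    · exact ⟨h.pos u, h.pos u, fun s hs => absurd hs (h.pos u)⟩
    · exact fun _ hh => hp (hh ▸ Γ.pos_mem_image _)
  | @cons u v w e W ih =>
    let θ₁ : C(I, ℝ) := ⟨fun t => θ (halfLeft t), θ.continuous.comp continuous_halfLeft⟩
    let θ₂ : C(I, ℝ) := ⟨fun t => θ (halfRight t), θ.continuous.comp continuous_halfRight⟩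
    have h1 : IsAngle (Γ.curve e) p θ₁ := fun t => by
      have := hθ (halfLeft t)
      rwa [walkCurve, trans_halfLeft] at this
    have h2 : IsAngle (Γ.walkCurve W) p θ₂ := fun t => by
      have := hθ (halfRight t)
      rwa [walkCurve, trans_halfRight] at this
    have e1 := natCast_ncard_hits_slantRay (h.curve e)
      (fun t hh => hp (hh ▸ Γ.curve_mem_image e t)) h1
    rw [SimpleGraph.Walk.darts_cons, List.map_cons, List.sum_cons, ih h2]
    simp only [edgeHits, e1]
    have a1 : θ₁ 0 = θ 0 := congrArg θ (Subtype.ext (by simp [halfLeft]))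
    have a2 : θ₂ 1 = θ 1 := congrArg θ (Subtype.ext (by simp [halfRight]))
    have a3 : θ₂ 0 = θ₁ 1 := congrArg θ (Subtype.ext (by simp [halfRight, halfLeft]))
    rw [a1, a2, a3]
    ring

/-- On a closed curve the floor of the number of turns changes by the winding number, and the ones
add up to the length. Odd embeddedness says that these have the same parity. -/
lemma IsOddAround.sum_cycle {m : ℝ} {p : ℂ} (hodd : Γ.IsOddAround p)
    (h : Γ.Transverse m (slant m p)) {v : V} {c : G.Walk v v} (hc : c.IsCycle) :
    (c.darts.map fun d => 1 + (Γ.edgeHits (slantRay m p) d.adj : ZMod 2)).sum = 0 := by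
  have hp := walkCurve_ne hodd.1 c
  obtain ⟨θ, hθ⟩ := exists_isAngle _ hp
  obtain ⟨n, hn⟩ := hθ.exists_int hp
  have hpar := hodd.2 v c hc n ⟨θ, hθ, hn⟩
  rw [List.sum_map_add, h.sum_edgeHits hodd.1 c hθ]
  have : turns m (θ 1) = turns m (θ 0) + n := by
    simp only [turns]
    field_simp
    linarith
  rw [this, Int.floor_add_intCast]
  simp only [List.map_const', List.sum_replicate, SimpleGraph.Walk.length_darts, nsmul_eq_mul,
    mul_one]
  push_cast
  rw [add_sub_cancel_left]
  rcases Nat.even_or_odd c.length with he | ho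
  · have hne : Even n := by
      rw [← Int.not_odd_iff_even]; exact fun hh => (Nat.not_odd_iff_even.2 he) (hpar.2 hh)
    rw [(ZMod.natCast_eq_zero_iff_even).2 he, (ZMod.intCast_eq_zero_iff_even).2 hne, add_zero]
  · rw [(ZMod.natCast_eq_one_iff_odd).2 ho, (ZMod.intCast_eq_one_iff_odd).2 (hpar.1 ho)]
    exact CharTwo.add_self_eq_zero _

end Embedding

/-! ### Potentials -/

lemma sum_darts_eq_of_potential {V : Type*} {H : SimpleGraph V} {f : V → V → ZMod 2}
    {g : V → ZMod 2} (hg : ∀ u v, H.Adj u v → f u v = g u + g v) {u v : V} (W : H.Walk u v) :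
    (W.darts.map fun d => f d.fst d.snd).sum = g u + g v := by
  induction W with
  | nil => simp [CharTwo.add_self_eq_zero]
  | @cons a b c h W ih =>
    simp only [SimpleGraph.Walk.darts_cons, List.map_cons, List.sum_cons, ih, hg _ _ h]
    linear_combination CharTwo.add_self_eq_zero (g b)

/-- Take a maximal subgraph `H` of `G` with a potential and suppose that an edge `uv` of `G` is
missing. If `H` joins its ends, a path in `H` closes up to a cycle, and the cycle condition shows
that the potential already fits `uv`. Otherwise the potential can be shifted on one component.
Either way `H` was not maximal. -/
lemma exists_potential {V : Type*} [Finite V] (G : SimpleGraph V) (f : V → V → ZMod 2)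
    (hsymm : ∀ u v, f u v = f v u)
    (hcycle : ∀ (v : V) (c : G.Walk v v), c.IsCycle →
      (c.darts.map fun d => f d.fst d.snd).sum = 0) :
    ∃ g : V → ZMod 2, ∀ u v, G.Adj u v → f u v = g u + g v := by
  classical
  let S : Set (SimpleGraph V) := {H | H ≤ G ∧
    ∃ g : V → ZMod 2, ∀ u v, H.Adj u v → f u v = g u + g v}
  have hS : S.Nonempty := ⟨⊥, bot_le, 0, fun u v h => h.elim⟩
  obtain ⟨H, ⟨⟨hHG, g, hg⟩, hmax⟩⟩ := S.toFinite.exists_maximal hS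
  refine ⟨g, fun u v huv => hg u v ?_⟩
  by_contra hH
  suffices ∃ g' : V → ZMod 2, (∀ a b, H.Adj a b → f a b = g' a + g' b) ∧ f u v = g' u + g' v by
    obtain ⟨g', h1, h2⟩ := this
    have hle : H ⊔ SimpleGraph.edge u v ≤ H := by
      refine hmax ⟨sup_le hHG ?_, g', fun a b hab => ?_⟩ le_sup_left
      · rw [SimpleGraph.edge_le_iff]; exact .inr huv
      · rw [SimpleGraph.sup_adj, SimpleGraph.edge_adj] at hab
        rcases hab with hab | ⟨⟨rfl, rfl⟩ | ⟨rfl, rfl⟩, -⟩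
        · exact h1 a b hab
        · exact h2
        · rw [hsymm, h2, add_comm]
    exact hH (hle (by simp [SimpleGraph.edge_adj, huv.ne]))
  by_cases hr : H.Reachable v u
  · refine ⟨g, hg, ?_⟩
    obtain ⟨P, hP⟩ := hr.exists_isPath
    have hc : (SimpleGraph.Walk.cons huv (P.mapLe hHG)).IsCycle := by
      rw [SimpleGraph.Walk.cons_isCycle_iff]
      refine ⟨hP.mapLe hHG, fun he => hH ?_⟩
      rw [SimpleGraph.Walk.edges_mapLe_eq_edges] at he
      exact P.adj_of_mem_edges he
    have := hcycle _ _ hc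
    rw [SimpleGraph.Walk.darts_cons, List.map_cons, List.sum_cons, SimpleGraph.Walk.mapLe,
      SimpleGraph.Walk.darts_map, List.map_map] at this
    have h2 := sum_darts_eq_of_potential hg P
    have h3 : (P.darts.map ((fun d : G.Dart => f d.fst d.snd) ∘
      (SimpleGraph.Hom.ofLE hHG).mapDart)).sum = g v + g u := h2
    rw [h3] at this
    simp only at this
    linear_combination this - CharTwo.add_self_eq_zero (g u) - CharTwo.add_self_eq_zero (g v)
  -- Shifting by the defect of `uv` on the whole component of `v` preserves the sums on the edges of
  -- `H`, because both ends of such an edge are shifted or neither is.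
  · refine ⟨fun w => g w + if H.Reachable v w then f u v + g u + g v else 0, fun a b hab => ?_, ?_⟩
    · have : H.Reachable v a ↔ H.Reachable v b :=
        ⟨fun h => h.trans hab.reachable, fun h => h.trans hab.symm.reachable⟩
      simp only [this, hg a b hab]
      split_ifs
      · linear_combination -CharTwo.add_self_eq_zero (f u v + g u + g v)
      · ring
    · simp only [hr, if_false, SimpleGraph.Reachable.refl, if_true]
      linear_combination -CharTwo.add_self_eq_zero (g u) - CharTwo.add_self_eq_zero (g v)

lemma Embedding.IsOddAround.exists_potential {V : Type*} [Finite V] {G : SimpleGraph V}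
    {Γ : Embedding G} {m : ℝ} {p : ℂ} (hodd : Γ.IsOddAround p)
    (h : Γ.Transverse m (slant m p)) :
    ∃ g : V → ZMod 2, ∀ {u v : V} (e : G.Adj u v),
      1 + (Γ.edgeHits (slantRay m p) e : ZMod 2) = g u + g v := by
  classical
  let f : V → V → ZMod 2 := fun u v =>
    if e : G.Adj u v then 1 + (Γ.edgeHits (slantRay m p) e : ZMod 2) else 0
  have hsymm : ∀ u v, f u v = f v u := fun u v => by
    by_cases e : G.Adj u v
    · simp only [f, dif_pos e, dif_pos e.symm]
      rw [Γ.edgeHits_symm _ e]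
    · simp only [f, dif_neg e, dif_neg fun e' : G.Adj v u => e e'.symm]
  have hcycle : ∀ (v : V) (c : G.Walk v v), c.IsCycle →
      (c.darts.map fun d => f d.fst d.snd).sum = 0 := fun v c hc => by
    rw [← hodd.sum_cycle h hc]
    congr 1
    refine List.map_congr_left fun d _ => ?_
    simp only [f, dif_pos d.adj]
  obtain ⟨g, hg⟩ := OddEuler.exists_potential G f hsymm hcycle
  refine ⟨g, fun {u v} e => ?_⟩
  rw [← hg u v e]
  simp only [f, dif_pos e]

end OddEuler

namespace OddEuler

open Filter Topology

/-! ### Polygonal odd Euler paths made of slanted boxes -/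

/-- The point at height `y` on the slanted line at offset `c`. -/
def slantPt (m c y : ℝ) : ℂ := ⟨c + m * y, y⟩

@[simp] lemma slantPt_im (m c y : ℝ) : (slantPt m c y).im = y := rfl

@[simp] lemma slant_slantPt (m c y : ℝ) : slant m (slantPt m c y) = c := by
  simp [slant_apply, slantPt]

lemma slantPt_slant (m : ℝ) (z : ℂ) : slantPt m (slant m z) z.im = z := by
  apply Complex.ext <;> simp [slantPt, slant_apply]

lemma mem_segment_slantPt {m c y₁ y₂ : ℝ} {z : ℂ} :
    z ∈ segment ℝ (slantPt m c y₁) (slantPt m c y₂) ↔ slant m z = c ∧ z.im ∈ uIcc y₁ y₂ := by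
  let f : ℝ →ᵃ[ℝ] ℂ := AffineMap.lineMap (slantPt m c 0) (slantPt m c 1)
  have hf : ∀ y, f y = slantPt m c y := fun y => by
    apply Complex.ext <;> simp [f, slantPt, AffineMap.lineMap_apply]
    ring
  rw [← hf, ← hf, ← image_segment, segment_eq_uIcc]
  constructor
  · rintro ⟨y, hy, rfl⟩
    rw [hf]
    exact ⟨slant_slantPt _ _ _, hy⟩
  · rintro ⟨rfl, hz⟩
    exact ⟨z.im, hz, by rw [hf, slantPt_slant]⟩

lemma segment_im_eq {a b : ℂ} {y : ℝ} (ha : a.im = y) (hb : b.im = y) {z : ℂ}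
    (hz : z ∈ segment ℝ a b) : z.im = y := by
  obtain ⟨r, s, -, -, hrs, rfl⟩ := hz
  simp [ha, hb, ← add_mul, hrs]

lemma crossesTimes_polyPath_cons {a b d e : ℂ} {L : List ℂ} {γ : Path d e} {n n' : ℕ}
    (h : CrossesTimes (Path.segment a b) γ n) (h' : CrossesTimes (polyPath b L) γ n')
    (hb : ∀ s, γ s ≠ b) : CrossesTimes (polyPath a (b :: L)) γ (n + n') := by
  cases L with
  | nil =>
    -- `polyPath` does not append a constant path to its last segment. The constant path would
    -- contribute no crossing anyway, so the count agrees.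
    have h0 : CrossesTimes (polyPath b []) γ 0 := crossesTimes_zero fun _ s => (hb s).symm
    rw [← h'.ncard, h0.ncard]
    exact h
  | cons c L => exact h.trans h' hb

lemma polyPath_cons_forall {a b : ℂ} {L : List ℂ} {S : Set ℂ} (h : segment ℝ a b ⊆ S)
    (h' : ∀ t, polyPath b L t ∈ S) (t : I) : polyPath a (b :: L) t ∈ S := by
  rw [← Path.range_segment] at h
  cases L with
  | nil => exact h ⟨t, rfl⟩
  | cons c L =>
    rcases exists_half t with ⟨t, rfl⟩ | ⟨t, rfl⟩
    · exact (congrArg (· ∈ S) (trans_halfLeft _ (polyPath b (c :: L)) t)).mpr (h ⟨t, rfl⟩)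
    · exact (congrArg (· ∈ S) (trans_halfRight (Path.segment a b) _ t)).mpr (h' t)

/-- The corners of a box with two slanted sides, traversed from its upper left corner to its upper
right corner around the bottom. -/
def slantBox (m Y : ℝ) (c : ℝ × ℝ) : List ℂ :=
  [slantPt m c.1 Y, slantPt m c.1 (-Y), slantPt m c.2 (-Y), slantPt m c.2 Y]

lemma lastPoint_im_flatMap_slantBox {m Y : ℝ} {a : ℂ} (ha : a.im = Y) (cs : List (ℝ × ℝ)) :
    (lastPoint a (cs.flatMap (slantBox m Y))).im = Y := by
  induction cs generalizing a with
  | nil => exact ha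
  | cons c cs ih => exact ih rfl

lemma crossesTimes_segment_horizontal {a b d e : ℂ} {γ : Path d e} {y : ℝ} (ha : a.im = y)
    (hb : b.im = y) (hγ : ∀ s, (γ s).im ≠ y) : CrossesTimes (Path.segment a b) γ 0 :=
  crossesTimes_zero fun t s h => hγ s <| h ▸
    segment_im_eq ha hb (by rw [← Path.range_segment]; exact ⟨t, rfl⟩)

/-- The curve stays strictly between the heights `-Y` and `Y`, so it cannot distinguish a full side
of the box from the infinite line. -/
lemma hits_segment_slantPt {m c Y : ℝ} {d e : ℂ} {γ : Path d e} (hγ : ∀ s, |(γ s).im| < Y) {y₀ : ℝ}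
    (hy₀ : y₀ = Y ∨ y₀ = -Y) :
    hits γ (segment ℝ (slantPt m c y₀) (slantPt m c (-y₀))) = hits γ (slantLine m c) := by
  ext s
  have := abs_lt.1 (hγ s)
  simp only [hits, slantLine, mem_ofPred_eq, mem_segment_slantPt, and_iff_left_iff_imp]
  intro _
  rcases hy₀ with rfl | rfl
  · rw [uIcc_comm, uIcc_of_le (by linarith)]; exact ⟨this.1.le, this.2.le⟩
  · rw [neg_neg, uIcc_of_le (by linarith)]; exact ⟨this.1.le, this.2.le⟩

lemma crossesTimes_segment_slantPt {m c Y : ℝ} {d e : ℂ} {γ : Path d e}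
    (h : TransverseLine m c γ) (hγ : ∀ s, |(γ s).im| < Y) {y₀ : ℝ} (hy₀ : y₀ = Y ∨ y₀ = -Y) :
    CrossesTimes (Path.segment (slantPt m c y₀) (slantPt m c (-y₀))) γ
      (hits γ (slantLine m c)).ncard := by
  have hY : 0 < Y := (abs_nonneg _).trans_lt (hγ 0)
  rw [← hits_segment_slantPt hγ hy₀]
  refine crossesTimes_segment h (slant_slantPt _ _ _) (slant_slantPt _ _ _) ?_ ?_ ?_
  · intro h
    have := congrArg Complex.im h
    simp only [slantPt_im] at this
    rcases hy₀ with rfl | rfl <;> linarith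
  · intro s hs
    have := abs_lt.1 (hγ s)
    rw [hs, slantPt_im] at this
    rcases hy₀ with rfl | rfl <;> linarith
  · intro s hs
    have := abs_lt.1 (hγ s)
    rw [hs, slantPt_im] at this
    rcases hy₀ with rfl | rfl <;> linarith

/-- How often, modulo two, the vertical sides of the boxes separate `z` from the far left. -/
noncomputable def boxParity (m : ℝ) (cs : List (ℝ × ℝ)) (z : ℂ) : ZMod 2 :=
  (cs.map fun c => leftOf m c.1 z + leftOf m c.2 z).sum

/-- The horizontal pieces run at heights `±Y`, off the curve. Each slanted side counts like its
whole line, so its parity depends only on the ends of the curve. -/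
lemma exists_crossesTimes_boxes {m Y : ℝ} {d e : ℂ} {γ : Path d e} (hγ : ∀ s, |(γ s).im| < Y)
    {cs : List (ℝ × ℝ)} (hcs : ∀ c ∈ cs, TransverseLine m c.1 γ ∧ TransverseLine m c.2 γ)
    {a : ℂ} (ha : a.im = Y) :
    ∃ n : ℕ, CrossesTimes (polyPath a (cs.flatMap (slantBox m Y))) γ n ∧
      (n : ZMod 2) = boxParity m cs d + boxParity m cs e := by
  have htop : ∀ s, (γ s).im ≠ Y := fun s => (abs_lt.1 (hγ s)).2.ne
  have hbot : ∀ s, (γ s).im ≠ -Y := fun s => (abs_lt.1 (hγ s)).1.ne'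
  induction cs generalizing a with
  | nil =>
    refine ⟨0, crossesTimes_zero fun _ s h => htop s (by rw [← h]; exact ha), ?_⟩
    simp [boxParity]
  | cons c cs ih =>
    obtain ⟨n, hn, hpar⟩ := ih (fun c hc => hcs c (List.mem_cons_of_mem _ hc))
      (a := slantPt m c.2 Y) rfl
    obtain ⟨h1, h2⟩ := hcs c List.mem_cons_self
    have s1 := crossesTimes_segment_slantPt h1 hγ (.inl rfl)
    have s2 := crossesTimes_segment_slantPt h2 hγ (.inr rfl)
    rw [neg_neg] at s2
    have ne1 : ∀ c s, γ s ≠ slantPt m c Y := fun c s h => htop s (by rw [h, slantPt_im])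
    have ne2 : ∀ c s, γ s ≠ slantPt m c (-Y) := fun c s h => hbot s (by rw [h, slantPt_im])
    have := crossesTimes_polyPath_cons
      (crossesTimes_segment_horizontal (b := slantPt m c.1 Y) ha rfl htop)
      (crossesTimes_polyPath_cons s1 (crossesTimes_polyPath_cons
        (crossesTimes_segment_horizontal (b := slantPt m c.2 (-Y)) rfl rfl hbot)
        (crossesTimes_polyPath_cons s2 hn (ne1 _)) (ne2 _)) (ne2 _)) (ne1 _)
    refine ⟨_, this, ?_⟩
    push_cast
    rw [h1.natCast_ncard_hits, h2.natCast_ncard_hits, hpar]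
    simp only [boxParity, List.map_cons, List.sum_cons]
    ring

lemma boxes_avoid {m Y : ℝ} {S : Set ℂ} (hS : ∀ z ∈ S, |z.im| < Y)
    {cs : List (ℝ × ℝ)} (hcs : ∀ c ∈ cs, ∀ z ∈ S, slant m z ≠ c.1 ∧ slant m z ≠ c.2)
    {a : ℂ} (ha : a.im = Y) (t : I) : polyPath a (cs.flatMap (slantBox m Y)) t ∈ Sᶜ := by
  have htop : ∀ {z : ℂ}, z.im = Y → z ∈ Sᶜ := fun hz hs => (abs_lt.1 (hS _ hs)).2.ne hz
  have hbot : ∀ {z : ℂ}, z.im = -Y → z ∈ Sᶜ := fun hz hs => (abs_lt.1 (hS _ hs)).1.ne' hz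
  induction cs generalizing a t with
  | nil => exact htop ha
  | cons c cs ih =>
    have h4 := polyPath_cons_forall (a := slantPt m c.2 (-Y)) (S := Sᶜ)
      (fun z hz hs => (hcs c List.mem_cons_self z hs).2 (mem_segment_slantPt.1 hz).1)
      (ih (fun c hc => hcs c (List.mem_cons_of_mem _ hc)) (slantPt_im m c.2 Y))
    have h3 := polyPath_cons_forall (a := slantPt m c.1 (-Y))
      (fun z hz => hbot (segment_im_eq (slantPt_im _ _ _) (slantPt_im _ _ _) hz)) h4
    have h2 := polyPath_cons_forall (a := slantPt m c.1 Y)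
      (fun z hz hs => (hcs c List.mem_cons_self z hs).1 (mem_segment_slantPt.1 hz).1) h3
    exact polyPath_cons_forall (fun z hz => htop (segment_im_eq ha (slantPt_im _ _ _) hz)) h2 t

/-! ### From boxes to odd Euler paths of embedded graphs -/

namespace Embedding

variable {V : Type*} {G : SimpleGraph V} {Γ : Embedding G}

/-- The half-plane above height `Y` is connected, unbounded and disjoint from the drawing. -/
lemma mem_outerFace {Y : ℝ} (hY : ∀ z ∈ Γ.image, |z.im| < Y) {z : ℂ} (hz : z.im = Y) :
    z ∈ Γ.outerFace := by
  have hsub : {w : ℂ | Y ≤ w.im} ⊆ Γ.imageᶜ := fun w hw hw' =>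
    (abs_lt.1 (hY w hw')).2.not_ge hw
  refine ⟨hsub hz.ge, fun hb => ?_⟩
  have hconn : IsPreconnected {w : ℂ | Y ≤ w.im} := (convex_halfSpace_im_ge Y).isPreconnected
  have hb := hb.subset (hconn.subset_connectedComponentIn hz.ge hsub)
  obtain ⟨R, hR⟩ := hb.exists_norm_le
  have := hR (⟨0, max Y (R + 1)⟩ : ℂ) (le_max_left Y (R + 1))
  have h2 := (Complex.abs_im_le_norm _).trans this
  have h3 := (le_abs_self _).trans h2
  have h4 := le_max_right Y (R + 1)
  simp only at h3
  linarith

/-- The first segment is the part of the ray below height `Y` and meets each edge exactly where the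
ray does; the boxes contribute `boxParity`. -/
theorem Transverse.isOddEulerPath {m Y : ℝ} {p : ℂ} (h : Γ.Transverse m (slant m p))
    (hp : p ∉ Γ.image) (hY : ∀ z ∈ Γ.image, |z.im| < Y) (hpY : p.im < Y) {cs : List (ℝ × ℝ)}
    (hcs : ∀ c ∈ cs, Γ.Transverse m c.1 ∧ Γ.Transverse m c.2)
    (hpar : ∀ {u v : V} (e : G.Adj u v), (Γ.edgeHits (slantRay m p) e : ZMod 2) +
      (boxParity m cs (Γ.pos u) + boxParity m cs (Γ.pos v)) = 1) :
    lastPoint p (slantPt m (slant m p) Y :: cs.flatMap (slantBox m Y)) ∈ Γ.outerFace ∧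
      Γ.IsOddEulerPath
        (polyPath p (slantPt m (slant m p) Y :: cs.flatMap (slantBox m Y))) := by
  refine ⟨mem_outerFace hY (lastPoint_im_flatMap_slantBox (slantPt_im _ _ _) cs), ?_, ?_⟩
  · intro t v ht
    refine polyPath_cons_forall (S := (range Γ.pos)ᶜ) ?_ (boxes_avoid ?_ ?_ rfl) t ⟨v, ht.symm⟩
    · rintro z hz ⟨v, rfl⟩
      have key := mem_segment_slantPt (m := m) (c := slant m p) (y₁ := p.im) (y₂ := Y)
        (z := Γ.pos v)
      rw [slantPt_slant] at key
      exact h.pos v (key.1 hz).1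
    · rintro _ ⟨v, rfl⟩
      exact hY _ (Γ.pos_mem_image v)
    · rintro c hc _ ⟨v, rfl⟩
      exact ⟨(hcs c hc).1.pos v, (hcs c hc).2.pos v⟩
  · intro u v e
    have hγ : ∀ s, |(Γ.curve e s).im| < Y := fun s => hY _ (Γ.curve_mem_image e s)
    have hγp : ∀ s, Γ.curve e s ≠ p := fun s hs => hp (hs ▸ Γ.curve_mem_image e s)
    have hγt : ∀ s, Γ.curve e s ≠ slantPt m (slant m p) Y := fun s hs =>
      (abs_lt.1 (hγ s)).2.ne (by rw [hs, slantPt_im])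
    obtain ⟨n, hn, hnpar⟩ := exists_crossesTimes_boxes hγ
      (fun c hc => ⟨(hcs c hc).1.curve e, (hcs c hc).2.curve e⟩)
      (slantPt_im m (slant m p) Y)
    have hray : hits (Γ.curve e) (segment ℝ p (slantPt m (slant m p) Y)) =
        hits (Γ.curve e) (slantRay m p) := by
      ext s
      have key := mem_segment_slantPt (m := m) (c := slant m p) (y₁ := p.im) (y₂ := Y)
        (z := Γ.curve e s)
      rw [slantPt_slant, uIcc_of_le hpY.le] at key
      simp only [hits, mem_ofPred_eq, key, slantRay, mem_Icc]
      refine and_congr_right fun h1 => ⟨fun h2 => lt_of_le_of_ne h2.1 fun h3 => hγp s ?_,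
        fun h2 => ⟨h2.le, (abs_lt.1 (hγ s)).2.le⟩⟩
      rw [← slantPt_slant m (Γ.curve e s), h1, ← h3, slantPt_slant]
    have s1 := crossesTimes_segment (h.curve e) rfl (slant_slantPt m (slant m p) Y)
      (fun hh => hpY.ne (by rw [hh, slantPt_im])) hγp hγt
    rw [hray] at s1
    have := crossesTimes_polyPath_cons s1 hn hγt
    refine ⟨this.finite, this.crosses, ?_⟩
    rw [this.ncard, ← ZMod.natCast_eq_one_iff_odd]
    push_cast
    rw [hnpar]
    exact hpar e

/-- The slanted lines at offsets `c.1` and `c.2` isolate the vertex `w` from all the others. -/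
structure Isolates (Γ : Embedding G) (m : ℝ) (w : V) (c : ℝ × ℝ) : Prop where
  left : Γ.Transverse m c.1
  right : Γ.Transverse m c.2
  left_lt : c.1 < slant m (Γ.pos w)
  lt_right : slant m (Γ.pos w) < c.2
  other : ∀ u ≠ w, slant m (Γ.pos u) < c.1 ∨ c.2 < slant m (Γ.pos u)

lemma Isolates.leftOf_add [DecidableEq V] {m : ℝ} {w : V} {c : ℝ × ℝ} (h : Γ.Isolates m w c)
    (u : V) :
    leftOf m c.1 (Γ.pos u) + leftOf m c.2 (Γ.pos u) = if u = w then 1 else 0 := by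
  split_ifs with hu
  · subst hu
    simp [leftOf, h.left_lt.not_gt, h.lt_right]
  · have hc := h.left_lt.trans h.lt_right
    rcases h.other u hu with hlt | hgt
    · simp only [leftOf, if_pos hlt, if_pos (hlt.trans hc)]
      exact CharTwo.add_self_eq_zero _
    · simp [leftOf, hgt.not_gt, (hc.trans hgt).not_gt]

/-- At a vertex `u`, `boxParity` counts the listed vertices whose strip contains `u`. By isolation
and absence of duplicates this is one if `u` is listed and zero otherwise, that is, `g u`. -/
theorem Transverse.isOddEulerPath_of_isolates {m Y : ℝ} {p : ℂ} (h : Γ.Transverse m (slant m p))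
    (hp : p ∉ Γ.image) (hY : ∀ z ∈ Γ.image, |z.im| < Y) (hpY : p.im < Y) {g : V → ZMod 2}
    (hg : ∀ {u v : V} (e : G.Adj u v), 1 + (Γ.edgeHits (slantRay m p) e : ZMod 2) = g u + g v)
    {vl : List V} (hnd : vl.Nodup) (hvl : ∀ v, v ∈ vl ↔ g v = 1) {c : V → ℝ × ℝ}
    (hc : ∀ v ∈ vl, Γ.Isolates m v (c v)) :
    lastPoint p (slantPt m (slant m p) Y :: vl.flatMap fun v => slantBox m Y (c v)) ∈ Γ.outerFace ∧
      Γ.IsOddEulerPath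
        (polyPath p (slantPt m (slant m p) Y :: vl.flatMap fun v => slantBox m Y (c v))) := by
  classical
  have hpar : ∀ u, boxParity m (vl.map c) (Γ.pos u) = g u := fun u => by
    have h1 : boxParity m (vl.map c) (Γ.pos u) =
        (vl.map fun w => if u = w then (1 : ZMod 2) else 0).sum := by
      rw [boxParity, List.map_map]
      congr 1
      exact List.map_congr_left fun w hw => (hc w hw).leftOf_add u
    have h2 : (vl.map fun w => if u = w then (1 : ZMod 2) else 0).sum = (vl.count u : ZMod 2) := by
      simp_rw [eq_comm (a := u)]
      rw [List.sum_map_ite_eq]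
      simp
    have hz : ∀ x : ZMod 2, x ≠ 1 → x = 0 := by decide
    rw [h1, h2]
    by_cases hu : u ∈ vl
    · rw [List.count_eq_one_of_mem hnd hu, (hvl u).1 hu]; rfl
    · rw [List.count_eq_zero_of_not_mem hu, hz _ fun h => hu ((hvl u).2 h)]; rfl
  have := h.isOddEulerPath hp hY hpY (cs := vl.map c) ?_ ?_
  · rwa [List.flatMap_map] at this
  · intro d hd
    obtain ⟨v, hv, rfl⟩ := List.mem_map.1 hd
    exact ⟨(hc v hv).left, (hc v hv).right⟩
  · intro u v e
    rw [hpar, hpar, ← hg e]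
    linear_combination CharTwo.add_self_eq_zero (Γ.edgeHits (slantRay m p) e : ZMod 2)

end Embedding

end OddEuler

namespace OddEuler

open Filter Topology MeasureTheory

/-! ### Generic lines are transversal -/

/-- Sard's theorem in dimension one, where differentiability at the critical points is enough. -/
lemma volume_image_eq_zero_of_hasDerivAt_zero {f : ℝ → ℝ} {A : Set ℝ}
    (h : ∀ s ∈ A, HasDerivAt f 0 s) : volume (f '' A) = 0 := by
  refine addHaar_image_eq_zero_of_det_fderivWithin_eq_zero volume
    (f' := fun _ => (ContinuousLinearMap.toSpanSingleton ℝ (0 : ℝ)))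
    (fun s hs => (h s hs).hasFDerivAt.hasFDerivWithinAt) fun s _ => ?_
  simp

lemma PiecewiseRegular.exists_finite {a b : ℂ} {γ : Path a b} (h : PiecewiseRegular γ) :
    ∃ B : Set ℝ, B.Finite ∧ 0 ∈ B ∧ 1 ∈ B ∧
      ∀ s : I, (s : ℝ) ∉ B → ∃ w, HasDerivAt γ.extend w s := by
  obtain ⟨n, τ, h0, h1, hτ⟩ := h
  refine ⟨τ '' Iic n, (finite_Iic n).image τ, ⟨0, Nat.zero_le n, h0⟩, ⟨n, mem_Iic.2 le_rfl, h1⟩, ?_⟩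
  intro s hs
  have key : ∀ k ≤ n, (s : ℝ) < τ k → ∃ i < n, (s : ℝ) ∈ Ioo (τ i) (τ (i + 1)) := by
    intro k
    induction k with
    | zero => exact fun _ hlt => absurd s.2.1 (not_le.2 (h0 ▸ hlt))
    | succ k ih =>
      intro hk hlt
      rcases lt_trichotomy (s : ℝ) (τ k) with hs' | hs' | hs'
      · exact ih (by omega) hs'
      · exact absurd ⟨k, (by omega : k ≤ n), hs'.symm⟩ hs
      · exact ⟨k, by omega, hs', hlt⟩
  obtain ⟨i, hi, hsi⟩ := key n le_rfl
    (lt_of_le_of_ne (h1 ▸ s.2.2) fun he => hs ⟨n, mem_Iic.2 le_rfl, he.symm⟩)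
  have hd := ((hτ i hi).2.1.differentiableOn (by norm_num)).differentiableAt
    (Icc_mem_nhds hsi.1 hsi.2)
  exact ⟨_, hd.hasDerivAt⟩

/-- An offset is bad only if it is the value of `slant m` at one of finitely many break points or a
critical value of `slant m` along the curve. -/
lemma PiecewiseRegular.ae_transverseLine {a b : ℂ} {γ : Path a b} (h : PiecewiseRegular γ)
    (m : ℝ) : ∀ᵐ c : ℝ, TransverseLine m c γ := by
  obtain ⟨B, hB, h0, h1, hd⟩ := h.exists_finite
  let φ : ℝ → ℝ := fun t => slant m (γ.extend t)
  have hn1 : ∀ᵐ c : ℝ, c ∉ φ '' B :=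
    (hB.image φ).measure_zero volume |> measure_eq_zero_iff_ae_notMem.1
  have hn2 : ∀ᵐ c : ℝ, c ∉ φ '' {s | HasDerivAt φ 0 s} :=
    measure_eq_zero_iff_ae_notMem.1 (volume_image_eq_zero_of_hasDerivAt_zero fun s hs => hs)
  filter_upwards [hn1, hn2] with c hc1 hc2
  refine ⟨fun he => hc1 ⟨0, h0, by simpa [φ] using he⟩,
    fun he => hc1 ⟨1, h1, by simpa [φ] using he⟩, fun s hs => ?_⟩
  have hφ : φ s = c := by simpa [φ] using hs
  obtain ⟨w, hw⟩ := hd s fun hsB => hc1 ⟨s, hsB, hφ⟩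
  refine ⟨w, hw, fun hw0 => hc2 ⟨s, ?_, hφ⟩⟩
  have := hasDerivAt_slant_extend (m := m) hw
  rwa [hw0] at this

lemma slant_eq_slant_iff {m : ℝ} {z p : ℂ} (hz : z ≠ p) :
    slant m z = slant m p ↔ z.im ≠ p.im ∧ (z.re - p.re) / (z.im - p.im) = m := by
  simp only [slant_apply]
  by_cases him : z.im = p.im
  · have : z.re ≠ p.re := fun hre => hz (Complex.ext hre him)
    simp [him, this]
  · have : z.im - p.im ≠ 0 := sub_ne_zero.2 him
    simp only [him, ne_eq, not_false_eq_true, true_and]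
    rw [div_eq_iff this]
    constructor <;> intro h <;> linarith

lemma ae_slant_ne {z p : ℂ} (hz : z ≠ p) : ∀ᵐ m : ℝ, slant m z ≠ slant m p := by
  have : ∀ᵐ m : ℝ, m ∉ ({(z.re - p.re) / (z.im - p.im)} : Set ℝ) :=
    measure_eq_zero_iff_ae_notMem.1 (by simp)
  filter_upwards [this] with m hm h
  exact hm ((slant_eq_slant_iff hz).1 h).2.symm

/-- The varying parameter is now the slope. The curve seen from `p` has slope function `ψ`, the line
through `p` with slope `m` is met where `ψ = m`, and a tangential meeting is a critical point of
`ψ`. So almost every slope is good. -/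
lemma PiecewiseRegular.ae_transverseLine_through {a b : ℂ} {γ : Path a b}
    (h : PiecewiseRegular γ) {p : ℂ} (hp : ∀ t, γ t ≠ p) :
    ∀ᵐ m : ℝ, TransverseLine m (slant m p) γ := by
  obtain ⟨B, hB, h0, h1, hd⟩ := h.exists_finite
  -- At the height of `p` the quotient takes the default value zero. This is harmless: a line of
  -- direction `m + i` through `p` contains no other point of that height.
  let ψ : ℝ → ℝ := fun t => ((γ.extend t).re - p.re) / ((γ.extend t).im - p.im)
  have hn1 : ∀ᵐ m : ℝ, m ∉ ψ '' B :=
    (hB.image ψ).measure_zero volume |> measure_eq_zero_iff_ae_notMem.1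
  have hn2 : ∀ᵐ m : ℝ, m ∉ ψ '' {s | HasDerivAt ψ 0 s} :=
    measure_eq_zero_iff_ae_notMem.1 (volume_image_eq_zero_of_hasDerivAt_zero fun s hs => hs)
  filter_upwards [hn1, hn2] with m hm1 hm2
  have hψ : ∀ s : I, slant m (γ s) = slant m p → (γ s).im ≠ p.im ∧ ψ s = m := fun s hs => by
    simpa [ψ] using (slant_eq_slant_iff (hp s)).1 hs
  refine ⟨fun he => hm1 ⟨0, h0, (hψ 0 (by simpa using he)).2⟩,
    fun he => hm1 ⟨1, h1, (hψ 1 (by simpa using he)).2⟩, fun s hs => ?_⟩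
  obtain ⟨him, hs'⟩ := hψ s hs
  obtain ⟨w, hw⟩ := hd s fun hsB => hm1 ⟨s, hsB, hs'⟩
  refine ⟨w, hw, fun hw0 => hm2 ⟨s, ?_, hs'⟩⟩
  have hre : HasDerivAt (fun t => (γ.extend t).re - p.re) w.re s :=
    (Complex.reCLM.hasFDerivAt.comp_hasDerivAt _ hw).sub_const _
  have hime : HasDerivAt (fun t => (γ.extend t).im - p.im) w.im s :=
    (Complex.imCLM.hasFDerivAt.comp_hasDerivAt _ hw).sub_const _
  have hne : (γ.extend s).im - p.im ≠ 0 := by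
    rw [γ.extend_extends']; exact sub_ne_zero.2 him
  have := hre.div hime hne
  rw [γ.extend_extends'] at this
  rw [slant_apply] at hw0
  rw [slant_apply, slant_apply] at hs
  have e1 : (γ s).re - p.re = m * ((γ s).im - p.im) := by linarith
  have e2 : w.re = m * w.im := by linarith
  have e3 : m * w.im * ((γ s).im - p.im) - m * ((γ s).im - p.im) * w.im = 0 := by ring
  rw [e1, e2, e3, zero_div] at this
  exact this

/-! ### Generic lines for an embedded graph, and existence of the path -/

namespace Embedding

variable {V : Type*} {G : SimpleGraph V} {Γ : Embedding G}

lemma ae_transverse [Finite V] (Γ : Embedding G) (m : ℝ) : ∀ᵐ c : ℝ, Γ.Transverse m c := by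
  have h1 : ∀ᵐ c : ℝ, ∀ v, slant m (Γ.pos v) ≠ c := by
    rw [ae_all_iff]
    intro v
    have : ∀ᵐ c : ℝ, c ∉ ({slant m (Γ.pos v)} : Set ℝ) := measure_eq_zero_iff_ae_notMem.1 (by simp)
    filter_upwards [this] with c hc h
    exact hc h.symm
  have h2 : ∀ᵐ c : ℝ, ∀ (u v : V) (h : G.Adj u v), TransverseLine m c (Γ.curve h) := by
    simp only [ae_all_iff]
    exact fun u v h => (Γ.regular h).ae_transverseLine m
  filter_upwards [h1, h2] with c hc1 hc2
  exact ⟨hc1, fun {u v} h => hc2 u v h⟩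

lemma ae_transverse_through [Finite V] {p : ℂ} (hp : p ∉ Γ.image) :
    ∀ᵐ m : ℝ, Γ.Transverse m (slant m p) := by
  have h1 : ∀ᵐ m : ℝ, ∀ v, slant m (Γ.pos v) ≠ slant m p := by
    rw [ae_all_iff]
    exact fun v => ae_slant_ne fun h => hp (h ▸ Γ.pos_mem_image v)
  have h2 : ∀ᵐ m : ℝ, ∀ (u v : V) (h : G.Adj u v),
      TransverseLine m (slant m p) (Γ.curve h) := by
    simp only [ae_all_iff]
    exact fun u v h => (Γ.regular h).ae_transverseLine_through
      fun t ht => hp (ht ▸ Γ.curve_mem_image h t)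
  filter_upwards [h1, h2] with c hc1 hc2
  exact ⟨hc1, fun {u v} h => hc2 u v h⟩

lemma isCompact_image [Finite V] (Γ : Embedding G) : IsCompact Γ.image := by
  refine (finite_range Γ.pos).isCompact.union ?_
  have : {z | ∃ (u v : V) (h : G.Adj u v) (t : I), Γ.curve h t = z} =
      ⋃ (u) (v) (h : G.Adj u v), range (Γ.curve h) := by
    ext; simp
  rw [this]
  exact isCompact_iUnion fun u => isCompact_iUnion fun v => isCompact_iUnion fun h =>
    isCompact_range (Γ.curve h).continuous

/-- Choose the two offsets within a distance smaller than every gap to another vertex; the good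
offsets are dense. -/
lemma exists_isolates [Finite V] {m : ℝ} (hm : ∀ u v, u ≠ v → slant m (Γ.pos u) ≠ slant m (Γ.pos v))
    (w : V) : ∃ c, Γ.Isolates m w c := by
  have hδ : ∀ᶠ δ in 𝓝[>] (0 : ℝ), ∀ u, u ≠ w → δ < |slant m (Γ.pos u) - slant m (Γ.pos w)| := by
    rw [eventually_all]
    intro u
    by_cases hu : u = w
    · exact Eventually.of_forall fun _ h => absurd hu h
    · filter_upwards [nhdsWithin_le_nhds (Iio_mem_nhds (abs_pos.2 (sub_ne_zero.2 (hm u w hu))))]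
        with δ hδ _ using hδ
  obtain ⟨δ, hδ, hδ0⟩ := (hδ.and self_mem_nhdsWithin).exists
  have hδ0 : 0 < δ := hδ0
  have hdense : Dense {c | Γ.Transverse m c} := Measure.dense_of_ae (Γ.ae_transverse m)
  obtain ⟨c₁, h1, h1l, h1r⟩ := hdense.exists_between (sub_lt_self (slant m (Γ.pos w)) hδ0)
  obtain ⟨c₂, h2, h2l, h2r⟩ := hdense.exists_between (lt_add_of_pos_right (slant m (Γ.pos w)) hδ0)
  refine ⟨(c₁, c₂), h1, h2, h1r, h2l, fun u hu => ?_⟩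
  rcases lt_abs.1 (hδ u hu) with h | h
  · exact .inr (by simp only; linarith)
  · exact .inl (by simp only; linarith)

theorem IsOddAround.exists_oddEulerPath [Finite V] {p : ℂ} (hodd : Γ.IsOddAround p) :
    ∃ q ∈ Γ.outerFace, ∃ T : Path p q, Γ.IsOddEulerPath T := by
  classical
  have : Fintype V := Fintype.ofFinite V
  have hsep : ∀ᵐ m : ℝ, ∀ u v, u ≠ v → slant m (Γ.pos u) ≠ slant m (Γ.pos v) := by
    simp only [ae_all_iff]
    exact fun u v huv => ae_slant_ne (Γ.pos_injective.ne huv)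
  obtain ⟨m, hm, hsep⟩ := ((ae_transverse_through hodd.1).and hsep).exists
  obtain ⟨g, hg⟩ := hodd.exists_potential hm
  choose c hc using exists_isolates hsep
  obtain ⟨R, hR⟩ := Γ.isCompact_image.isBounded.exists_norm_le
  let Y := max R ‖p‖ + 1
  have h1 : R < Y := (le_max_left R ‖p‖).trans_lt (lt_add_one _)
  have h2 : ‖p‖ < Y := (le_max_right R ‖p‖).trans_lt (lt_add_one _)
  obtain ⟨hq, hT⟩ := hm.isOddEulerPath_of_isolates hodd.1 (Y := Y)
    (fun z hz => ((Complex.abs_im_le_norm z).trans (hR z hz)).trans_lt h1)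
    ((le_abs_self _).trans_lt ((Complex.abs_im_le_norm p).trans_lt h2)) hg
    (Finset.univ.filter fun v => g v = 1).nodup_toList (fun v => by simp)
    (fun v _ => hc v)
  exact ⟨_, hq, _, hT⟩

end Embedding

end OddEuler

namespace OddEuler

/-! ### Running times of programs -/

section time

variable {a b c : Ty}

lemma Prog.time_comp (g : Prog b c) (f : Prog a b) (x : a.Val) :
    (Prog.comp g f).time x =
      1 + a.size x + c.size (g.eval (f.eval x)) + (f.time x + g.time (f.eval x)) := rfl

lemma Prog.time_pair (f : Prog a b) (g : Prog a c) (x : a.Val) :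
    (Prog.pair f g).time x =
      1 + a.size x + (1 + b.size (f.eval x) + c.size (g.eval x)) + (f.time x + g.time x) := rfl

lemma Prog.time_ifPos (t : Prog a .rat) (f g : Prog a b) (x : a.Val) :
    (Prog.ifPos t f g).time x =
      1 + a.size x + b.size (if 0 < t.eval x then f.eval x else g.eval x) +
        (t.time x + if 0 < t.eval x then f.time x else g.time x) := rfl

lemma Prog.time_fold (f : Prog (.prod b a) b) (x : (Ty.prod b (.list a)).Val) :
    (Prog.fold f).time x =
      1 + (Ty.prod b (.list a)).size x + b.size (x.2.foldl (fun s y => f.eval (s, y)) x.1) +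
        (x.2.foldl (fun s y => (f.eval (s.1, y), s.2 + f.time (s.1, y))) (x.1, 0)).2 := rfl

/-- Every instruction pays for writing its output. Time bounds therefore also bound the sizes of
intermediate results, which is what composition needs. -/
lemma Prog.size_eval_le_time (f : Prog a b) (x : a.Val) : b.size (f.eval x) ≤ f.time x := by
  cases f <;> simp only [Prog.time] <;> omega

end time

/-! ### Polynomial bounds -/

lemma polynomial_eval_mono (P : Polynomial ℕ) {m n : ℕ} (h : m ≤ n) : P.eval m ≤ P.eval n := by
  induction P using Polynomial.induction_on' with
  | add p q hp hq => rw [Polynomial.eval_add, Polynomial.eval_add]; exact add_le_add hp hq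
  | monomial k c =>
    rw [Polynomial.eval_monomial, Polynomial.eval_monomial]
    exact Nat.mul_le_mul_left _ (Nat.pow_le_pow_left h k)

/-- `f` is computed by a program in polynomial time. -/
def PolyTime (a b : Ty) (f : a.Val → b.Val) : Prop :=
  ∃ F : Prog a b, (∀ x, F.eval x = f x) ∧ ∃ P : Polynomial ℕ, ∀ x, F.time x ≤ P.eval (a.size x)

/-- The quantity `f` is polynomially bounded in the size of the input. -/
def PolyBound (a : Ty) (f : a.Val → ℕ) : Prop := ∃ P : Polynomial ℕ, ∀ x, f x ≤ P.eval (a.size x)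

namespace PolyBound

variable {a : Ty} {f g : a.Val → ℕ}

lemma mono (hg : PolyBound a g) (h : ∀ x, f x ≤ g x) : PolyBound a f :=
  ⟨hg.choose, fun x => (h x).trans (hg.choose_spec x)⟩

lemma const (n : ℕ) : PolyBound a fun _ => n := ⟨Polynomial.C n, fun x => by simp⟩

lemma size : PolyBound a a.size := ⟨Polynomial.X, fun x => by simp⟩

lemma add (hf : PolyBound a f) (hg : PolyBound a g) : PolyBound a fun x => f x + g x := by
  obtain ⟨P, hP⟩ := hf
  obtain ⟨Q, hQ⟩ := hg
  exact ⟨P + Q, fun x => by rw [Polynomial.eval_add]; exact add_le_add (hP x) (hQ x)⟩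

lemma mul (hf : PolyBound a f) (hg : PolyBound a g) : PolyBound a fun x => f x * g x := by
  obtain ⟨P, hP⟩ := hf
  obtain ⟨Q, hQ⟩ := hg
  exact ⟨P * Q, fun x => by rw [Polynomial.eval_mul]; exact mul_le_mul' (hP x) (hQ x)⟩

lemma eval (P : Polynomial ℕ) (hf : PolyBound a f) : PolyBound a fun x => P.eval (f x) := by
  obtain ⟨Q, hQ⟩ := hf
  exact ⟨P.comp Q, fun x => by rw [Polynomial.eval_comp]; exact polynomial_eval_mono P (hQ x)⟩

end PolyBound

lemma PolyTime.polyBound {a b : Ty} {f : a.Val → b.Val} (h : PolyTime a b f) :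
    PolyBound a fun x => b.size (f x) := by
  obtain ⟨F, hF, P, hP⟩ := h
  exact ⟨P, fun x => by
    change b.size (f x) ≤ _
    rw [← hF]; exact (F.size_eval_le_time x).trans (hP x)⟩

/-! ### Sizes -/

@[simp] lemma Ty.size_prod (a b : Ty) (x : (Ty.prod a b).Val) :
    (Ty.prod a b).size x = 1 + a.size x.1 + b.size x.2 := rfl

@[simp] lemma Ty.size_nil (a : Ty) : (Ty.list a).size ([] : List a.Val) = 1 := rfl

@[simp] lemma Ty.size_cons (a : Ty) (x : a.Val) (l : List a.Val) :
    (Ty.list a).size (x :: l : List a.Val) = 1 + a.size x + (Ty.list a).size l := by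
  simp only [Ty.size, List.map_cons, List.sum_cons]; ring

lemma Ty.size_append (a : Ty) (l l' : List a.Val) :
    (Ty.list a).size (l ++ l' : List a.Val) + 1 = (Ty.list a).size l + (Ty.list a).size l' := by
  simp only [Ty.size, List.map_append, List.sum_append]; ring

lemma Ty.size_prefix (a : Ty) {l l' : List a.Val} (h : l <+: l') :
    (Ty.list a).size l ≤ (Ty.list a).size l' := by
  obtain ⟨t, rfl⟩ := h
  have := Ty.size_append a l t
  have : 1 ≤ (Ty.list a).size t := by simp [Ty.size]
  omega

lemma Ty.size_mem (a : Ty) {l : List a.Val} {x : a.Val} (h : x ∈ l) :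
    a.size x ≤ (Ty.list a).size l := by
  induction l with
  | nil => simp at h
  | cons y l ih =>
    rw [Ty.size_cons]
    rcases List.mem_cons.1 h with rfl | h
    · omega
    · have := ih h; omega

lemma Ty.length_le_size (a : Ty) (l : List a.Val) : l.length ≤ (Ty.list a).size l := by
  induction l with
  | nil => simp
  | cons y l ih => rw [Ty.size_cons, List.length_cons]; omega

lemma Ty.size_list_le (a : Ty) {l : List a.Val} {N B : ℕ} (hl : l.length ≤ N)
    (h : ∀ x ∈ l, a.size x ≤ B) : (Ty.list a).size l ≤ 1 + N * (1 + B) := by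
  refine le_trans ?_ (Nat.add_le_add_left (Nat.mul_le_mul_right _ hl) 1)
  induction l with
  | nil => simp
  | cons y l ih =>
    rw [Ty.size_cons, List.length_cons]
    have h1 := ih (by rw [List.length_cons] at hl; omega) fun x hx =>
      h x (List.mem_cons_of_mem _ hx)
    have h2 := h y List.mem_cons_self
    nlinarith

lemma size_mul_le (m n : ℕ) : Nat.size (m * n) ≤ Nat.size m + Nat.size n := by
  rw [Nat.size_le, pow_add]
  exact Nat.mul_lt_mul'' (Nat.lt_size_self m) (Nat.lt_size_self n)

lemma size_add_le (m n : ℕ) : Nat.size (m + n) ≤ Nat.size m + Nat.size n + 1 := by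
  rw [Nat.size_le, pow_succ, pow_add]
  have h1 := Nat.lt_size_self m
  have h2 := Nat.lt_size_self n
  have h3 : 0 < 2 ^ m.size := by positivity
  have h4 : 0 < 2 ^ n.size := by positivity
  nlinarith [Nat.mul_le_mul h1 h4, Nat.mul_le_mul h3 h2]

/-- Reduction to lowest terms only shrinks numerator and denominator. The constant `3` is the size
of zero, the value when `n = 0`. -/
lemma size_rat_intCast_div_le (m n : ℤ) :
    Ty.rat.size ((m : ℚ) / n) ≤ 3 + Nat.size m.natAbs + Nat.size n.natAbs := by
  rcases eq_or_ne n 0 with rfl | hn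
  · simp [Ty.size]
  rcases eq_or_ne m 0 with rfl | hm
  · simp [Ty.size]
  rw [← Rat.divInt_eq_div]
  have h1 : (Rat.divInt m n).num.natAbs ≤ m.natAbs :=
    Nat.le_of_dvd (Int.natAbs_pos.2 hm) (Int.natAbs_dvd_natAbs.2 (Rat.num_dvd m hn))
  have h2 : (Rat.divInt m n).den ≤ n.natAbs :=
    Nat.le_of_dvd (Int.natAbs_pos.2 hn) (Int.natCast_dvd.1 (Rat.den_dvd m n))
  have := Nat.size_le_size h1
  have := Nat.size_le_size h2
  simp only [Ty.size]
  omega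

lemma size_rat_neg (q : ℚ) : Ty.rat.size (-q) = Ty.rat.size q := by
  simp [Ty.size]

/-- The factor two arises because the denominators enter both the new numerator and the new
denominator. -/
lemma size_rat_add_le (q r : ℚ) :
    Ty.rat.size (q + r) ≤ 4 + 2 * (Ty.rat.size q + Ty.rat.size r) := by
  have h : q + r = ((q.num * r.den + r.num * q.den : ℤ) : ℚ) / ((q.den * r.den : ℤ) : ℚ) := by
    have h1 : (q.den : ℚ) ≠ 0 := by exact_mod_cast q.den_ne_zero
    have h2 : (r.den : ℚ) ≠ 0 := by exact_mod_cast r.den_ne_zero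
    conv_lhs => rw [← Rat.num_div_den q, ← Rat.num_div_den r]
    push_cast
    field_simp
  rw [h]
  refine (size_rat_intCast_div_le _ _).trans ?_
  have h1 : (q.num * r.den + r.num * q.den : ℤ).natAbs ≤
      q.num.natAbs * r.den + r.num.natAbs * q.den :=
    (Int.natAbs_add_le _ _).trans (by simp [Int.natAbs_mul])
  have h2 : (q.den * r.den : ℤ).natAbs = q.den * r.den := by simp [Int.natAbs_mul]
  have := (Nat.size_le_size h1).trans (size_add_le _ _)
  have := size_mul_le q.num.natAbs r.den
  have := size_mul_le r.num.natAbs q.den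
  have := size_mul_le q.den r.den
  rw [h2]
  simp only [Ty.size]
  omega

lemma size_rat_mul_le (q r : ℚ) :
    Ty.rat.size (q * r) ≤ 3 + (Ty.rat.size q + Ty.rat.size r) := by
  have h : q * r = ((q.num * r.num : ℤ) : ℚ) / ((q.den * r.den : ℤ) : ℚ) := by
    conv_lhs => rw [← Rat.num_div_den q, ← Rat.num_div_den r]
    push_cast
    rw [div_mul_div_comm]
  rw [h]
  refine (size_rat_intCast_div_le _ _).trans ?_
  have := size_mul_le q.num.natAbs r.num.natAbs
  have := size_mul_le q.den r.den
  simp only [Ty.size, Int.natAbs_mul, Int.natAbs_natCast]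
  omega

lemma size_rat_div_le (q r : ℚ) :
    Ty.rat.size (q / r) ≤ 3 + (Ty.rat.size q + Ty.rat.size r) := by
  have h : q / r = ((q.num * r.den : ℤ) : ℚ) / ((q.den * r.num : ℤ) : ℚ) := by
    conv_lhs => rw [← Rat.num_div_den q, ← Rat.num_div_den r]
    push_cast
    rw [div_div_div_eq]
  rw [h]
  refine (size_rat_intCast_div_le _ _).trans ?_
  have := size_mul_le q.num.natAbs r.den
  have := size_mul_le q.den r.num.natAbs
  simp only [Ty.size, Int.natAbs_mul, Int.natAbs_natCast]
  omega

/-! ### Closure properties of polynomial time functions -/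

namespace PolyTime

variable {a b c d : Ty}

lemma id : PolyTime a a fun x => x :=
  ⟨.id, fun _ => rfl, ((PolyBound.const 1).add (.size)).add .size |>.add (.const 0)⟩

lemma comp {g : b.Val → c.Val} {f : a.Val → b.Val} (hg : PolyTime b c g) (hf : PolyTime a b f) :
    PolyTime a c fun x => g (f x) := by
  have h := hf.polyBound
  obtain ⟨F, hF, hP⟩ := hf
  have h' := hg.polyBound
  obtain ⟨G, hG, Q, hQ⟩ := hg
  obtain ⟨R, hR⟩ := h'
  refine ⟨.comp G F, fun x => by rw [Prog.eval, hF, hG], ?_⟩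
  refine PolyBound.mono (((PolyBound.const 1).add .size).add (.eval R h) |>.add
    (PolyBound.add hP (.eval Q h))) fun x => ?_
  rw [Prog.time_comp, hF, hG]
  have := hQ (f x)
  have := hR (f x)
  gcongr

lemma pair {f : a.Val → b.Val} {g : a.Val → c.Val} (hf : PolyTime a b f) (hg : PolyTime a c g) :
    PolyTime a (.prod b c) fun x => (f x, g x) := by
  have h := hf.polyBound
  have h' := hg.polyBound
  obtain ⟨F, hF, hP⟩ := hf
  obtain ⟨G, hG, hQ⟩ := hg
  refine ⟨.pair F G, fun x => by rw [Prog.eval, hF, hG], ?_⟩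
  refine PolyBound.mono (((PolyBound.const 1).add .size).add (((PolyBound.const 1).add h).add h')
    |>.add (PolyBound.add hP hQ)) fun x => ?_
  rw [Prog.time_pair, hF, hG]

/-- A single instruction runs in polynomial time if its output is polynomially bounded. -/
lemma of_time_eq (F : Prog a b) (ht : ∀ x, F.time x = 1 + a.size x + b.size (F.eval x))
    (hs : PolyBound a fun x => b.size (F.eval x)) : PolyTime a b F.eval :=
  ⟨F, fun _ => rfl, PolyBound.mono (((PolyBound.const 1).add .size).add hs) fun x => (ht x).le⟩

lemma fst' : PolyTime (.prod a b) a fun x => x.1 :=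
  of_time_eq .fst (fun _ => rfl) (PolyBound.size.mono fun x => by simp [Prog.eval]; omega)

lemma snd' : PolyTime (.prod a b) b fun x => x.2 :=
  of_time_eq .snd (fun _ => rfl) (PolyBound.size.mono fun x => by simp [Prog.eval])

lemma fst {f : a.Val → b.Val × c.Val} (hf : PolyTime a (.prod b c) f) :
    PolyTime a b fun x => (f x).1 := fst'.comp hf

lemma snd {f : a.Val → b.Val × c.Val} (hf : PolyTime a (.prod b c) f) :
    PolyTime a c fun x => (f x).2 := snd'.comp hf

lemma const (q : ℚ) : PolyTime a .rat fun _ => q :=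
  of_time_eq (.const q) (fun _ => rfl) (.mono (.const (Ty.rat.size q)) fun _ => le_rfl)

lemma add {f g : a.Val → ℚ} (hf : PolyTime a .rat f) (hg : PolyTime a .rat g) :
    PolyTime a .rat fun x => f x + g x :=
  (of_time_eq .add (fun _ => rfl) (.mono (((PolyBound.const 4).add ((PolyBound.const 2).mul .size)))
    fun x => (size_rat_add_le x.1 x.2).trans (by simp only [Ty.size_prod]; omega))).comp
      (hf.pair hg)

lemma sub {f g : a.Val → ℚ} (hf : PolyTime a .rat f) (hg : PolyTime a .rat g) :
    PolyTime a .rat fun x => f x - g x :=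
  (of_time_eq .sub (fun _ => rfl) (.mono (((PolyBound.const 4).add ((PolyBound.const 2).mul .size)))
    fun x => by
      have := size_rat_add_le x.1 (-x.2)
      rw [size_rat_neg, ← sub_eq_add_neg] at this
      exact this.trans (by simp only [Ty.size_prod]; omega))).comp (hf.pair hg)

lemma mul {f g : a.Val → ℚ} (hf : PolyTime a .rat f) (hg : PolyTime a .rat g) :
    PolyTime a .rat fun x => f x * g x :=
  (of_time_eq .mul (fun _ => rfl) (.mono (((PolyBound.const 3).add .size))
    fun x => (size_rat_mul_le x.1 x.2).trans (by simp only [Ty.size_prod]; omega))).comp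
      (hf.pair hg)

lemma div {f g : a.Val → ℚ} (hf : PolyTime a .rat f) (hg : PolyTime a .rat g) :
    PolyTime a .rat fun x => f x / g x :=
  (of_time_eq .div (fun _ => rfl) (.mono (((PolyBound.const 3).add .size))
    fun x => (size_rat_div_le x.1 x.2).trans (by simp only [Ty.size_prod]; omega))).comp
      (hf.pair hg)

lemma nil : PolyTime a (.list b) fun _ => [] :=
  of_time_eq .nil (fun _ => rfl) (.const 1)

lemma cons {f : a.Val → b.Val} {l : a.Val → List b.Val} (hf : PolyTime a b f)
    (hl : PolyTime a (.list b) l) : PolyTime a (.list b) fun x => f x :: l x :=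
  (of_time_eq .cons (fun _ => rfl) (.mono .size fun x => by
    change (Ty.list b).size (x.1 :: x.2) ≤ _
    rw [Ty.size_cons, Ty.size_prod])).comp (hf.pair hl)

lemma ite {t : a.Val → ℚ} {f g : a.Val → b.Val} (ht : PolyTime a .rat t) (hf : PolyTime a b f)
    (hg : PolyTime a b g) : PolyTime a b fun x => if 0 < t x then f x else g x := by
  have h := hf.polyBound
  have h' := hg.polyBound
  obtain ⟨F, hF, hP⟩ := hf
  obtain ⟨G, hG, hQ⟩ := hg
  obtain ⟨C, hC, hR⟩ := ht
  refine ⟨.ifPos C F G, fun x => by rw [Prog.eval, hF, hG, hC], ?_⟩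
  refine PolyBound.mono (((PolyBound.const 1).add .size).add (h.add h')
    |>.add (PolyBound.add hR (PolyBound.add hP hQ))) fun x => ?_
  rw [Prog.time_ifPos, hF, hG, hC]
  split_ifs <;> omega

/-- The bound `N` is only required at the states that actually occur, namely the folds over prefixes
of the list. -/
lemma time_foldl_le (f : Prog (.prod b c) b) {N : ℕ} (s : b.Val) (l : List c.Val) (n : ℕ)
    (h : ∀ l' y, l' ++ [y] <+: l → f.time (l'.foldl (fun s y => f.eval (s, y)) s, y) ≤ N) :
    (l.foldl (fun s y => (f.eval (s.1, y), s.2 + f.time (s.1, y))) (s, n)).2 ≤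
      n + l.length * N := by
  induction l generalizing s n with
  | nil => simp
  | cons y l ih =>
    rw [List.foldl_cons]
    refine (ih _ _ fun l' z hz => ?_).trans ?_
    · exact h (y :: l') z (by simpa using hz)
    · have := h [] y (by simp)
      simp only [List.foldl_nil] at this
      rw [List.length_cons]
      nlinarith

/-- Bounded iteration with access to the input runs in polynomial time, provided that all the
states that occur are polynomially bounded. -/
lemma foldl {f : a.Val → b.Val → c.Val → b.Val} {s : a.Val → b.Val} {l : a.Val → List c.Val}
    (hf : PolyTime (.prod (.prod a b) c) b fun x => f x.1.1 x.1.2 x.2) (hs : PolyTime a b s)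
    (hl : PolyTime a (.list c) l) {B : a.Val → ℕ} (hB : PolyBound a B)
    (h : ∀ x l', l' <+: l x → b.size (l'.foldl (f x) (s x)) ≤ B x) :
    PolyTime a b fun x => (l x).foldl (f x) (s x) := by
  -- The body of a `Prog.fold` sees only the state and the list entry, so the input `x` is carried
  -- along in the state.
  have hstep : PolyTime (.prod (.prod a b) c) (.prod a b) fun x => (x.1.1, f x.1.1 x.1.2 x.2) :=
    fst'.fst.pair hf
  have hlb := hl.polyBound
  obtain ⟨F, hF, P, hP⟩ := hstep
  have key : ∀ x s (l : List c.Val),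
      l.foldl (fun s y => F.eval (s, y)) (x, s) = (x, l.foldl (f x) s) := fun x s l => by
    induction l generalizing s with
    | nil => rfl
    | cons y l ih => rw [List.foldl_cons, hF, ih]; rfl
  have hinit : PolyTime a (.prod (.prod a b) (.list c)) fun x => ((x, s x), l x) :=
    (id.pair hs).pair hl
  have hib := hinit.polyBound
  obtain ⟨J, hJ, hQ⟩ := hinit
  have : PolyTime a (.prod a b) fun x => (x, (l x).foldl (f x) (s x)) := by
    have hout : PolyBound a fun x => 1 + a.size x + B x := ((PolyBound.const 1).add .size).add hB
    refine ⟨.comp (.fold F) J, fun x => by rw [Prog.eval, hJ, Prog.eval, key], ?_⟩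
    refine PolyBound.mono ((((PolyBound.const 1).add .size).add hout).add
      (PolyBound.add hQ ((((PolyBound.const 1).add hib).add hout).add
      (hlb.mul (.eval P (((PolyBound.const 1).add hout).add hlb)))))) fun x => ?_
    have hsz : ∀ l', l' <+: l x →
        (Ty.prod a b).size (x, l'.foldl (f x) (s x)) ≤ 1 + a.size x + B x := fun l' hl' => by
      simpa using h x l' hl'
    have h1 := hsz _ (List.prefix_refl _)
    have h2 := time_foldl_le F (x, s x) (l x) 0
      (N := P.eval (1 + (1 + a.size x + B x) + (Ty.list c).size (l x))) fun l' y hl' => by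
        rw [key]
        refine (hP _).trans (polynomial_eval_mono P ?_)
        rw [Ty.size_prod]
        have e1 := hsz l' ((List.prefix_append _ _).trans hl')
        have e2 : c.size y ≤ (Ty.list c).size (l x) :=
          Ty.size_mem c (hl'.subset (by simp))
        exact add_le_add (Nat.add_le_add_left e1 1) e2
    have h3 : (l x).length * P.eval (1 + (1 + a.size x + B x) + (Ty.list c).size (l x)) ≤
      (Ty.list c).size (l x) * P.eval (1 + (1 + a.size x + B x) + (Ty.list c).size (l x)) :=
        Nat.mul_le_mul_right _ (Ty.length_le_size c _)
    rw [Prog.time_comp, hJ, Prog.time_fold, Prog.eval]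
    dsimp only
    rw [key]
    omega
  exact this.snd

end PolyTime

end OddEuler

/-! ### Polynomial-time list operations -/

namespace OddEuler

namespace PolyTime

variable {a b c d : Ty}

lemma reverse {l : a.Val → List b.Val} (hl : PolyTime a (.list b) l) :
    PolyTime a (.list b) fun x => (l x).reverse := by
  have := foldl (a := a) (b := .list b) (c := b) (f := fun _ s y => y :: s) (s := fun _ => [])
    (cons snd' fst'.snd) nil hl
    hl.polyBound fun x l' hl' => ?_
  · simpa only [List.foldl_flip_cons_eq_append', List.append_nil] using this
  · rw [List.foldl_flip_cons_eq_append', List.append_nil]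
    refine le_trans (le_of_eq ?_) (Ty.size_prefix b hl')
    simp only [Ty.size, List.map_reverse, List.sum_reverse]

lemma append {l l' : a.Val → List b.Val} (hl : PolyTime a (.list b) l)
    (hl' : PolyTime a (.list b) l') : PolyTime a (.list b) fun x => l x ++ l' x := by
  have := foldl (f := fun _ s y => y :: s) (cons snd' fst'.snd) hl' hl.reverse
    (hl.reverse.polyBound.add hl'.polyBound) fun x t ht => ?_
  · simpa only [List.foldl_flip_cons_eq_append', List.reverse_reverse] using this
  · rw [List.foldl_flip_cons_eq_append']
    have h1 := Ty.size_append b t.reverse (l' x)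
    have h2 := Ty.size_prefix b ht
    have h3 : (Ty.list b).size t.reverse = (Ty.list b).size t := by
      simp only [Ty.size, List.map_reverse, List.sum_reverse]
    omega

lemma size_flatMap_le {f : c.Val → List b.Val} {M : ℕ} (l : List c.Val)
    (h : ∀ y ∈ l, (Ty.list b).size (f y) ≤ M) :
    (Ty.list b).size (l.flatMap f) ≤ 1 + l.length * M := by
  induction l with
  | nil => simp
  | cons y l ih =>
    rw [List.flatMap_cons, List.length_cons]
    have h1 := Ty.size_append b (f y) (l.flatMap f)
    have h2 := ih fun z hz => h z (List.mem_cons_of_mem _ hz)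
    have h3 := h y List.mem_cons_self
    nlinarith

lemma foldl_append_eq_flatMap {α β : Type*} (f : α → List β) (l : List α) (s : List β) :
    l.foldl (fun s y => s ++ f y) s = s ++ l.flatMap f := by
  induction l generalizing s with
  | nil => simp
  | cons y l ih => rw [List.foldl_cons, ih, List.flatMap_cons, List.append_assoc]

lemma flatMap {f : a.Val → c.Val → List b.Val} {l : a.Val → List c.Val}
    (hf : PolyTime (.prod a c) (.list b) fun x => f x.1 x.2) (hl : PolyTime a (.list c) l) :
    PolyTime a (.list b) fun x => (l x).flatMap (f x) := by
  have hb := hl.polyBound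
  obtain ⟨P, hP⟩ := hf.polyBound
  have := foldl (f := fun x s y => s ++ f x y) (s := fun _ => [])
    (append fst'.snd (hf.comp (fst'.fst.pair snd'))) nil hl
    ((PolyBound.const 1).add (hb.mul (.eval P (((PolyBound.const 1).add .size).add hb))))
    fun x l' hl' => ?_
  · simpa only [foldl_append_eq_flatMap, List.nil_append] using this
  · rw [foldl_append_eq_flatMap, List.nil_append]
    refine (size_flatMap_le l' fun y hy => (hP (x, y)).trans (polynomial_eval_mono P
      (show _ ≤ 1 + a.size x + (Ty.list c).size (l x) from
        Nat.add_le_add_left (Ty.size_mem c (hl'.subset hy)) _))).trans ?_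
    gcongr
    exact hl'.length_le.trans (Ty.length_le_size c _)

end PolyTime

/-! ### The algorithm -/

/-- A number in `(0, 1]` that is less than `|u / w|` if `u` is not zero. -/
def ratioBound (u w : ℚ) : ℚ := if 0 < u * u then u * u / (u * u + w * w) else 1

/-- The least entry of a list of numbers of the interval `(0, 1]`. -/
def minEntry (l : List ℚ) : ℚ := l.foldl (fun s y => if 0 < s - y then y else s) 1

/-- The squared distance of two points. -/
def distSq (z w : ℚ × ℚ) : ℚ := (z.1 - w.1) * (z.1 - w.1) + (z.2 - w.2) * (z.2 - w.2)

/-- The rational version of `slant`. -/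
def slantRat (m : ℚ) (z : ℚ × ℚ) : ℚ := z.1 - m * z.2

/-- The rational version of `slantPt`. -/
def slantPtRat (m c y : ℚ) : ℚ × ℚ := (c + m * y, y)

/-- A drawing: the point, the vertices, and the edges. -/
abbrev Drawing := Ty.drawing.Val

namespace Drawing

variable (d : Drawing)

/-- All the points that occur in a drawing. -/
def points : List (ℚ × ℚ) := d.1 :: (d.2.1 ++ d.2.2.flatMap fun e => e.1 :: e.2)

/-- A slope for which the slanted lines through different points of the drawing are different. -/
def slope : ℚ :=
  minEntry (d.points.flatMap fun z => d.points.flatMap fun w =>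
    [ratioBound (z.1 - w.1) (z.2 - w.2)])

/-- A number that is less than the distances of the slanted lines through the points. -/
def margin : ℚ :=
  minEntry (d.points.flatMap fun z => d.points.flatMap fun w =>
    [ratioBound (slantRat d.slope z - slantRat d.slope w) 1])

/-- A height above all the points. -/
def height : ℚ := 1 / minEntry (d.points.flatMap fun z => [1 / (1 + z.2 * z.2)])

/-- Step over one segment of an edge: change the sign if the segment crosses the ray. -/
def signStep (s : (ℚ × ℚ) × ℚ) (z : ℚ × ℚ) : (ℚ × ℚ) × ℚ :=
  (z, if 0 < 0 - (slantRat d.slope s.1 - slantRat d.slope d.1) *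
        (slantRat d.slope z - slantRat d.slope d.1) then
      if 0 < ((slantRat d.slope z - slantRat d.slope d.1) * s.1.2 -
          (slantRat d.slope s.1 - slantRat d.slope d.1) * z.2) /
            (slantRat d.slope z - slantRat d.slope s.1) - d.1.2 then
        0 - s.2 else s.2
      else s.2)

/-- The sign of an edge: positive if the edge crosses the ray an odd number of times. -/
def edgeSign (e : (ℚ × ℚ) × List (ℚ × ℚ)) : ℚ := (e.2.foldl d.signStep (e.1, 0 - 1)).2

end Drawing

/-- A list of labelled vertices: the label is a representative and a sign relative to it. -/
abbrev Labels := List ((ℚ × ℚ) × (ℚ × ℚ) × ℚ)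

/-- The label of the vertex at `z`. -/
def lookup (W : Labels) (z : ℚ × ℚ) : (ℚ × ℚ) × ℚ :=
  W.foldl (fun s w => if 0 < distSq w.1 z then s else w.2) (z, 1)

/-- The end of an edge. -/
def edgeEnd (e : (ℚ × ℚ) × List (ℚ × ℚ)) : ℚ × ℚ := e.2.foldl (fun _ z => z) e.1

/-- Given the labels `α` and `β` of two vertices, join their classes with relative sign `s`. -/
def relabel (α β : (ℚ × ℚ) × ℚ) (s : ℚ) (w : (ℚ × ℚ) × (ℚ × ℚ) × ℚ) : (ℚ × ℚ) × (ℚ × ℚ) × ℚ :=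
  if 0 < distSq w.2.1 β.1 then w else (w.1, α.1, w.2.2 * (α.2 * (β.2 * s)))

namespace Drawing

variable (d : Drawing)

/-- Join the classes of the ends of an edge. -/
def merge (W : Labels) (e : (ℚ × ℚ) × List (ℚ × ℚ)) : Labels :=
  W.flatMap fun w => [relabel (lookup W e.1) (lookup W (edgeEnd e)) (d.edgeSign e) w]

/-- The final labels of the vertices. -/
def labels : Labels := d.2.2.foldl d.merge (d.2.1.flatMap fun z => [(z, z, 1)])

/-- The box around the vertex at `z`. -/
def box (z : ℚ × ℚ) : List (ℚ × ℚ) :=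
  [slantPtRat d.slope (slantRat d.slope z - d.margin) d.height,
    slantPtRat d.slope (slantRat d.slope z - d.margin) (0 - d.height),
    slantPtRat d.slope (slantRat d.slope z + d.margin) (0 - d.height),
    slantPtRat d.slope (slantRat d.slope z + d.margin) d.height]

/-- The corners of an odd Euler path for the drawing. -/
def eulerPath : List (ℚ × ℚ) :=
  d.1 :: slantPtRat d.slope (slantRat d.slope d.1) d.height ::
    d.labels.flatMap fun w => if 0 < 0 - w.2.2 then d.box w.1 else []

end Drawing

/-! ### The algorithm runs in polynomial time -/

/-- The data type of edges. -/
abbrev Ty.edge : Ty := .prod .point (.list .point)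

/-- The data type of labelled vertices. -/
abbrev Ty.labelled : Ty := .prod .point (.prod .point .rat)

lemma Ty.size_edge (e : (ℚ × ℚ) × List (ℚ × ℚ)) :
    Ty.edge.size e = 1 + Ty.point.size e.1 + (Ty.list .point).size e.2 := rfl

lemma Ty.size_label (w : (ℚ × ℚ) × ℚ) :
    (Ty.prod .point .rat).size w = 1 + Ty.point.size w.1 + Ty.rat.size w.2 := rfl

lemma Ty.size_labelled (w : (ℚ × ℚ) × (ℚ × ℚ) × ℚ) :
    Ty.labelled.size w = 1 + Ty.point.size w.1 + (Ty.prod .point .rat).size w.2 := rfl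

lemma Ty.size_drawing (d : Drawing) : Ty.drawing.size d =
    1 + Ty.point.size d.1 + (1 + (Ty.list .point).size d.2.1 + (Ty.list .edge).size d.2.2) := rfl

/-- The running minimum is always copied from the list or the initial value, which keeps the states
of the fold small. -/
lemma minEntry_foldl_mem (l : List ℚ) (q : ℚ) :
    l.foldl (fun s y => if 0 < s - y then y else s) q ∈ q :: l := by
  induction l generalizing q with
  | nil => simp
  | cons y l ih =>
    rw [List.foldl_cons]
    rcases List.mem_cons.1 (ih (if 0 < q - y then y else q)) with h | h
    · rw [h]; split_ifs <;> simp
    · exact List.mem_cons_of_mem _ (List.mem_cons_of_mem _ h)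

lemma minEntry_mem (l : List ℚ) : minEntry l ∈ 1 :: l := minEntry_foldl_mem l 1

namespace PolyTime

variable {a b c : Ty}

lemma ratioBound {u w : a.Val → ℚ} (hu : PolyTime a .rat u) (hw : PolyTime a .rat w) :
    PolyTime a .rat fun x => OddEuler.ratioBound (u x) (w x) :=
  ite (hu.mul hu) ((hu.mul hu).div ((hu.mul hu).add (hw.mul hw))) (const 1)

lemma minEntry {l : a.Val → List ℚ} (hl : PolyTime a (.list .rat) l) :
    PolyTime a .rat fun x => OddEuler.minEntry (l x) := by
  refine foldl (f := fun _ s y => if 0 < s - y then y else s) (s := fun _ => 1)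
    (ite (fst'.snd.sub snd') snd' fst'.snd) (const 1) hl
    ((PolyBound.const (Ty.rat.size 1)).add hl.polyBound) fun x l' hl' => ?_
  rcases List.mem_cons.1 (minEntry_mem l') with h | h
  · exact (congrArg Ty.rat.size h).le.trans (Nat.le_add_right _ _)
  · exact ((Ty.size_mem .rat h).trans (Ty.size_prefix .rat hl')).trans (Nat.le_add_left _ _)

lemma distSq {z w : a.Val → ℚ × ℚ} (hz : PolyTime a .point z) (hw : PolyTime a .point w) :
    PolyTime a .rat fun x => OddEuler.distSq (z x) (w x) :=
  ((hz.fst.sub hw.fst).mul (hz.fst.sub hw.fst)).add ((hz.snd.sub hw.snd).mul (hz.snd.sub hw.snd))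

lemma slantRat {m : a.Val → ℚ} {z : a.Val → ℚ × ℚ} (hm : PolyTime a .rat m)
    (hz : PolyTime a .point z) : PolyTime a .rat fun x => OddEuler.slantRat (m x) (z x) :=
  hz.fst.sub (hm.mul hz.snd)

lemma slantPtRat {m u y : a.Val → ℚ} (hm : PolyTime a .rat m) (hu : PolyTime a .rat u)
    (hy : PolyTime a .rat y) : PolyTime a .point fun x => OddEuler.slantPtRat (m x) (u x) (y x) :=
  (hu.add (hm.mul hy)).pair hy

lemma points : PolyTime .drawing (.list .point) Drawing.points :=
  cons fst' (append snd'.fst (flatMap (cons snd'.fst snd'.snd) snd'.snd))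

lemma slope : PolyTime .drawing .rat Drawing.slope :=
  minEntry (flatMap (flatMap (cons (ratioBound (fst'.snd.fst.sub snd'.fst)
    (fst'.snd.snd.sub snd'.snd)) nil) (points.comp fst')) points)

lemma margin : PolyTime .drawing .rat Drawing.margin :=
  minEntry (flatMap (flatMap (cons (ratioBound
    ((slantRat (slope.comp fst'.fst) fst'.snd).sub (slantRat (slope.comp fst'.fst) snd')) (const 1))
      nil) (points.comp fst')) points)

lemma height : PolyTime .drawing .rat Drawing.height :=
  (const 1).div (minEntry (flatMap
    (cons ((const 1).div ((const 1).add (snd'.snd.mul snd'.snd))) nil) points))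

lemma signStep {d : a.Val → Drawing} {s : a.Val → (ℚ × ℚ) × ℚ} {z : a.Val → ℚ × ℚ}
    (hd : PolyTime a .drawing d) (hs : PolyTime a (.prod .point .rat) s)
    (hz : PolyTime a .point z) :
    PolyTime a (.prod .point .rat) fun x => (d x).signStep (s x) (z x) := by
  have hm := slope.comp hd
  have h0 := slantRat hm hd.fst
  have h1 := slantRat hm hs.fst
  have h2 := slantRat hm hz
  exact pair hz (ite ((const 0).sub ((h1.sub h0).mul (h2.sub h0)))
    (ite (((((h2.sub h0).mul hs.fst.snd).sub ((h1.sub h0).mul hz.snd)).div (h2.sub h1)).sub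
      hd.fst.snd) ((const 0).sub hs.snd) hs.snd) hs.snd)

end PolyTime

lemma Drawing.signStep_foldl_snd (d : Drawing) (l : List (ℚ × ℚ)) {s : (ℚ × ℚ) × ℚ}
    (hs : s.2 = 1 ∨ s.2 = -1) : (l.foldl d.signStep s).2 = 1 ∨ (l.foldl d.signStep s).2 = -1 := by
  induction l generalizing s with
  | nil => exact hs
  | cons z l ih =>
    refine ih ?_
    simp only [signStep]
    split_ifs
    · rcases hs with h | h <;> simp [h]
    · exact hs
    · exact hs

lemma Drawing.edgeSign_eq (d : Drawing) (e : (ℚ × ℚ) × List (ℚ × ℚ)) :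
    d.edgeSign e = 1 ∨ d.edgeSign e = -1 :=
  d.signStep_foldl_snd _ (by simp)

lemma Drawing.signStep_foldl_fst (d : Drawing) (l : List (ℚ × ℚ)) (s : (ℚ × ℚ) × ℚ) :
    (l.foldl d.signStep s).1 ∈ s.1 :: l := by
  induction l generalizing s with
  | nil => simp
  | cons z l ih =>
    exact List.mem_cons_of_mem _ (ih (d.signStep s z))

lemma edgeEnd_mem (e : (ℚ × ℚ) × List (ℚ × ℚ)) : edgeEnd e ∈ e.1 :: e.2 := by
  obtain ⟨z, l⟩ := e
  simp only [edgeEnd]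
  induction l generalizing z with
  | nil => simp
  | cons w l ih => exact List.mem_cons_of_mem _ (ih w)

lemma size_sign {q : ℚ} (h : q = 1 ∨ q = -1) : Ty.rat.size q = 4 := by
  rcases h with rfl | rfl <;> simp [Ty.size]

namespace PolyTime

variable {a b c : Ty}

lemma edgeSign : PolyTime (.prod .drawing .edge) .rat fun x => Drawing.edgeSign x.1 x.2 := by
  refine snd (foldl (a := .prod .drawing .edge) (b := .prod .point .rat) (c := .point)
    (f := fun x => Drawing.signStep x.1) (s := fun x => (x.2.1, 0 - 1))
    (l := fun x => x.2.2) (signStep fst'.fst.fst fst'.snd snd')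
    (snd'.fst.pair ((const 0).sub (const 1))) snd'.snd ((PolyBound.const 5).add .size) ?_)
  intro x l' hl'
  have h1 := size_sign (Drawing.signStep_foldl_snd x.1 l' (s := (x.2.1, 0 - 1)) (by simp))
  have h2 := Ty.size_mem .point (Drawing.signStep_foldl_fst x.1 l' (x.2.1, 0 - 1))
  have h3 := Ty.size_prefix .point hl'
  rw [Ty.size_cons] at h2
  have h4 : (Ty.prod .drawing .edge).size x = 1 + Ty.drawing.size x.1 + Ty.edge.size x.2 := rfl
  have h5 := Ty.size_edge x.2
  rw [Ty.size_label, h1]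
  simp only at h2
  omega

lemma edgeEnd {e : a.Val → (ℚ × ℚ) × List (ℚ × ℚ)} (he : PolyTime a .edge e) :
    PolyTime a .point fun x => OddEuler.edgeEnd (e x) := by
  refine foldl (f := fun _ _ z => z) snd' he.fst he.snd he.polyBound fun x l' hl' => ?_
  have h2 := Ty.size_mem .point (edgeEnd_mem ((e x).1, l'))
  have h3 := Ty.size_prefix .point hl'
  rw [Ty.size_cons] at h2
  have h4 := Ty.size_edge (e x)
  refine le_trans h2 ?_
  simp only
  omega

end PolyTime

lemma lookup_foldl_mem (W : Labels) (z : ℚ × ℚ) (s : (ℚ × ℚ) × ℚ) :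
    W.foldl (fun s w => if 0 < distSq w.1 z then s else w.2) s ∈ s :: W.map Prod.snd := by
  induction W generalizing s with
  | nil => simp
  | cons w W ih =>
    rw [List.foldl_cons, List.map_cons]
    rcases List.mem_cons.1 (ih (if 0 < distSq w.1 z then s else w.2)) with h | h
    · rw [h]; split_ifs <;> simp
    · exact List.mem_cons_of_mem _ (List.mem_cons_of_mem _ h)

/-- The points of the label have size at most `N`, and the sign is `1` or `-1`. -/
def LabelBounded (N : ℕ) (w : (ℚ × ℚ) × (ℚ × ℚ) × ℚ) : Prop :=
  Ty.point.size w.1 ≤ N ∧ Ty.point.size w.2.1 ≤ N ∧ (w.2.2 = 1 ∨ w.2.2 = -1)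

lemma LabelBounded.size_le {N : ℕ} {w : (ℚ × ℚ) × (ℚ × ℚ) × ℚ} (h : LabelBounded N w) :
    Ty.labelled.size w ≤ 2 * N + 6 := by
  obtain ⟨h1, h2, h3⟩ := h
  have e1 := Ty.size_labelled w
  have e2 := Ty.size_label w.2
  have := size_sign h3
  omega

lemma lookup_bounded {N : ℕ} {W : Labels} (hW : ∀ w ∈ W, LabelBounded N w) {z : ℚ × ℚ}
    (hz : Ty.point.size z ≤ N) :
    Ty.point.size (lookup W z).1 ≤ N ∧ ((lookup W z).2 = 1 ∨ (lookup W z).2 = -1) := by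
  rcases List.mem_cons.1 (lookup_foldl_mem W z (z, 1)) with h | h
  · rw [lookup, h]; exact ⟨hz, .inl rfl⟩
  · obtain ⟨w, hw, he⟩ := List.mem_map.1 h
    rw [lookup, ← he]
    exact (hW w hw).2

/-- Merging copies points and multiplies signs, so the size of a label does not grow with the number
of merges. -/
lemma Drawing.merge_bounded {d : Drawing} {N : ℕ} {W : Labels} (hW : ∀ w ∈ W, LabelBounded N w)
    {e : (ℚ × ℚ) × List (ℚ × ℚ)} (he : Ty.edge.size e ≤ N) :
    (d.merge W e).length = W.length ∧ ∀ w ∈ d.merge W e, LabelBounded N w := by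
  constructor
  · simp [merge]
  · intro w hw
    obtain ⟨v, hv, hw⟩ := List.mem_flatMap.1 hw
    rw [List.mem_singleton] at hw
    subst hw
    rw [Ty.size_prod] at he
    have h0 := Ty.size_mem .point (edgeEnd_mem e)
    rw [Ty.size_cons] at h0
    have h1 := lookup_bounded hW (z := e.1) (by omega)
    have h2 := lookup_bounded hW (z := edgeEnd e) (by omega)
    have h3 := d.edgeSign_eq e
    rw [relabel]
    split_ifs
    · exact hW v hv
    · refine ⟨(hW v hv).1, h1.1, ?_⟩
      rcases (hW v hv).2.2 with h4 | h4 <;> rcases h1.2 with h5 | h5 <;>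
        rcases h2.2 with h6 | h6 <;> rcases h3 with h7 | h7 <;> simp [h4, h5, h6, h7]

namespace PolyTime

variable {a b c : Ty}

lemma lookup {W : a.Val → Labels} {z : a.Val → ℚ × ℚ} (hW : PolyTime a (.list .labelled) W)
    (hz : PolyTime a .point z) :
    PolyTime a (.prod .point .rat) fun x => OddEuler.lookup (W x) (z x) := by
  refine foldl (a := a) (b := .prod .point .rat) (c := .labelled)
    (f := fun x s w => if 0 < OddEuler.distSq w.1 (z x) then s else w.2)
    (ite (distSq snd'.fst (hz.comp fst'.fst)) fst'.snd snd'.snd) (hz.pair (const 1)) hW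
    ((hz.pair (const 1)).polyBound.add hW.polyBound) fun x l' hl' => ?_
  rcases List.mem_cons.1 (lookup_foldl_mem l' (z x) (z x, 1)) with h | h
  · rw [h]; exact Nat.le_add_right _ _
  · obtain ⟨w, hw, he⟩ := List.mem_map.1 h
    rw [← he]
    have h1 := Ty.size_mem .labelled (hl'.subset hw)
    have h2 := Ty.size_labelled w
    omega

lemma relabel {α β : a.Val → (ℚ × ℚ) × ℚ} {s : a.Val → ℚ} {w : a.Val → (ℚ × ℚ) × (ℚ × ℚ) × ℚ}
    (hα : PolyTime a (.prod .point .rat) α) (hβ : PolyTime a (.prod .point .rat) β)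
    (hs : PolyTime a .rat s) (hw : PolyTime a .labelled w) :
    PolyTime a .labelled fun x => OddEuler.relabel (α x) (β x) (s x) (w x) :=
  ite (distSq hw.snd.fst hβ.fst) hw
    (hw.fst.pair (hα.fst.pair (hw.snd.snd.mul (hα.snd.mul (hβ.snd.mul hs)))))

lemma merge {d : a.Val → Drawing} {W : a.Val → Labels} {e : a.Val → (ℚ × ℚ) × List (ℚ × ℚ)}
    (hd : PolyTime a .drawing d) (hW : PolyTime a (.list .labelled) W) (he : PolyTime a .edge e) :
    PolyTime a (.list .labelled) fun x => (d x).merge (W x) (e x) := by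
  refine flatMap (a := a) (b := .labelled) (c := .labelled)
    (f := fun x w => [OddEuler.relabel (OddEuler.lookup (W x) (e x).1)
      (OddEuler.lookup (W x) (OddEuler.edgeEnd (e x))) ((d x).edgeSign (e x)) w]) ?_ hW
  exact cons (relabel ((lookup hW he.fst).comp fst') ((lookup hW (edgeEnd he)).comp fst')
    ((edgeSign.comp (hd.pair he)).comp fst') snd') nil

lemma labels : PolyTime .drawing (.list .labelled) Drawing.labels := by
  refine foldl (a := .drawing) (b := .list .labelled) (c := .edge) (f := Drawing.merge)
    (s := fun d => d.2.1.flatMap fun z => [(z, z, 1)]) (l := fun d => d.2.2)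
    (merge fst'.fst fst'.snd snd')
    (flatMap (cons (snd'.pair (snd'.pair (const 1))) nil) snd'.fst) snd'.snd
    -- There are at most as many labels as the size of the drawing, and `LabelBounded.size_le`
    -- bounds each by twice that size plus six.
    ((PolyBound.const 1).add (.mul .size ((PolyBound.const 1).add
      (((PolyBound.const 2).mul .size).add (.const 6))))) fun d l' hl' => ?_
  have hd := Ty.size_drawing d
  have key : ∀ (W : Labels), W.length ≤ Ty.drawing.size d →
      (∀ w ∈ W, LabelBounded (Ty.drawing.size d) w) →
      (l'.foldl (Drawing.merge d) W).length ≤ Ty.drawing.size d ∧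
        ∀ w ∈ l'.foldl (Drawing.merge d) W, LabelBounded (Ty.drawing.size d) w := by
    have hle : ∀ e ∈ l', Ty.edge.size e ≤ Ty.drawing.size d := fun e he => by
      have := Ty.size_mem .edge (hl'.subset he)
      omega
    clear hl'
    induction l' with
    | nil => exact fun W h1 h2 => ⟨h1, h2⟩
    | cons e l' ih =>
      intro W h1 h2
      have := Drawing.merge_bounded (d := d) h2 (hle e List.mem_cons_self)
      exact ih (fun e' he' => hle e' (List.mem_cons_of_mem _ he')) _ (this.1.le.trans h1) this.2
  have := key (d.2.1.flatMap fun z => [(z, z, 1)]) ?_ ?_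
  · obtain ⟨h1, h2⟩ := this
    exact Ty.size_list_le .labelled h1 fun w hw => (h2 w hw).size_le
  · have := Ty.length_le_size .point d.2.1
    simp only [List.length_flatMap, List.length_singleton, List.map_const', List.sum_replicate,
      smul_eq_mul, mul_one]
    omega
  · intro w hw
    obtain ⟨z, hz, hw⟩ := List.mem_flatMap.1 hw
    rw [List.mem_singleton] at hw
    subst hw
    have := Ty.size_mem .point hz
    refine ⟨?_, ?_, .inl rfl⟩ <;> simp only <;> omega

lemma box {d : a.Val → Drawing} {z : a.Val → ℚ × ℚ} (hd : PolyTime a .drawing d)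
    (hz : PolyTime a .point z) : PolyTime a (.list .point) fun x => (d x).box (z x) := by
  have hm := slope.comp hd
  have hε := margin.comp hd
  have hY := height.comp hd
  have h1 := (slantRat hm hz).sub hε
  have h2 := (slantRat hm hz).add hε
  have hY' := (const 0).sub hY
  exact cons (slantPtRat hm h1 hY) (cons (slantPtRat hm h1 hY') (cons (slantPtRat hm h2 hY')
    (cons (slantPtRat hm h2 hY) nil)))

lemma eulerPath : PolyTime .drawing (.list .point) Drawing.eulerPath := by
  refine cons fst' (cons (slantPtRat slope (slantRat slope fst') height) ?_)
  refine flatMap (a := .drawing) (b := .point) (c := .labelled)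
    (f := fun d w => if 0 < 0 - w.2.2 then Drawing.box d w.1 else []) ?_ labels
  exact ite ((const 0).sub snd'.snd.snd) (box fst' snd'.fst) nil

end PolyTime

end OddEuler

namespace OddEuler

/-! ### Polygonal curves -/

lemma TransverseLine.refl {m c : ℝ} {a : ℂ} (h : slant m a ≠ c) :
    TransverseLine m c (Path.refl a) := ⟨h, h, fun _ hs => absurd hs h⟩

lemma TransverseLine.trans {m k : ℝ} {a b c : ℂ} {γ : Path a b} {δ : Path b c}
    (h : TransverseLine m k γ) (h' : TransverseLine m k δ) : TransverseLine m k (γ.trans δ) where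
  left := h.left
  right := h'.right
  transverse s hs := by
    rcases exists_half s with ⟨t, rfl⟩ | ⟨t, rfl⟩
    · rw [trans_halfLeft] at hs
      obtain ⟨w, hw, hw0⟩ := h.transverse t hs
      exact ⟨_, hasDerivAt_trans_left δ hw fun hb => h.right (hb ▸ hs),
        by rw [map_smul]; exact smul_ne_zero two_ne_zero hw0⟩
    · rw [trans_halfRight] at hs
      obtain ⟨w, hw, hw0⟩ := h'.transverse t hs
      exact ⟨_, hasDerivAt_trans_right γ hw fun hb => h'.left (hb ▸ hs),
        by rw [map_smul]; exact smul_ne_zero two_ne_zero hw0⟩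

lemma segment_apply_eq (a b : ℂ) (t : I) : Path.segment a b t = a + (t : ℝ) • (b - a) := by
  have : Path.segment a b t = AffineMap.lineMap a b (t : ℝ) := rfl
  rw [this, AffineMap.lineMap_apply, vsub_eq_sub, vadd_eq_add, add_comm]

lemma slant_segment (m : ℝ) (a b : ℂ) (t : I) :
    slant m (Path.segment a b t) = slant m a + t * (slant m b - slant m a) := by
  rw [segment_apply_eq, map_add, map_smul, map_sub, smul_eq_mul]

lemma transverseLine_segment {m c : ℝ} {a b : ℂ} (ha : slant m a ≠ c) (hb : slant m b ≠ c) :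
    TransverseLine m c (Path.segment a b) := by
  refine ⟨ha, hb, fun s hs => ⟨b - a, hasDerivAt_segment (fun h => ha (h ▸ hs))
    (fun h => hb (h ▸ hs)), fun h => ha ?_⟩⟩
  rw [slant_segment, ← map_sub, h, mul_zero, add_zero] at hs
  exact hs

/-- A segment with an end off the line is not parallel to it if it meets it, so corners on the line
are the only obstruction to transversality. -/
lemma transverseLine_polyPath {m c : ℝ} {a : ℂ} {L : List ℂ} (h : ∀ z ∈ a :: L, slant m z ≠ c) :
    TransverseLine m c (polyPath a L) := by
  induction L generalizing a with
  | nil => exact .refl (h a List.mem_cons_self)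
  | cons b L ih =>
    have h1 := transverseLine_segment (h a List.mem_cons_self)
      (h b (List.mem_cons_of_mem _ List.mem_cons_self))
    cases L with
    | nil => exact h1
    | cons c L => exact h1.trans (ih fun z hz => h z (List.mem_cons_of_mem _ hz))

lemma polyPath_mem_convex {S : Set ℂ} (hS : Convex ℝ S) {a : ℂ} {L : List ℂ}
    (h : ∀ z ∈ a :: L, z ∈ S) (t : I) : polyPath a L t ∈ S := by
  induction L generalizing a t with
  | nil => exact h a List.mem_cons_self
  | cons b L ih =>
    exact polyPath_cons_forall (hS.segment_subset (h a List.mem_cons_self)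
      (h b (List.mem_cons_of_mem _ List.mem_cons_self)))
      (ih fun z hz => h z (List.mem_cons_of_mem _ hz)) t

/-- Used to see that `p`, which is off the drawing, differs from all corners, so that the chosen
slope separates it from them. -/
lemma exists_polyPath_eq_corner {a : ℂ} {L : List ℂ} {z : ℂ} (hz : z ∈ a :: L) :
    ∃ t, polyPath a L t = z := by
  induction L generalizing a with
  | nil => exact ⟨0, by rw [Path.source]; exact (List.mem_singleton.1 hz).symm⟩
  | cons b L ih =>
    rcases List.mem_cons.1 hz with rfl | hz
    · exact ⟨0, Path.source _⟩
    · cases L with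
      | nil => exact ⟨1, by rw [Path.target]; exact (List.mem_singleton.1 hz).symm⟩
      | cons c L =>
        obtain ⟨t, ht⟩ := ih hz
        exact ⟨halfRight t, (trans_halfRight (Path.segment a b) _ t).trans ht⟩

lemma finite_hits_slantRay {m : ℝ} {p a b : ℂ} {γ : Path a b}
    (h : TransverseLine m (slant m p) γ) : (hits γ (slantRay m p)).Finite :=
  h.finite.subset fun _ hs => hs.1

lemma ncard_hits_polyPath_cons {m : ℝ} {p a b : ℂ} {L : List ℂ}
    (h : ∀ z ∈ a :: b :: L, slant m z ≠ slant m p) :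
    (hits (polyPath a (b :: L)) (slantRay m p)).ncard =
      (hits (Path.segment a b) (slantRay m p)).ncard +
        (hits (polyPath b L) (slantRay m p)).ncard := by
  have ha := h a List.mem_cons_self
  have hb := h b (List.mem_cons_of_mem _ List.mem_cons_self)
  have hb' : b ∉ slantRay m p := fun hh => hb hh.1
  cases L with
  | nil =>
    have : hits (polyPath b []) (slantRay m p) = ∅ := hits_refl hb'
    rw [this, ncard_empty]
    rfl
  | cons c L =>
    exact (hits_trans hb' (finite_hits_slantRay (transverseLine_segment ha hb))
      (finite_hits_slantRay (transverseLine_polyPath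
        fun z hz => h z (List.mem_cons_of_mem _ hz)))).2

/-- With `A` and `B` the signed offsets of the ends from the line, the segment meets the line if and
only if `A * B < 0`. The parameter is then `A / (A - B)`, and the quotient in the second test is the
height of the meeting point. The tests have the form `0 < ...` because they are those of
`Drawing.signStep`. -/
lemma ncard_hits_segment {m : ℝ} {p a b : ℂ} (ha : slant m a ≠ slant m p)
    (hb : slant m b ≠ slant m p) :
    (hits (Path.segment a b) (slantRay m p)).ncard =
      if 0 < 0 - (slant m a - slant m p) * (slant m b - slant m p) then
        if 0 < ((slant m b - slant m p) * a.im - (slant m a - slant m p) * b.im) /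
          (slant m b - slant m a) - p.im then 1 else 0
      else 0 := by
  set A := slant m a - slant m p with hA
  set B := slant m b - slant m p with hB
  have hA0 : A ≠ 0 := sub_ne_zero.2 ha
  have hB0 : B ≠ 0 := sub_ne_zero.2 hb
  have hBA : slant m b - slant m a = B - A := by rw [hA, hB]; ring
  rw [hBA]
  have hmem : ∀ t : I, t ∈ hits (Path.segment a b) (slantRay m p) ↔
      A + t * (B - A) = 0 ∧ p.im < a.im + t * (b.im - a.im) := fun t => by
    change slant m (Path.segment a b t) = slant m p ∧ p.im < (Path.segment a b t).im ↔ _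
    rw [slant_segment, segment_apply_eq, hBA]
    refine and_congr ⟨fun h => by rw [hA]; linarith, fun h => by rw [hA] at h; linarith⟩ ?_
    simp
  by_cases h1 : 0 < 0 - A * B
  · have hne : A - B ≠ 0 := fun h => by
      have : B = A := by linarith
      rw [this] at h1; nlinarith [mul_self_nonneg A]
    have hne' : B - A ≠ 0 := fun h => hne (by linarith)
    have h01 : A / (A - B) ∈ I := by
      rw [show A / (A - B) = A * A / (A * A - A * B) by field_simp]
      have hpos : 0 < A * A - A * B := by nlinarith [mul_self_nonneg A]
      exact ⟨div_nonneg (mul_self_nonneg A) hpos.le, (div_le_one hpos).2 (by linarith)⟩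
    have hmem' : ∀ t : I, t ∈ hits (Path.segment a b) (slantRay m p) ↔
        t = ⟨A / (A - B), h01⟩ ∧ 0 < (B * a.im - A * b.im) / (B - A) - p.im := fun t => by
      have e1 : A + t * (B - A) = 0 ↔ t = ⟨A / (A - B), h01⟩ := by
        rw [Subtype.ext_iff, eq_div_iff hne]
        constructor <;> intro h <;> linarith
      rw [hmem, e1]
      refine and_congr_right fun h => ?_
      have e2 : a.im + t * (b.im - a.im) = (B * a.im - A * b.im) / (B - A) := by
        rw [h]; simp only; field_simp; ring
      rw [e2, sub_pos]
    rw [if_pos h1]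
    split_ifs with h2
    · rw [show hits (Path.segment a b) (slantRay m p) = {⟨A / (A - B), h01⟩} by
        ext t; rw [hmem']; simp only [h2, and_true, mem_singleton_iff], ncard_singleton]
    · rw [show hits (Path.segment a b) (slantRay m p) = ∅ by
        ext t; rw [hmem']; simp only [h2, and_false, mem_empty_iff_false], ncard_empty]
  · rw [if_neg h1, show hits (Path.segment a b) (slantRay m p) = ∅ from ?_, ncard_empty]
    refine eq_empty_of_forall_notMem fun t ht => ?_
    have h2 := ((hmem t).1 ht).1
    have hAB : 0 < A * B := lt_of_le_of_ne (by linarith) (mul_ne_zero hA0 hB0).symm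
    have h3 : (1 - t) * (A * A) + t * (A * B) = 0 := by linear_combination A * h2
    rcases t.2.1.eq_or_lt with h0 | h0
    · rw [← h0] at h3
      simp [hA0] at h3
    · nlinarith [mul_pos h0 hAB, mul_nonneg (sub_nonneg.2 t.2.2) (mul_self_nonneg A)]

lemma lastPoint_map (z : ℚ × ℚ) (L : List (ℚ × ℚ)) :
    lastPoint (toPlane z) (L.map toPlane) = toPlane (edgeEnd (z, L)) := by
  induction L generalizing z with
  | nil => rfl
  | cons w L ih => exact ih w

/-! ### Rational parameters -/

lemma toPlane_injective : Function.Injective toPlane := fun z w h => by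
  have h1 := congrArg Complex.re h
  have h2 := congrArg Complex.im h
  simp only [toPlane, Rat.cast_inj] at h1 h2
  exact Prod.ext h1 h2

lemma slant_toPlane (m : ℚ) (z : ℚ × ℚ) : slant m (toPlane z) = (slantRat m z : ℚ) := by
  simp [slant_apply, toPlane, slantRat]

lemma toPlane_slantPtRat (m c y : ℚ) : toPlane (slantPtRat m c y) = slantPt m c y := by
  simp [toPlane, slantPtRat, slantPt]

lemma ratioBound_pos (u w : ℚ) : 0 < ratioBound u w := by
  rw [ratioBound]
  split_ifs with h
  · have := mul_self_nonneg w
    positivity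
  · exact one_pos

/-- After clearing denominators this is `|u| * |w| < u² + w²`. Squares in `ratioBound` avoid
absolute values in the program. -/
lemma ratioBound_mul_lt {u : ℚ} (hu : u ≠ 0) (w : ℚ) : ratioBound u w * |w| < |u| := by
  have h : 0 < u * u := mul_self_pos.2 hu
  have hu' : 0 < |u| := abs_pos.2 hu
  rw [ratioBound, if_pos h, ← abs_mul_abs_self u, ← abs_mul_abs_self w, div_mul_eq_mul_div,
    div_lt_iff₀ (by positivity)]
  nlinarith [mul_pos hu' (mul_pos hu' hu'), mul_nonneg hu'.le (sq_nonneg (|u| - |w|)),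
    mul_nonneg hu'.le (mul_self_nonneg |w|), sq_nonneg (|u| - 2 * |w|)]

lemma minEntry_foldl_le (l : List ℚ) (q : ℚ) :
    ∀ y ∈ q :: l, l.foldl (fun s y => if 0 < s - y then y else s) q ≤ y := by
  induction l generalizing q with
  | nil => simp
  | cons z l ih =>
    intro y hy
    rw [List.foldl_cons]
    have h1 := ih (if 0 < q - z then z else q) _ List.mem_cons_self
    have h2 : (if 0 < q - z then z else q) ≤ q ∧ (if 0 < q - z then z else q) ≤ z := by
      split_ifs <;> constructor <;> linarith
    rcases List.mem_cons.1 hy with rfl | hy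
    · exact h1.trans h2.1
    rcases List.mem_cons.1 hy with rfl | hy
    · exact h1.trans h2.2
    · exact ih _ y (List.mem_cons_of_mem _ hy)

lemma minEntry_le {l : List ℚ} {y : ℚ} (hy : y ∈ l) : minEntry l ≤ y :=
  minEntry_foldl_le l 1 y (List.mem_cons_of_mem _ hy)

lemma minEntry_pos {l : List ℚ} (h : ∀ y ∈ l, 0 < y) : 0 < minEntry l := by
  rcases List.mem_cons.1 (minEntry_mem l) with h1 | h1
  · rw [h1]; exact one_pos
  · exact h _ h1

/-! ### Properties of the computed slope, margin and height -/

namespace Drawing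

variable (d : Drawing)

lemma slope_pos : 0 < slope d := by
  refine minEntry_pos fun y hy => ?_
  simp only [List.mem_flatMap, List.mem_singleton] at hy
  obtain ⟨z, -, w, -, rfl⟩ := hy
  exact ratioBound_pos _ _

lemma margin_pos : 0 < margin d := by
  refine minEntry_pos fun y hy => ?_
  simp only [List.mem_flatMap, List.mem_singleton] at hy
  obtain ⟨z, -, w, -, rfl⟩ := hy
  exact ratioBound_pos _ _

variable {d}

/-- If the points differ horizontally, the slope is too small for `m * Δy` to reach `Δx`. If they
differ only vertically, it suffices that the slope is not zero. -/
lemma slantRat_ne {z w : ℚ × ℚ} (hz : z ∈ points d) (hw : w ∈ points d) (h : z ≠ w) :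
    slantRat (slope d) z ≠ slantRat (slope d) w := by
  intro he
  have hle : slope d ≤ ratioBound (z.1 - w.1) (z.2 - w.2) := minEntry_le <| by
    simp only [List.mem_flatMap, List.mem_singleton]
    exact ⟨z, hz, w, hw, rfl⟩
  simp only [slantRat] at he
  have he' : z.1 - w.1 = slope d * (z.2 - w.2) := by linarith
  by_cases h1 : z.1 - w.1 = 0
  · rw [h1, zero_eq_mul] at he'
    exact h (Prod.ext (sub_eq_zero.1 h1) (sub_eq_zero.1 (he'.resolve_left (slope_pos d).ne')))
  · have h2 := ratioBound_mul_lt h1 (z.2 - w.2)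
    rw [he', abs_mul, abs_of_pos (slope_pos d), ← he'] at h2
    exact h2.not_ge (mul_le_mul_of_nonneg_right hle (abs_nonneg _))

lemma margin_lt {z w : ℚ × ℚ} (hz : z ∈ points d) (hw : w ∈ points d) (h : z ≠ w) :
    margin d < |slantRat (slope d) z - slantRat (slope d) w| := by
  have hle : margin d ≤ ratioBound (slantRat (slope d) z - slantRat (slope d) w) 1 :=
    minEntry_le <| by
      simp only [List.mem_flatMap, List.mem_singleton]
      exact ⟨z, hz, w, hw, rfl⟩
  have := ratioBound_mul_lt (sub_ne_zero.2 (slantRat_ne hz hw h)) 1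
  rw [abs_one, mul_one] at this
  exact hle.trans_lt this

/-- The height is the maximum of `1` and the numbers `1 + y²`, written as the inverse of a minimum,
and `|y| < 1 + y²`. -/
lemma abs_lt_height {z : ℚ × ℚ} (hz : z ∈ points d) : |z.2| < height d := by
  have hpos : 0 < minEntry ((points d).flatMap fun z => [1 / (1 + z.2 * z.2)]) := by
    refine minEntry_pos fun y hy => ?_
    simp only [List.mem_flatMap, List.mem_singleton] at hy
    obtain ⟨z, -, rfl⟩ := hy
    have := mul_self_nonneg z.2
    positivity
  have hle : minEntry ((points d).flatMap fun z => [1 / (1 + z.2 * z.2)]) ≤ 1 / (1 + z.2 * z.2) :=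
    minEntry_le <| by
      simp only [List.mem_flatMap, List.mem_singleton]
      exact ⟨z, hz, rfl⟩
  have h0 : 0 < 1 + z.2 * z.2 := by have := mul_self_nonneg z.2; positivity
  rw [le_one_div hpos h0] at hle
  refine lt_of_lt_of_le ?_ hle
  rw [← abs_mul_abs_self]
  nlinarith [sq_nonneg (|z.2| - 1), abs_nonneg z.2]

end Drawing

end OddEuler

namespace OddEuler

/-! ### Signs of edges -/

/-- The sign of a number modulo two. -/
def sgn (x : ZMod 2) : ℚ := if x = 0 then 1 else -1

lemma sgn_zero : sgn 0 = 1 := rfl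

lemma sgn_one : sgn 1 = -1 := rfl

lemma eq_zero_or_one (x : ZMod 2) : x = 0 ∨ x = 1 := by
  revert x; decide

lemma sgn_add (x y : ZMod 2) : sgn (x + y) = sgn x * sgn y := by
  have h : (1 + 1 : ZMod 2) = 0 := rfl
  rcases eq_zero_or_one x with rfl | rfl <;> rcases eq_zero_or_one y with rfl | rfl <;>
    simp [sgn_zero, sgn_one, h]

lemma sgn_mul_self (x : ZMod 2) : sgn x * sgn x = 1 := by
  rw [← sgn_add, CharTwo.add_self_eq_zero, sgn_zero]

lemma sgn_injective : Function.Injective sgn := fun x y h => by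
  rcases eq_zero_or_one x with rfl | rfl <;> rcases eq_zero_or_one y with rfl | rfl
  · rfl
  · norm_num [sgn_zero, sgn_one] at h
  · norm_num [sgn_zero, sgn_one] at h
  · rfl

lemma toPlane_im (z : ℚ × ℚ) : (toPlane z).im = z.2 := rfl

lemma Drawing.signStep_foldl_eq {d : Drawing} {a : ℚ × ℚ} {L : List (ℚ × ℚ)} (s : ℚ)
    (h : ∀ z ∈ a :: L, slantRat (slope d) z ≠ slantRat (slope d) d.1) :
    (L.foldl (signStep d) (a, s)).2 = s * sgn (hits (polyPath (toPlane a) (L.map toPlane))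
      (slantRay (slope d) (toPlane d.1))).ncard := by
  have hreal : ∀ z ∈ a :: L, slant (slope d) (toPlane z) ≠ slant (slope d) (toPlane d.1) :=
    fun z hz => by
      rw [slant_toPlane, slant_toPlane, Ne, Rat.cast_inj]
      exact h z hz
  induction L generalizing a s with
  | nil =>
    have : hits (polyPath (toPlane a) []) (slantRay (slope d) (toPlane d.1)) = ∅ :=
      hits_refl fun hh => hreal a List.mem_cons_self hh.1
    rw [List.map_nil, this, ncard_empty, Nat.cast_zero, sgn_zero, mul_one]
    rfl
  | cons b L ih =>
    have hb := hreal b (List.mem_cons_of_mem _ List.mem_cons_self)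
    rw [List.foldl_cons, List.map_cons, ncard_hits_polyPath_cons, Nat.cast_add, sgn_add,
      ← mul_assoc]
    · rw [signStep, ih _ (fun z hz => h z (List.mem_cons_of_mem _ hz))
        (fun z hz => hreal z (List.mem_cons_of_mem _ hz))]
      congr 1
      rw [ncard_hits_segment (hreal a List.mem_cons_self) hb]
      simp only [slant_toPlane, toPlane_im]
      norm_cast
      split_ifs
      · rw [Nat.cast_one, sgn_one]; ring
      · rw [Nat.cast_zero, sgn_zero, mul_one]
      · rw [Nat.cast_zero, sgn_zero, mul_one]
    · intro z hz
      rw [← List.map_cons, ← List.map_cons] at hz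
      obtain ⟨w, hw, rfl⟩ := List.mem_map.1 hz
      exact hreal w hw

/-- The fold starts with the sign `-1`; this supplies the summand `1` of the edge weight. -/
lemma Drawing.edgeSign_eq_sgn {d : Drawing} {e : (ℚ × ℚ) × List (ℚ × ℚ)}
    (h : ∀ z ∈ e.1 :: e.2, slantRat (slope d) z ≠ slantRat (slope d) d.1) :
    edgeSign d e = sgn (1 + (hits (polyPath (toPlane e.1) (e.2.map toPlane))
      (slantRay (slope d) (toPlane d.1))).ncard) := by
  rw [edgeSign, signStep_foldl_eq _ h, sgn_add, sgn_one, zero_sub]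

/-! ### Labels -/

lemma distSq_pos_iff {z w : ℚ × ℚ} : 0 < distSq z w ↔ z ≠ w := by
  rw [distSq]
  constructor
  · rintro h rfl
    simp at h
  · intro h
    by_contra! hle
    have h1 := mul_self_nonneg (z.1 - w.1)
    have h2 := mul_self_nonneg (z.2 - w.2)
    refine h (Prod.ext (sub_eq_zero.1 (mul_self_eq_zero.1 ?_))
      (sub_eq_zero.1 (mul_self_eq_zero.1 ?_))) <;> linarith

/-- The last match wins in `lookup`, but all matches carry the same label `f z`; the initial value
is irrelevant once there is a match. -/
lemma lookup_map {vs : List (ℚ × ℚ)} (f : ℚ × ℚ → (ℚ × ℚ) × ℚ) {z : ℚ × ℚ} (hz : z ∈ vs) :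
    lookup (vs.map fun w => (w, f w)) z = f z := by
  have key : ∀ (vs : List (ℚ × ℚ)) (s : (ℚ × ℚ) × ℚ), (z ∈ vs ∨ s = f z) →
      (vs.map fun w => (w, f w)).foldl (fun s w => if 0 < distSq w.1 z then s else w.2) s =
        f z := by
    intro vs
    induction vs with
    | nil => intro s hs; simpa using hs
    | cons w vs ih =>
      intro s hs
      rw [List.map_cons, List.foldl_cons]
      refine ih _ ?_
      simp only [distSq_pos_iff]
      split_ifs with hw
      · rcases hs with hs | hs
        · exact .inl ((List.mem_cons.1 hs).resolve_left hw.symm)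
        · exact .inr hs
      · rw [not_not] at hw
        exact .inr (by rw [hw])
  exact key vs _ (.inl hz)

/-- Labels by representatives `R` and signs `S` that agree, on each class, with the signs `τ` up to
a common factor. -/
structure Compatible (vs : List (ℚ × ℚ)) (τ : ℚ × ℚ → ℚ) (R : ℚ × ℚ → ℚ × ℚ) (S : ℚ × ℚ → ℚ) :
    Prop where
  sign : ∀ z ∈ vs, S z * S z = 1
  compat : ∀ z ∈ vs, ∀ w ∈ vs, R z = R w → S z * S w = τ z * τ w

/-- The class of `b` receives the representative of `a`, and its signs are multiplied by `S a * S b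
* (τ a * τ b)`. On each old class `S` is `τ` up to a constant sign, and this factor is the quotient
of the two constants, so the joined class again agrees with `τ` up to a constant. The last clause,
that classes only grow, keeps earlier merges valid. -/
lemma Drawing.exists_merge {d : Drawing} {vs : List (ℚ × ℚ)} {τ : ℚ × ℚ → ℚ}
    (hτ : ∀ z ∈ vs, τ z * τ z = 1) {R : ℚ × ℚ → ℚ × ℚ} {S : ℚ × ℚ → ℚ}
    (h : Compatible vs τ R S) {e : (ℚ × ℚ) × List (ℚ × ℚ)} (h1 : e.1 ∈ vs) (h2 : edgeEnd e ∈ vs)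
    (hs : edgeSign d e = τ e.1 * τ (edgeEnd e)) :
    ∃ R' S', Compatible vs τ R' S' ∧
      merge d (vs.map fun z => (z, R z, S z)) e = (vs.map fun z => (z, R' z, S' z)) ∧
      R' e.1 = R' (edgeEnd e) ∧ ∀ z w, R z = R w → R' z = R' w := by
  set a := e.1
  set b := edgeEnd e
  let R' : ℚ × ℚ → ℚ × ℚ := fun z => if R z = R b then R a else R z
  let S' : ℚ × ℚ → ℚ := fun z => if R z = R b then S z * (S a * (S b * edgeSign d e)) else S z
  have ta := hτ a h1
  have tb := hτ b h2
  have sa := h.sign a h1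
  have sb := h.sign b h2
  have hfac : (S a * (S b * edgeSign d e)) * (S a * (S b * edgeSign d e)) = 1 := by
    rw [hs]
    linear_combination (S b * S b * (τ a * τ a) * (τ b * τ b)) * sa +
      (τ a * τ a * (τ b * τ b)) * sb +
      (τ b * τ b) * ta + tb
  -- The essential case: `z` in the class of `b`, which is relabelled, and `w` in the class of `a`,
  -- which is not.
  have hcross : ∀ z ∈ vs, ∀ w ∈ vs, R z = R b → R a = R w →
      S z * (S a * (S b * edgeSign d e)) * S w = τ z * τ w := fun z hz w hw hzb haw => by
    have e1 := h.compat z hz b h2 hzb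
    have e2 := h.compat a h1 w hw haw
    rw [hs]
    linear_combination (S a * S w * τ a * τ b) * e1 + (τ z * τ b * τ a * τ b) * e2 +
      (τ z * τ w * (τ b * τ b)) * ta + (τ z * τ w) * tb
  refine ⟨R', S', ⟨fun z hz => ?_, fun z hz w hw hzw => ?_⟩, ?_, ?_, fun z w hzw => ?_⟩
  · simp only [S']
    split_ifs
    · linear_combination (S z * S z) * hfac + h.sign z hz
    · exact h.sign z hz
  · simp only [R', S'] at hzw ⊢
    split_ifs at hzw ⊢ with hz' hw' hw'
    · linear_combination (S z * S w) * hfac + h.compat z hz w hw (hz'.trans hw'.symm)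
    · exact hcross z hz w hw hz' hzw
    · rw [mul_comm, mul_comm (τ z)]
      exact hcross w hw z hz hw' hzw.symm
    · exact h.compat z hz w hw hzw
  · rw [merge, lookup_map (fun z => (R z, S z)) h1, lookup_map (fun z => (R z, S z)) h2,
      List.flatMap_map, ← List.map_eq_flatMap]
    refine List.map_congr_left fun z _ => ?_
    simp only [relabel, distSq_pos_iff, R', S']
    by_cases hz : R z = R b <;> simp [hz]
  · simp only [R', if_true]
    split_ifs <;> rfl
  · simp only [R', hzw]

lemma Drawing.exists_merge_foldl {d : Drawing} {vs : List (ℚ × ℚ)} {τ : ℚ × ℚ → ℚ}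
    (hτ : ∀ z ∈ vs, τ z * τ z = 1) {es : List ((ℚ × ℚ) × List (ℚ × ℚ))}
    (hes : ∀ e ∈ es, e.1 ∈ vs ∧ edgeEnd e ∈ vs ∧ edgeSign d e = τ e.1 * τ (edgeEnd e))
    {R : ℚ × ℚ → ℚ × ℚ} {S : ℚ × ℚ → ℚ} (h : Compatible vs τ R S) :
    ∃ R' S', Compatible vs τ R' S' ∧
      es.foldl (merge d) (vs.map fun z => (z, R z, S z)) = (vs.map fun z => (z, R' z, S' z)) ∧
      (∀ e ∈ es, R' e.1 = R' (edgeEnd e)) ∧ ∀ z w, R z = R w → R' z = R' w := by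
  induction es generalizing R S with
  | nil => exact ⟨R, S, h, rfl, by simp, fun _ _ h => h⟩
  | cons e es ih =>
    obtain ⟨h1, h2, h3⟩ := hes e List.mem_cons_self
    obtain ⟨R₁, S₁, c1, c2, c3, c4⟩ := exists_merge hτ h h1 h2 h3
    obtain ⟨R₂, S₂, d1, d2, d3, d4⟩ := ih (fun e he => hes e (List.mem_cons_of_mem _ he)) c1
    refine ⟨R₂, S₂, d1, by rw [List.foldl_cons, c2, d2], fun e' he' => ?_, fun z w hzw =>
      d4 z w (c4 z w hzw)⟩
    rcases List.mem_cons.1 he' with rfl | he'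
    · exact d4 _ _ c3
    · exact d3 e' he'

/-- Start from singleton classes, where compatibility is trivial. After all merges the ends of every
edge share a class, so on edges the computed signs have the same products as `τ`. -/
theorem Drawing.exists_labels {d : Drawing} {τ : ℚ × ℚ → ℚ}
    (hτ : ∀ z ∈ d.2.1, τ z * τ z = 1)
    (hes : ∀ e ∈ d.2.2, e.1 ∈ d.2.1 ∧ edgeEnd e ∈ d.2.1 ∧
      edgeSign d e = τ e.1 * τ (edgeEnd e)) :
    ∃ S : ℚ × ℚ → ℚ, (∀ z ∈ d.2.1, S z * S z = 1) ∧
      (∃ R : ℚ × ℚ → ℚ × ℚ, labels d = d.2.1.map fun z => (z, R z, S z)) ∧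
      ∀ e ∈ d.2.2, S e.1 * S (edgeEnd e) = τ e.1 * τ (edgeEnd e) := by
  have h0 : Compatible d.2.1 τ (fun z => z) (fun _ => 1) :=
    ⟨fun _ _ => one_mul 1, fun z hz w _ hzw => by
      have hzw : z = w := hzw
      rw [← hzw, hτ z hz, one_mul]⟩
  obtain ⟨R, S, h1, h2, h3, -⟩ := exists_merge_foldl hτ hes h0
  refine ⟨S, h1.sign, ⟨R, ?_⟩, fun e he => h1.compat _ (hes e he).1 _ (hes e he).2.1 (h3 e he)⟩
  rw [labels, ← h2, List.map_eq_flatMap]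

end OddEuler

namespace OddEuler

/-! ### Correctness of the algorithm -/

lemma exists_ofFn_of_map_eq {α β : Type*} {f : α → β} {l : List α} {n : ℕ} {g : Fin n → β}
    (h : l.map f = List.ofFn g) : ∃ q : Fin n → α, l = List.ofFn q ∧ ∀ i, f (q i) = g i := by
  have hlen : l.length = n := by simpa using congrArg List.length h
  subst hlen
  refine ⟨l.get, (List.ofFn_get l).symm, fun i => ?_⟩
  have := List.getElem_of_eq h (i := i) (by simp)
  simpa using this

lemma flatMap_filter_eq {α β : Type*} (P : α → Prop) [DecidablePred P] (f : α → List β)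
    (l : List α) : (l.filter P).flatMap f = l.flatMap fun x => if P x then f x else [] := by
  induction l with
  | nil => rfl
  | cons x l ih =>
    rw [List.flatMap_cons, ← ih, List.filter_cons]
    by_cases h : P x <;> simp [h]

namespace Describes

variable {vs : List (ℚ × ℚ)} {es : List ((ℚ × ℚ) × List (ℚ × ℚ))} {n : ℕ}
  {G : SimpleGraph (Fin n)} {Γ : Embedding G}

lemma exists_vertices (hD : Describes vs es Γ) :
    ∃ q : Fin n → ℚ × ℚ, vs = List.ofFn q ∧ ∀ v, toPlane (q v) = Γ.pos v :=
  exists_ofFn_of_map_eq hD.vertices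

lemma toPlane_mem_image (hD : Describes vs es Γ) {z : ℚ × ℚ} (hz : z ∈ vs) :
    toPlane z ∈ Γ.image := by
  obtain ⟨q, rfl, hq⟩ := hD.exists_vertices
  obtain ⟨v, rfl⟩ := (List.mem_ofFn' _ _).1 hz
  rw [hq]
  exact Γ.pos_mem_image v

lemma toPlane_corner_mem_image (hD : Describes vs es Γ) {e : (ℚ × ℚ) × List (ℚ × ℚ)}
    (he : e ∈ es) {z : ℚ × ℚ} (hz : z ∈ e.1 :: e.2) : toPlane z ∈ Γ.image := by
  obtain ⟨u, v, h, hc⟩ := hD.edges e he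
  obtain ⟨t, ht⟩ := exists_polyPath_eq_corner (a := toPlane e.1) (L := e.2.map toPlane)
    (z := toPlane z) (by rw [← List.map_cons]; exact List.mem_map_of_mem hz)
  rw [← ht, ← hc]
  exact Γ.curve_mem_image h t

lemma transverse (hD : Describes vs es Γ) {m c : ℝ} (hv : ∀ z ∈ vs, slant m (toPlane z) ≠ c)
    (he : ∀ e ∈ es, ∀ z ∈ e.1 :: e.2, slant m (toPlane z) ≠ c) : Γ.Transverse m c where
  pos v := by
    obtain ⟨q, rfl, hq⟩ := hD.exists_vertices
    rw [← hq]
    exact hv _ ((List.mem_ofFn' _ _).2 ⟨v, rfl⟩)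
  curve {u v} h := by
    obtain ⟨e, hes, hc⟩ := hD.complete u v h
    have hT : TransverseLine m c (polyPath (toPlane e.1) (e.2.map toPlane)) := by
      refine transverseLine_polyPath fun z hz => ?_
      rw [← List.map_cons] at hz
      obtain ⟨w, hw, rfl⟩ := List.mem_map.1 hz
      exact he e hes w hw
    rcases hc with hc | hc
    · exact hT.congr hc
    · have := (hT.congr hc).symm
      rwa [← Γ.curve_symm] at this

lemma image_subset (hD : Describes vs es Γ) {S : Set ℂ} (hS : Convex ℝ S)
    (hv : ∀ z ∈ vs, toPlane z ∈ S) (he : ∀ e ∈ es, ∀ z ∈ e.1 :: e.2, toPlane z ∈ S) :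
    Γ.image ⊆ S := by
  have key : ∀ e ∈ es, ∀ t, polyPath (toPlane e.1) (e.2.map toPlane) t ∈ S := fun e hes t => by
    refine polyPath_mem_convex hS (fun z hz => ?_) t
    rw [← List.map_cons] at hz
    obtain ⟨w, hw, rfl⟩ := List.mem_map.1 hz
    exact he e hes w hw
  rintro _ (⟨v, rfl⟩ | ⟨u, v, h, t, rfl⟩)
  · obtain ⟨q, rfl, hq⟩ := hD.exists_vertices
    rw [← hq]
    exact hv _ ((List.mem_ofFn' _ _).2 ⟨v, rfl⟩)
  · obtain ⟨e, hes, hc | hc⟩ := hD.complete u v h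
    · rw [hc]
      exact key e hes t
    · have : Γ.curve h t = Γ.curve h.symm (unitInterval.symm t) := by
        rw [Γ.curve_symm h, Path.symm_apply, Function.comp_apply, unitInterval.symm_symm]
      rw [this, hc]
      exact key e hes _

lemma edge_ends {q : Fin n → ℚ × ℚ} (hq : ∀ v, toPlane (q v) = Γ.pos v)
    {e : (ℚ × ℚ) × List (ℚ × ℚ)} {u v : Fin n} {h : G.Adj u v}
    (hc : (Γ.curve h : I → ℂ) = polyPath (toPlane e.1) (e.2.map toPlane)) :
    e.1 = q u ∧ edgeEnd e = q v := by
  constructor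
  · apply toPlane_injective
    rw [hq, ← (Γ.curve h).source, hc, Path.source]
  · apply toPlane_injective
    rw [hq, ← (Γ.curve h).target, hc, Path.target, lastPoint_map]

theorem eulerPath_correct {p : ℚ × ℚ} (hD : Describes vs es Γ)
    (hodd : Γ.IsOddAround (toPlane p)) :
    ∃ L : List (ℚ × ℚ), Drawing.eulerPath (p, vs, es) = p :: L ∧
      lastPoint (toPlane p) (L.map toPlane) ∈ Γ.outerFace ∧
      Γ.IsOddEulerPath (polyPath (toPlane p) (L.map toPlane)) := by
  classical
  let d : Drawing := (p, vs, es)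
  have hp : p ∈ Drawing.points d := List.mem_cons_self
  have hv : ∀ z ∈ vs, z ∈ Drawing.points d := fun z hz =>
    List.mem_cons_of_mem _ (List.mem_append_left _ hz)
  have he : ∀ e ∈ es, ∀ z ∈ e.1 :: e.2, z ∈ Drawing.points d := fun e hes z hz =>
    List.mem_cons_of_mem _ (List.mem_append_right _ (List.mem_flatMap.2 ⟨e, hes, hz⟩))
  have hvp : ∀ z ∈ vs, z ≠ p := fun z hz h => hodd.1 (h ▸ hD.toPlane_mem_image hz)
  have hep : ∀ e ∈ es, ∀ z ∈ e.1 :: e.2, z ≠ p := fun e hes z hz h =>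
    hodd.1 (h ▸ hD.toPlane_corner_mem_image hes hz)
  have hray : Γ.Transverse (Drawing.slope d) (slant (Drawing.slope d) (toPlane p)) := by
    refine hD.transverse (fun z hz => ?_) (fun e hes z hz => ?_) <;>
      rw [slant_toPlane, slant_toPlane, Ne, Rat.cast_inj]
    · exact Drawing.slantRat_ne (hv z hz) hp (hvp z hz)
    · exact Drawing.slantRat_ne (he e hes z hz) hp (hep e hes z hz)
  obtain ⟨g, hg⟩ := hodd.exists_potential hray
  obtain ⟨q, hvs, hq⟩ := hD.exists_vertices
  have hqinj : Function.Injective q := fun u v h => Γ.pos_injective (by rw [← hq, ← hq, h])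
  have hqv : ∀ v, q v ∈ vs := fun v => by rw [hvs]; exact (List.mem_ofFn' _ _).2 ⟨v, rfl⟩
  -- The signs of a true potential, moved to rational points. The value `1` away from the vertices
  -- is never used.
  let τ : ℚ × ℚ → ℚ := Function.extend q (fun v => sgn (g v)) 1
  have hτ : ∀ v, τ (q v) = sgn (g v) := fun v => hqinj.extend_apply _ _ v
  have hsign : ∀ e ∈ es, e.1 ∈ vs ∧ edgeEnd e ∈ vs ∧
      Drawing.edgeSign d e = τ e.1 * τ (edgeEnd e) := fun e hes => by
    obtain ⟨u, v, h, hc⟩ := hD.edges e hes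
    obtain ⟨h1, h2⟩ := edge_ends hq hc
    refine ⟨h1 ▸ hqv u, h2 ▸ hqv v, ?_⟩
    rw [h2, h1, hτ, hτ, ← sgn_add, ← hg h, Embedding.edgeHits, hits_congr hc]
    exact Drawing.edgeSign_eq_sgn fun z hz =>
      Drawing.slantRat_ne (he e hes z hz) hp (hep e hes z hz)
  obtain ⟨S, hS, ⟨R, hR⟩, hSe⟩ := Drawing.exists_labels (d := d) (τ := τ) (fun z hz => by
    have hz' : z ∈ List.ofFn q := hvs ▸ (show z ∈ vs from hz)
    obtain ⟨v, rfl⟩ := (List.mem_ofFn' _ _).1 hz'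
    rw [hτ, sgn_mul_self]) hsign
  -- The potential that the algorithm found. It need not equal `g`, but it has the same sums on all
  -- edges, which is all that the construction of the path requires.
  let g' : Fin n → ZMod 2 := fun v => if S (q v) = 1 then 0 else 1
  have hg' : ∀ v, sgn (g' v) = S (q v) := fun v => by
    simp only [g']
    split_ifs with h
    · rw [sgn_zero, h]
    · rw [sgn_one]
      exact ((mul_self_eq_one_iff.1 (hS _ (hqv v))).resolve_left h).symm
  have hgg : ∀ {u v : Fin n} (h : G.Adj u v), g u + g v = g' u + g' v := fun {u v} h => by
    apply sgn_injective
    rw [sgn_add, sgn_add, hg', hg', ← hτ, ← hτ]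
    obtain ⟨e, hes, hc | hc⟩ := hD.complete u v h
    · obtain ⟨h1, h2⟩ := edge_ends hq hc
      rw [← h1, ← h2, hSe e hes]
    · obtain ⟨h1, h2⟩ := edge_ends hq hc
      rw [← h1, ← h2, mul_comm, ← hSe e hes, mul_comm]
  have habs : ∀ z ∈ Drawing.points d, |(toPlane z).im| < (Drawing.height d : ℝ) := fun z hz => by
    rw [toPlane_im]
    exact_mod_cast Drawing.abs_lt_height hz
  have hY : ∀ z ∈ Γ.image, |z.im| < (Drawing.height d : ℝ) := fun z hz => by
    have hconv : Convex ℝ (Complex.imLm ⁻¹' Ioo (-(Drawing.height d : ℝ)) (Drawing.height d)) :=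
      (convex_Ioo _ _).linear_preimage _
    exact abs_lt.2 (hD.image_subset hconv (fun z hz => abs_lt.1 (habs z (hv z hz)))
      (fun e hes z hz => abs_lt.1 (habs z (he e hes z hz))) hz)
  let c : Fin n → ℝ × ℝ := fun v =>
    (slant (Drawing.slope d) (Γ.pos v) - Drawing.margin d,
      slant (Drawing.slope d) (Γ.pos v) + Drawing.margin d)
  have hε : (0 : ℝ) < Drawing.margin d := by exact_mod_cast Drawing.margin_pos d
  -- The margin is positive and smaller than every gap between slanted lines through different
  -- points. Hence the sides of the box around `q v` avoid all corners, including `q v`, and enclose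
  -- no other vertex.
  have hgap : ∀ z ∈ Drawing.points d, ∀ v, slant (Drawing.slope d) (toPlane z) ≠ (c v).1 ∧
      slant (Drawing.slope d) (toPlane z) ≠ (c v).2 ∧ (z ≠ q v →
        slant (Drawing.slope d) (toPlane z) < (c v).1 ∨
          (c v).2 < slant (Drawing.slope d) (toPlane z)) := fun z hz v => by
    simp only [c, ← hq]
    by_cases hzv : z = q v
    · subst hzv
      exact ⟨by linarith, by linarith, fun h => absurd rfl h⟩
    · have h1 := Drawing.margin_lt hz (hv _ (hqv v)) hzv
      have h2 : (Drawing.margin d : ℝ) <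
          |slant (Drawing.slope d) (toPlane z) - slant (Drawing.slope d) (toPlane (q v))| := by
        rw [slant_toPlane, slant_toPlane]
        exact_mod_cast h1
      rcases lt_abs.1 h2 with h3 | h3
      · exact ⟨by linarith, by linarith, fun _ => .inr (by linarith)⟩
      · exact ⟨by linarith, by linarith, fun _ => .inl (by linarith)⟩
  have hiso : ∀ v, Γ.Isolates (Drawing.slope d) v (c v) := fun v => by
    refine ⟨hD.transverse (fun z hz => (hgap z (hv z hz) v).1)
      (fun e hes z hz => (hgap z (he e hes z hz) v).1),
      hD.transverse (fun z hz => (hgap z (hv z hz) v).2.1)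
      (fun e hes z hz => (hgap z (he e hes z hz) v).2.1),
      sub_lt_self _ hε, lt_add_of_pos_right _ hε, fun u hu => ?_⟩
    rw [← hq u]
    exact (hgap (q u) (hv _ (hqv u)) v).2.2 (hqinj.ne hu)
  have main := hray.isOddEulerPath_of_isolates hodd.1 hY ((le_abs_self _).trans_lt (habs p hp))
    (g := g') (fun h => (hg h).trans (hgg h))
    (vl := (List.finRange n).filter fun v => g' v = 1) ((List.nodup_finRange n).filter _)
    (fun v => by simp) (fun v _ => hiso v)
  refine ⟨_, rfl, ?_⟩
  -- The rational output of the program is matched with the real path of `main`. The sign test on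
  -- labels becomes the filter `g' v = 1`, and `List.ofFn q` puts the vertices in the same order.
  have hL : (slantPtRat (Drawing.slope d) (slantRat (Drawing.slope d) p) (Drawing.height d) ::
      (Drawing.labels d).flatMap fun w => if 0 < 0 - w.2.2 then Drawing.box d w.1 else []).map
        toPlane =
      slantPt (Drawing.slope d) (slant (Drawing.slope d) (toPlane p)) (Drawing.height d) ::
        ((List.finRange n).filter fun v => g' v = 1).flatMap fun v =>
          slantBox (Drawing.slope d) (Drawing.height d) (c v) := by
    rw [List.map_cons, toPlane_slantPtRat, slant_toPlane, flatMap_filter_eq, hR, List.map_flatMap,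
      List.flatMap_map]
    change _ :: vs.flatMap _ = _
    rw [hvs, List.ofFn_eq_map, List.flatMap_map]
    congr 2
    funext v
    have hSv : 0 < 0 - S (q v) ↔ g' v = 1 := by
      rw [← hg' v]
      rcases eq_zero_or_one (g' v) with h | h <;> rw [h]
      · norm_num [sgn_zero]
      · norm_num [sgn_one]
    simp only [hSv]
    split_ifs
    · simp only [Drawing.box, slantBox, c, List.map_cons, List.map_nil, toPlane_slantPtRat, ← hq,
        slant_toPlane]
      push_cast
      simp only [zero_sub]
    · rfl
  rw [← hL] at main
  exact main

end Describes

end OddEuler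

theorem mainTheorem8 :
    (∀ {V : Type*} [Finite V] (G : SimpleGraph V) (Γ : OddEuler.Embedding G) (p : ℂ),
      Γ.IsOddAround p →
        ∃ q ∈ Γ.outerFace, ∃ T : Path p q, Γ.IsOddEulerPath T) ∧
    (∃ (A : OddEuler.Prog OddEuler.Ty.drawing (OddEuler.Ty.list OddEuler.Ty.point))
        (P : Polynomial ℕ),
      (∀ d : OddEuler.Ty.drawing.Val, A.time d ≤ P.eval (OddEuler.Ty.drawing.size d)) ∧
      ∀ (p : OddEuler.Ty.point.Val) (vs : List OddEuler.Ty.point.Val)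
        (es : List (OddEuler.Ty.point.Val × List OddEuler.Ty.point.Val))
        {n : ℕ} (G : SimpleGraph (Fin n)) (Γ : OddEuler.Embedding G),
        OddEuler.Describes vs es Γ → Γ.IsOddAround (OddEuler.toPlane p) →
          ∃ L : List OddEuler.Ty.point.Val,
            A.eval (p, vs, es) = p :: L ∧
            OddEuler.lastPoint (OddEuler.toPlane p) (L.map OddEuler.toPlane) ∈ Γ.outerFace ∧
            Γ.IsOddEulerPath
              (OddEuler.polyPath (OddEuler.toPlane p) (L.map OddEuler.toPlane))) := by
  refine ⟨fun G Γ p hodd => hodd.exists_oddEulerPath, ?_⟩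
  obtain ⟨A, hA, P, hP⟩ := OddEuler.PolyTime.eulerPath
  refine ⟨A, P, hP, fun p vs es n G Γ hD hodd => ?_⟩
  rw [hA]
  exact hD.eulerPath_correct hodd
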